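/- All Hilbert spaces are finite-dimensional and all logarithms (hence all entropies) are to base $q$. Let $\mathcal W=\mathbb F_q$ be a finite field with $q$ elements, $\rho$ a density operator on $\mathcal H_A$, and $\lambda=\{\lambda_y\}_{y\in\mathcal Y}$ a POVM on $\mathcal H_A$ with finite outcome set. For a state $\sigma=\sum_i\gamma_i|u_i\rangle\langle u_i|$ (spectral decomposition) let $|\phi_\sigma\rangle=\sum_i\sqrt{\gamma_i}\,|\overline{u_i}\rangle\otimes|u_i\rangle$ be its canonical purification (conjugation in a fixed orthonormal basis), and for a POVM $\theta$ let $\mathscr E^\theta(s)=\sum_o\mathrm{tr}(s\theta_o)|o\rangle\langle o|$. Let $\mu=\{\mu_w\}_{w\in\mathbb F_q}$ be a POVM on $\mathcal H_A$ and $p_{Y|W}$ a stochastic matrix such that measuring $\mu$ on the $A$-part of $|\phi_\rho\rangle$ and passing the outcome through $p_{Y|W}$ yields $(i\otimes\mathscr E^{\lambda})(|\phi_\rho\rangle\langle\phi_\rho|)$. Put $$p_W(w)=\mathrm{tr}(\rho\mu_w),\quad \beta_w=\frac{\sqrt\rho\,\mu_w\sqrt\rho}{p_W(w)},\quad \gamma_w=\sum_y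 p_{Y|W}(y|w)\,\beta_w\otimes|y\rangle\langle y|,$$ and let $\mathscr{RC}=\chi(\gamma_w;p_W)$, $\mathscr R=\chi(\beta_w;p_W)$ be the Holevo informations and $H(p_W)$ the Shannon entropy. For a map $\hat c:[K]\times[M]\times[B]\to\mathbb F_q^n$ put $\omega=\rho^{\otimes n}$, $\mu_{k,m,b}=\mu_{\hat c(k,m,b)_1}\otimes\cdots\otimes\mu_{\hat c(k,m,b)_n}$, $$\hat S_k=\sum_{m,b}\frac{\sqrt\omega\,\mu_{k,m,b}\sqrt\omega}{\mathrm{tr}(\omega\mu_{k,m,b})},\qquad \hat\theta_{k,m,b}=\frac{\hat S_k^{-1/2}\sqrt\omega\,\mu_{k,m,b}\sqrt\omega\,\hat S_k^{-1/2}}{\mathrm{tr}(\omega\mu_{k,m,b})},$$ with generalized inverses ($0$ on the null space), terms with $\mathrm{tr}(\omega\mu_{k,m,b})=0$ being read as $0$, and let $\hat\theta$ be the family $\{\hat\theta_{k,m,b}\otimes|k\rangle\langle k|\}$ completed, for each $k$, by one extra outcome $0$ with operator $(I-\sum_{m,b}\hat\theta_{k,m,b})\otimes|k\rangle\langle k|$.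 It is applied to the $A^nK$-part of the canonical purification of $\frac1K\sum_k\rho^{\otimes n}\otimes|k\rangle\langle k|$; the component $b$ of the outcome is discarded, and a decoder applies to $k$ and $m\in[M]\cup\{0\}$ a POVM $\Delta$ with outcomes in $\mathcal Y^n$; tracing out the reference copy of $K$ leaves a state $\alpha_S$. Say that $\hat c$ *$\eta$-simulates* if $\hat\theta$ is a POVM and, for some $\Delta$, $\|\alpha_O-\alpha_S\|_1\le\eta$, where $\alpha_O=(i\otimes\mathscr E^{\lambda^{\otimes n}})(|\phi_{\rho^{\otimes n}}\rangle\langle\phi_{\rho^{\otimes n}}|)$. Call $c,r,\beta\ge0$ *admissible* if $$c+r+\beta>\mathscr{RC}+\log q-H(p_W),\qquad r+\beta>\mathscr R+\log q-H(p_W),\qquad \beta\le\log q-H(p_W).$$ **Theorem.** (1) Let $c,r,\beta$ be admissible. For every $\eta>0$ and all sufficiently large $n$, with $K=\lceil q^{nc}\rceil$, $M=\lceil q^{nr}\rceil$, $B=\lceil q^{n\beta}\rceil$, there is a map $\hat c:[K]\times[M]\times[B]\to\mathbb F_q^n$ whose range is a coset of a linear code and which $\eta$-simulates, and $\frac{\log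 K}{n}\le c+\eta$, $\frac{\log (M+1)}{n}\le r+\eta$. (2) The communication cost $(\mathscr{RC},\mathscr R)$ is attained: for every $\eta>0$ there are admissible $c,r,\beta$ such that for all sufficiently large $n$, with $K,M,B$ as in (1), there is such an $\eta$-simulating $\hat c$, and $\frac{\log K}{n}\le\mathscr{RC}+\eta$, in fact $\frac{\log (K(M+1))}{n}\le\mathscr{RC}+\eta$, and $\frac{\log (M+1)}{n}\le\mathscr R+\eta$. -/

import Mathlib

open scoped Kronecker ComplexOrder

noncomputable section

namespace POVMSim

/-! Operators on a finite-dimensional Hilbert space with a fixed orthonormal basis indexed by a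
finite type `H` are matrices `Matrix H H ℂ`; the space `H₁ ⊗ H₂` is indexed by `H₁ × H₂`, and the
`n`-fold tensor power of `H` by `Fin n → H`. -/

section Operators

variable {H : Type*} [Fintype H] [DecidableEq H]

/-- Positive square root of a positive operator (functional calculus). -/
def sqrtOp (σ : Matrix H H ℂ) : Matrix H H ℂ := cfc Real.sqrt σ

/-- Generalized inverse of the square root of a positive operator: on the eigenspace of an
eigenvalue `x` it is `1 / √x` if `x > 0` and it is `0` on the null space, since `0⁻¹ = 0`. -/
def invSqrtOp (σ : Matrix H H ℂ) : Matrix H H ℂ := cfc (fun x : ℝ => (Real.sqrt x)⁻¹) σ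

/-- Trace norm `‖T‖₁ = tr √(T† T)`. -/
def traceNorm (T : Matrix H H ℂ) : ℝ := (sqrtOp (T.conjTranspose * T)).trace.re

/-- Von Neumann entropy `-tr (σ log σ)`, logarithm to base `b`. -/
def vnEntropy (b : ℝ) (σ : Matrix H H ℂ) : ℝ :=
  (cfc (fun x : ℝ => -(x * Real.logb b x)) σ).trace.re

/-- Density operators. -/
def IsDensity (σ : Matrix H H ℂ) : Prop := σ.PosSemidef ∧ σ.trace = 1

/-- POVMs on `H` with outcome set `O`. -/
def IsPOVM {O : Type*} [Fintype O] (lam : O → Matrix H H ℂ) : Prop :=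
  (∀ o, (lam o).PosSemidef) ∧ ∑ o, lam o = 1

/-- Canonical purification `|φ_σ⟩ ∈ X ⊗ H`, `X = H`: if `σ = ∑ i, γ i |u i⟩⟨u i|` then
`|φ_σ⟩ = ∑ i, √(γ i) |conj (u i)⟩ ⊗ |u i⟩`. Its coordinate at `(x, a)` is the matrix entry
`⟨a| √σ |x⟩`; see `canonicalPurification_eq`. -/
def canonicalPurification (σ : Matrix H H ℂ) : H × H → ℂ := fun xa => sqrtOp σ xa.2 xa.1

theorem canonicalPurification_eq (σ : Matrix H H ℂ) (hσ : σ.IsHermitian) (x a : H) :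
    canonicalPurification σ (x, a) =
      ∑ i, (Real.sqrt (hσ.eigenvalues i) : ℂ) *
        (star (hσ.eigenvectorBasis i x) * hσ.eigenvectorBasis i a) := by
  simp only [canonicalPurification, sqrtOp, hσ.cfc_eq, Matrix.IsHermitian.cfc,
    Unitary.conjStarAlgAut_apply]
  rw [Matrix.mul_apply]
  refine Finset.sum_congr rfl fun i _ => ?_
  rw [Matrix.mul_diagonal, Matrix.star_apply, Matrix.IsHermitian.eigenvectorUnitary_apply,
    Matrix.IsHermitian.eigenvectorUnitary_apply]
  simp only [Function.comp_apply, Complex.coe_algebraMap]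
  ring

/-- The rank-one operator `|φ⟩⟨φ|`. -/
def ketbra (φ : H → ℂ) : Matrix H H ℂ := Matrix.vecMulVec φ (star φ)

/-- `T 0 ⊗ ⋯ ⊗ T (n - 1)`. -/
def tensorFamily {n : ℕ} (T : Fin n → Matrix H H ℂ) : Matrix (Fin n → H) (Fin n → H) ℂ :=
  Matrix.of fun i j => ∏ t, T t (i t) (j t)

/-- `σ^{⊗ n}`. -/
def tensorPow (n : ℕ) (σ : Matrix H H ℂ) : Matrix (Fin n → H) (Fin n → H) ℂ :=
  tensorFamily fun _ => σ

/-- The operators `λ_{y₁} ⊗ ⋯ ⊗ λ_{yₙ}`, `yⁿ ∈ Oⁿ`. -/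
def productPOVM {O : Type*} (n : ℕ) (lam : O → Matrix H H ℂ) :
    (Fin n → O) → Matrix (Fin n → H) (Fin n → H) ℂ :=
  fun y => tensorFamily fun t => lam (y t)

end Operators

section Channels

variable {H : Type*} [Fintype H] [DecidableEq H]

/-- The measurement map `s ↦ ∑ y, tr (s λ_y) |y⟩⟨y|`. -/
def measMap {O : Type*} [DecidableEq O] (lam : O → Matrix H H ℂ) :
    Matrix H H ℂ →ₗ[ℂ] Matrix O O ℂ where
  toFun s := Matrix.diagonal fun o => (s * lam o).trace
  map_add' s t := by
    simp only [add_mul, Matrix.trace_add, Matrix.diagonal_add]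
  map_smul' z s := by
    ext i j
    by_cases h : i = j <;> simp [h]

/-- The map `a ↦ ∑ (w, y), p(y|w) |y⟩⟨w| a |w⟩⟨y|` of a stochastic matrix. -/
def stochMap {W Y : Type*} [Fintype W] [DecidableEq Y] (p : W → Y → ℝ) :
    Matrix W W ℂ →ₗ[ℂ] Matrix Y Y ℂ where
  toFun a := Matrix.diagonal fun y => ∑ w, (p w y : ℂ) * a w w
  map_add' s t := by
    simp only [Matrix.add_apply, mul_add, Finset.sum_add_distrib, Matrix.diagonal_add]
  map_smul' z s := by
    ext i j
    by_cases h : i = j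
    · simp only [h, Matrix.diagonal_apply_eq, Matrix.smul_apply, smul_eq_mul, RingHom.id_apply,
        Finset.mul_sum]
      exact Finset.sum_congr rfl fun w _ => by ring
    · simp [h]

/-- `i_X ⊗ E`: the map `E` applied blockwise to an operator on `X ⊗ H₁`. -/
def idTensor (X : Type*) {H₁ H₂ : Type*} (E : Matrix H₁ H₁ ℂ →ₗ[ℂ] Matrix H₂ H₂ ℂ)
    (s : Matrix (X × H₁) (X × H₁) ℂ) : Matrix (X × H₂) (X × H₂) ℂ :=
  Matrix.of fun i j => E (Matrix.of fun h h' => s (i.1, h) (j.1, h')) i.2 j.2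

/-- `i_X ⊗ tr_K ⊗ i_Y` on operators on `(X ⊗ K) ⊗ Y`. -/
def traceMiddle {X K Y : Type*} [Fintype K] (s : Matrix ((X × K) × Y) ((X × K) × Y) ℂ) :
    Matrix (X × Y) (X × Y) ℂ :=
  Matrix.of fun i j => ∑ k, s ((i.1, k), i.2) ((j.1, k), j.2)

end Channels

section TestTriples

variable {A Y W : Type*} [Fintype A] [DecidableEq A] [Fintype Y] [DecidableEq Y]
  [Fintype W] [DecidableEq W]

/-- `p w y = p(y|w)` is a stochastic matrix. -/
def IsStochastic (p : W → Y → ℝ) : Prop := (∀ w y, 0 ≤ p w y) ∧ ∀ w, ∑ y, p w y = 1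

/-- `(W, μ, p_{Y|W}) ∈ 𝒞(ρ, λ)`: the measurement `μ` followed by the classical channel `p_{Y|W}`
acts on the canonical purification of `ρ` exactly as `λ` does. -/
def IsTestTriple (ρ : Matrix A A ℂ) (lam : Y → Matrix A A ℂ) (mu : W → Matrix A A ℂ)
    (p : W → Y → ℝ) : Prop :=
  IsPOVM mu ∧ IsStochastic p ∧
    idTensor A (stochMap p) (idTensor A (measMap mu) (ketbra (canonicalPurification ρ))) =
      idTensor A (measMap lam) (ketbra (canonicalPurification ρ))

/-- `p_W(w) = tr (ρ μ_w)`. -/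
def pW (ρ : Matrix A A ℂ) (mu : W → Matrix A A ℂ) (w : W) : ℝ := (ρ * mu w).trace.re

/-- `β_w = √ρ μ_w √ρ / p_W(w)` (it is `0` if `p_W(w) = 0`). -/
def betaState (ρ : Matrix A A ℂ) (mu : W → Matrix A A ℂ) (w : W) : Matrix A A ℂ :=
  (((pW ρ mu w)⁻¹ : ℝ) : ℂ) • (sqrtOp ρ * mu w * sqrtOp ρ)

/-- `γ_w = ∑ y, p(y|w) β_w ⊗ |y⟩⟨y|`. -/
def gammaState (ρ : Matrix A A ℂ) (mu : W → Matrix A A ℂ) (p : W → Y → ℝ) (w : W) :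
    Matrix (A × Y) (A × Y) ℂ :=
  ∑ y, (p w y : ℂ) • (betaState ρ mu w ⊗ₖ Matrix.single y y (1 : ℂ))

/-- Shannon entropy, logarithm to base `b`. -/
def shannon (b : ℝ) (P : W → ℝ) : ℝ := -∑ w, P w * Real.logb b (P w)

/-- Holevo information `S(∑ w, P(w) s_w) - ∑ w, P(w) S(s_w)`, logarithm to base `b`. -/
def holevo {H : Type*} [Fintype H] [DecidableEq H] (b : ℝ) (s : W → Matrix H H ℂ) (P : W → ℝ) :
    ℝ :=
  vnEntropy b (∑ w, (P w : ℂ) • s w) - ∑ w, P w * vnEntropy b (s w)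

/-- The total rate `ℛ𝒞(W, μ, p_{Y|W}) = χ(γ_w; p_W)`. -/
def rateRC (b : ℝ) (ρ : Matrix A A ℂ) (mu : W → Matrix A A ℂ) (p : W → Y → ℝ) : ℝ :=
  holevo b (gammaState ρ mu p) (pW ρ mu)

/-- The message rate `ℛ(W, μ, p_{Y|W}) = χ(β_w; p_W)`. -/
def rateR (b : ℝ) (ρ : Matrix A A ℂ) (mu : W → Matrix A A ℂ) : ℝ :=
  holevo b (betaState ρ mu) (pW ρ mu)

end TestTriples

section Protocol

variable {A Y W : Type*} [Fintype A] [DecidableEq A] [Fintype Y] [DecidableEq Y]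

/-- `√ω μ_{k,m,b} √ω / tr (ω μ_{k,m,b})` for the codeword `w = ĉ(k,m,b)`, where `ω = ρ^{⊗ n}` and
`μ_{k,m,b} = μ_{w₁} ⊗ ⋯ ⊗ μ_{wₙ}` (it is `0` if the denominator vanishes, for then the numerator
vanishes too). -/
def codewordOp (ρ : Matrix A A ℂ) (mu : W → Matrix A A ℂ) {n : ℕ} (w : Fin n → W) :
    Matrix (Fin n → A) (Fin n → A) ℂ :=
  ((tensorPow n ρ * productPOVM n mu w).trace)⁻¹ •
    (sqrtOp (tensorPow n ρ) * productPOVM n mu w * sqrtOp (tensorPow n ρ))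

/-- `Ŝ_k`. -/
def sHat (ρ : Matrix A A ℂ) (mu : W → Matrix A A ℂ) {n K M B : ℕ}
    (c : Fin K × Fin M × Fin B → (Fin n → W)) (k : Fin K) :
    Matrix (Fin n → A) (Fin n → A) ℂ :=
  ∑ mb : Fin M × Fin B, codewordOp ρ mu (c (k, mb))

/-- `θ̂_{k,m,b} = Ŝ_k^{-1/2} (√ω μ_{k,m,b} √ω / tr (ω μ_{k,m,b})) Ŝ_k^{-1/2}`. -/
def thetaHat (ρ : Matrix A A ℂ) (mu : W → Matrix A A ℂ) {n K M B : ℕ}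
    (c : Fin K × Fin M × Fin B → (Fin n → W)) (k : Fin K) (mb : Fin M × Fin B) :
    Matrix (Fin n → A) (Fin n → A) ℂ :=
  invSqrtOp (sHat ρ mu c k) * codewordOp ρ mu (c (k, mb)) * invSqrtOp (sHat ρ mu c k)

/-- The measurement performed when the common randomness is `k`: the operators `θ̂_{k,m,b}`,
completed by the operator `I - ∑ θ̂_{k,m,b}` of one further outcome `none` (the outcome "0"). -/
def thetaFull (ρ : Matrix A A ℂ) (mu : W → Matrix A A ℂ) {n K M B : ℕ}
    (c : Fin K × Fin M × Fin B → (Fin n → W)) (k : Fin K) :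
    Option (Fin M × Fin B) → Matrix (Fin n → A) (Fin n → A) ℂ
  | none => 1 - ∑ mb, thetaHat ρ mu c k mb
  | some mb => thetaHat ρ mu c k mb

/-- Only the component `m` of the outcome `(m, b)` is sent: the operators of the coarse-grained
measurement, with outcomes in `[M] ∪ {0}`. -/
def thetaSent (ρ : Matrix A A ℂ) (mu : W → Matrix A A ℂ) {n K M B : ℕ}
    (c : Fin K × Fin M × Fin B → (Fin n → W)) (k : Fin K) (m : Option (Fin M)) :
    Matrix (Fin n → A) (Fin n → A) ℂ :=
  ∑ o : Option (Fin M × Fin B) with o.map Prod.fst = m, thetaFull ρ mu c k o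

/-- The operators `θ_{k,o} ⊗ |k⟩⟨k|`. -/
def controlled {H O : Type*} {K : ℕ} (th : Fin K → O → Matrix H H ℂ) :
    Fin K × O → Matrix (H × Fin K) (H × Fin K) ℂ :=
  fun ko => th ko.1 ko.2 ⊗ₖ Matrix.single ko.1 ko.1 (1 : ℂ)

/-- `ρ_K^{⊗ n} = (1/K) ∑ k, ρ^{⊗ n} ⊗ |k⟩⟨k|`. -/
def inputState (n K : ℕ) (ρ : Matrix A A ℂ) :
    Matrix ((Fin n → A) × Fin K) ((Fin n → A) × Fin K) ℂ :=
  (K : ℂ)⁻¹ • ∑ k : Fin K, tensorPow n ρ ⊗ₖ Matrix.single k k (1 : ℂ)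

/-- Joint state of reference and outcome for the original measurement `λ^{⊗ n}`. -/
def alphaO (n : ℕ) (ρ : Matrix A A ℂ) (lam : Y → Matrix A A ℂ) :
    Matrix ((Fin n → A) × (Fin n → Y)) ((Fin n → A) × (Fin n → Y)) ℂ :=
  idTensor (Fin n → A) (measMap (productPOVM n lam))
    (ketbra (canonicalPurification (tensorPow n ρ)))

/-- Joint state of reference and outcome for the simulation by the measurements
`{θ_{k,m}}_m`, `k ∈ [K]`, and the decoder POVM `Δ` on `H_K ⊗ H_M`. -/
def alphaS {n K : ℕ} {O : Type*} [Fintype O] [DecidableEq O] (ρ : Matrix A A ℂ)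
    (th : Fin K → O → Matrix (Fin n → A) (Fin n → A) ℂ)
    (Δ : (Fin n → Y) → Matrix (Fin K × O) (Fin K × O) ℂ) :
    Matrix ((Fin n → A) × (Fin n → Y)) ((Fin n → A) × (Fin n → Y)) ℂ :=
  traceMiddle
    (idTensor ((Fin n → A) × Fin K) (measMap Δ)
      (idTensor ((Fin n → A) × Fin K) (measMap (controlled th))
        (ketbra (canonicalPurification (inputState n K ρ)))))

/-- `S ⊆ Fⁿ` is a coset of a linear code. -/
def IsCosetOfLinearCode {F : Type*} [Field F] {n : ℕ} (S : Set (Fin n → F)) : Prop :=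
  ∃ (C : Submodule F (Fin n → F)) (v : Fin n → F), S = (fun x => v + x) '' (C : Set (Fin n → F))

/-- At block length `n`, some table `ĉ : [K] × [M] × [B] → Fⁿ` whose range is a coset of a linear
code gives a POVM `θ̂` which, together with some decoder POVM that sees `k` and `m` only,
reproduces `λ^{⊗ n}` on `ρ^{⊗ n}` up to `η` in trace norm. -/
def CosetSimulates {F : Type*} [Field F] (ρ : Matrix A A ℂ) (lam : Y → Matrix A A ℂ)
    (mu : F → Matrix A A ℂ) (n K M B : ℕ) (η : ℝ) : Prop :=
  ∃ c : Fin K × Fin M × Fin B → (Fin n → F),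
    IsCosetOfLinearCode (Set.range c) ∧
    IsPOVM (controlled (thetaFull ρ mu c)) ∧
    ∃ Δ : (Fin n → Y) → Matrix (Fin K × Option (Fin M)) (Fin K × Option (Fin M)) ℂ,
      IsPOVM Δ ∧ traceNorm (alphaO n ρ lam - alphaS ρ (thetaSent ρ mu c) Δ) ≤ η

/-- The size `⌈q^{n x}⌉` of an index set of rate `x`. -/
def indexSize (q n : ℕ) (x : ℝ) : ℕ := ⌈(q : ℝ) ^ ((n : ℝ) * x)⌉₊

/-- The conditions on the rates `c`, `r`, `β`; logarithms to base `q = |F|`. -/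
structure AdmissibleRates {F : Type*} [Field F] [Fintype F] [DecidableEq F] (ρ : Matrix A A ℂ)
    (mu : F → Matrix A A ℂ) (p : F → Y → ℝ) (c r β : ℝ) : Prop where
  c_nonneg : 0 ≤ c
  r_nonneg : 0 ≤ r
  β_nonneg : 0 ≤ β
  β_le : β ≤ Real.logb (Fintype.card F) (Fintype.card F) - shannon (Fintype.card F) (pW ρ mu)
  total_gt : c + r + β > rateRC (Fintype.card F) ρ mu p +
    Real.logb (Fintype.card F) (Fintype.card F) - shannon (Fintype.card F) (pW ρ mu)
  message_gt : r + β > rateR (Fintype.card F) ρ mu +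
    Real.logb (Fintype.card F) (Fintype.card F) - shannon (Fintype.card F) (pW ρ mu)

end Protocol

end POVMSim

end

open scoped Kronecker ComplexOrder

noncomputable section

set_option linter.unusedSectionVars false

/-! Let w(k,m) be words in F^n. They simulate the measurement as soon as two averages are close to
their means: on average over k, the states β of the words w(k,m), averaged over m, are close to
ρ^⊗n; and the states γ, averaged over (k,m), are close to the n-fold mean of γ. The first makes the
square-root measurement reproduce the ensemble β on the purification (`sum_tn_prettyGood_le`, from
Powers–Størmer and Cauchy–Schwarz). The second makes the output right once the decoder draws from
p^n(·|w(k,m)) (`exists_decoder`).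

Such words come from random coding. After a restriction to typical subspaces (`exists_isSmoothing`),
the Hilbert–Schmidt variance of an average needs only pairwise independence, and trace norm is at
most the root of dimension times variance (`IsSmoothing.covering`). So a number of words
exponentially above q^(nχ) suffices, χ being the Holevo information.

A random affine map over F gives pairwise independent words, but uniform ones. Binning corrects the
law: some linear code of rate slightly above 1 - H(p_W) has cosets of nearly equal p_W^n-mass
(`exists_uniform_bins`). The random affine map picks a coset, and a word is drawn inside it from the
conditional law (`PairwiseLaw.select`). The words stay pairwise independent, with law close to
p_W^n.

All candidate words lie in one affine code, whose rate is just below c + r + β. The table therefore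
repeats w(k,m) for every b, and a vanishing fraction of its entries is overwritten so that the whole
code occurs (`exists_table`). The index b carries no information; it only supplies room for the
coset.

The corner point needs 0 ≤ R ≤ RC and H(p_W) ≤ log q. The inequality R ≤ RC is obtained
operationally: a covering by γ-states is one by β-states, and a rank count (`IsSmoothing.converse`)
shows that a covering cannot use far fewer than q^(nχ) words (`holevo_le_holevo_of_covering`). -/

namespace POVMSim

/-! ### Trace norm by duality with contractions; spectral calculus -/

section TraceNormTheory

variable {H : Type*} [Fintype H]

/-- Squared Euclidean norm of a vector. -/
def vecSq (v : H → ℂ) : ℝ := ∑ i, ‖v i‖ ^ 2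

/-- Squared Hilbert–Schmidt norm. -/
def hsSq (T : Matrix H H ℂ) : ℝ := ∑ i, ∑ j, ‖T i j‖ ^ 2

lemma hsSq_nonneg (T : Matrix H H ℂ) : 0 ≤ hsSq T :=
  Finset.sum_nonneg fun _ _ => Finset.sum_nonneg fun _ _ => sq_nonneg _

lemma hsSq_transpose (T : Matrix H H ℂ) : hsSq T.transpose = hsSq T := by
  unfold hsSq; rw [Finset.sum_comm]; rfl

lemma hsSq_conjTranspose (T : Matrix H H ℂ) : hsSq T.conjTranspose = hsSq T := by
  unfold hsSq; rw [Finset.sum_comm]; simp [Matrix.conjTranspose_apply]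

lemma hsSq_eq_trace (T : Matrix H H ℂ) : hsSq T = (T * T.conjTranspose).trace.re := by
  simp only [hsSq, Matrix.trace, Matrix.diag, Matrix.mul_apply, Matrix.conjTranspose_apply,
    Complex.re_sum]
  refine Finset.sum_congr rfl fun i _ => Finset.sum_congr rfl fun j _ => ?_
  rw [← Complex.normSq_eq_norm_sq, Complex.star_def, Complex.mul_conj, Complex.ofReal_re]

lemma hsSq_eq_sum_vecSq (T : Matrix H H ℂ) : hsSq T = ∑ j, vecSq (fun i => T i j) := by
  unfold hsSq vecSq; rw [Finset.sum_comm]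

/-- Cauchy–Schwarz for the Hilbert–Schmidt inner product. -/
lemma abs_re_trace_mul_le (S T : Matrix H H ℂ) :
    |(S * T).trace.re| ≤ √(hsSq S) * √(hsSq T) := by
  have h1 : |(S * T).trace.re| ≤ ∑ x : H × H, ‖S x.1 x.2‖ * ‖T x.2 x.1‖ := by
    refine (Complex.abs_re_le_norm _).trans ?_
    simp only [Matrix.trace, Matrix.diag, Matrix.mul_apply]
    rw [← Finset.sum_product' (s := Finset.univ) (t := Finset.univ)
      (f := fun i j => S i j * T j i)]
    refine (norm_sum_le _ _).trans ?_
    simp [Finset.univ_product_univ]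
  refine h1.trans ?_
  refine (Real.sum_mul_le_sqrt_mul_sqrt _ _ _).trans (le_of_eq ?_)
  congr 2
  · rw [hsSq, Fintype.sum_prod_type]
  · rw [← hsSq_transpose, hsSq, Fintype.sum_prod_type]; rfl

/-- Contractions, described by their action and the action of their transposes on vectors. -/
def IsContr (C : Matrix H H ℂ) : Prop :=
  (∀ v, vecSq (C.mulVec v) ≤ vecSq v) ∧ ∀ v, vecSq (C.transpose.mulVec v) ≤ vecSq v

lemma IsContr.transpose {C : Matrix H H ℂ} (hC : IsContr C) : IsContr C.transpose :=
  ⟨hC.2, by simpa using hC.1⟩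

lemma IsContr.hsSq_mul_le {C : Matrix H H ℂ} (hC : IsContr C) (T : Matrix H H ℂ) :
    hsSq (C * T) ≤ hsSq T := by
  rw [hsSq_eq_sum_vecSq, hsSq_eq_sum_vecSq]
  exact Finset.sum_le_sum fun j _ => hC.1 _

lemma IsContr.hsSq_mul_le' {C : Matrix H H ℂ} (hC : IsContr C) (T : Matrix H H ℂ) :
    hsSq (T * C) ≤ hsSq T := by
  rw [← hsSq_transpose, Matrix.transpose_mul, ← hsSq_transpose T]
  exact hC.transpose.hsSq_mul_le _

lemma IsContr.mul {C D : Matrix H H ℂ} (hC : IsContr C) (hD : IsContr D) : IsContr (C * D) := by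
  refine ⟨fun v => ?_, fun v => ?_⟩
  · rw [← Matrix.mulVec_mulVec]; exact (hC.1 _).trans (hD.1 _)
  · rw [Matrix.transpose_mul, ← Matrix.mulVec_mulVec]; exact (hD.2 _).trans (hC.2 _)

lemma IsContr.neg {C : Matrix H H ℂ} (hC : IsContr C) : IsContr (-C) := by
  refine ⟨fun v => ?_, fun v => ?_⟩
  · simpa [vecSq, Matrix.neg_mulVec] using hC.1 v
  · simpa [vecSq, Matrix.neg_mulVec, Matrix.transpose_neg] using hC.2 v

lemma vecSq_star (v : H → ℂ) : vecSq (star v) = vecSq v := by simp [vecSq]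

/-- The transpose of a Hermitian matrix is its entrywise conjugate, and conjugating vectors
preserves `vecSq`. -/
lemma isContr_of_isHermitian {C : Matrix H H ℂ} (hC : C.IsHermitian)
    (h : ∀ v, vecSq (C.mulVec v) ≤ vecSq v) : IsContr C := by
  refine ⟨h, fun v => ?_⟩
  have e : C.transpose.mulVec v = star (C.mulVec (star v)) := by
    rw [Matrix.star_mulVec, star_star, hC.eq, Matrix.mulVec_transpose]
  rw [e, vecSq_star, ← vecSq_star v]
  exact h _

lemma vecSq_eq (v : H → ℂ) : vecSq v = (star v ⬝ᵥ v).re := by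
  simp only [vecSq, dotProduct, Complex.re_sum]
  refine Finset.sum_congr rfl fun j _ => ?_
  rw [← Complex.normSq_eq_norm_sq, Pi.star_apply, Complex.star_def, mul_comm, Complex.mul_conj,
    Complex.ofReal_re]

lemma re_trace_nonneg {β : Matrix H H ℂ} (hβ : β.PosSemidef) : 0 ≤ β.trace.re :=
  (Complex.nonneg_iff.1 hβ.trace_nonneg).1

lemma trace_eq_re {β : Matrix H H ℂ} (hβ : β.IsHermitian) : β.trace = (β.trace.re : ℂ) := by
  refine (Complex.conj_eq_iff_re.1 ?_).symm
  rw [← Complex.star_def, ← Matrix.trace_conjTranspose, hβ.eq]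

variable [DecidableEq H]

lemma isContr_one : IsContr (1 : Matrix H H ℂ) := by
  constructor <;> intro v <;> simp

lemma vecSq_unitary_mulVec (U : Matrix H H ℂ) (hU : U.conjTranspose * U = 1) (v : H → ℂ) :
    vecSq (U.mulVec v) = vecSq v := by
  rw [vecSq_eq, vecSq_eq, Matrix.star_mulVec, Matrix.dotProduct_mulVec, Matrix.vecMul_vecMul, hU,
    Matrix.vecMul_one]

/-- The Hermitian operator with eigenbasis `U` and eigenvalues `d`. -/
def specOp (U : Matrix H H ℂ) (d : H → ℝ) : Matrix H H ℂ :=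
  U * Matrix.diagonal (fun i => (d i : ℂ)) * U.conjTranspose

/-- Unitary matrices, as a plain predicate. -/
def IsUnitaryMat (U : Matrix H H ℂ) : Prop := U.conjTranspose * U = 1 ∧ U * U.conjTranspose = 1

lemma specOp_isHermitian (U : Matrix H H ℂ) (d : H → ℝ) : (specOp U d).IsHermitian := by
  unfold specOp
  rw [Matrix.IsHermitian, Matrix.conjTranspose_mul, Matrix.conjTranspose_mul,
    Matrix.conjTranspose_conjTranspose, Matrix.diagonal_conjTranspose, ← mul_assoc]
  congr 3
  ext i; simp

lemma specOp_mul {U : Matrix H H ℂ} (hU : IsUnitaryMat U) (d e : H → ℝ) :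
    specOp U d * specOp U e = specOp U (fun i => d i * e i) := by
  unfold specOp
  calc _ = U * Matrix.diagonal (fun i => (d i : ℂ)) * (U.conjTranspose * U) *
        Matrix.diagonal (fun i => (e i : ℂ)) * U.conjTranspose := by simp only [mul_assoc]
    _ = _ := by
      rw [hU.1, mul_one, mul_assoc U, Matrix.diagonal_mul_diagonal]; simp

lemma specOp_sub (U : Matrix H H ℂ) (d e : H → ℝ) :
    specOp U d - specOp U e = specOp U (fun i => d i - e i) := by
  unfold specOp
  rw [← sub_mul, ← mul_sub, Matrix.diagonal_sub]; simp

lemma specOp_one {U : Matrix H H ℂ} (hU : IsUnitaryMat U) : specOp U (fun _ => 1) = 1 := by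
  unfold specOp; simp [hU.2]

lemma specOp_smul (U : Matrix H H ℂ) (c : ℝ) (d : H → ℝ) :
    specOp U (fun i => c * d i) = (c : ℂ) • specOp U d := by
  unfold specOp
  rw [← Matrix.smul_mul, ← Matrix.mul_smul, ← Matrix.diagonal_smul]
  congr 3; ext i; simp

lemma specOp_trace {U : Matrix H H ℂ} (hU : IsUnitaryMat U) (d : H → ℝ) :
    (specOp U d).trace = ((∑ i, d i : ℝ) : ℂ) := by
  unfold specOp
  rw [Matrix.trace_mul_comm, ← mul_assoc, hU.1, one_mul, Matrix.trace_diagonal]; simp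

lemma specOp_posSemidef (U : Matrix H H ℂ) {d : H → ℝ} (hd : ∀ i, 0 ≤ d i) :
    (specOp U d).PosSemidef := by
  refine Matrix.PosSemidef.mul_mul_conjTranspose_same (Matrix.PosSemidef.diagonal ?_) U
  intro i; simpa using hd i

lemma isContr_specOp {U : Matrix H H ℂ} (hU : IsUnitaryMat U) {d : H → ℝ} (hd : ∀ i, |d i| ≤ 1) :
    IsContr (specOp U d) := by
  refine isContr_of_isHermitian (specOp_isHermitian U d) fun v => ?_
  unfold specOp
  rw [← Matrix.mulVec_mulVec, ← Matrix.mulVec_mulVec, vecSq_unitary_mulVec U hU.1,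
    ← vecSq_unitary_mulVec U.conjTranspose (by simpa using hU.2) v]
  refine Finset.sum_le_sum fun i _ => ?_
  rw [Matrix.mulVec_diagonal, norm_mul, mul_pow]
  refine mul_le_of_le_one_left (sq_nonneg _) ?_
  simpa using hd i

/-- One eigenbasis serves all functions of `σ` at once, so functional calculus becomes arithmetic on
eigenvalue lists. -/
lemma exists_specOp {σ : Matrix H H ℂ} (hσ : σ.IsHermitian) :
    ∃ U : Matrix H H ℂ, IsUnitaryMat U ∧ σ = specOp U hσ.eigenvalues ∧
      ∀ f : ℝ → ℝ, cfc f σ = specOp U (fun i => f (hσ.eigenvalues i)) := by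
  refine ⟨hσ.eigenvectorUnitary, ⟨?_, ?_⟩, ?_, fun f => ?_⟩
  · exact Unitary.coe_star_mul_self _
  · exact Unitary.coe_mul_star_self _
  · conv_lhs => rw [hσ.spectral_theorem]
    rfl
  · rw [hσ.cfc_eq]; rfl

lemma sqrtOp_posSemidef {σ : Matrix H H ℂ} (hσ : σ.PosSemidef) : (sqrtOp σ).PosSemidef := by
  obtain ⟨U, hU, h1, h2⟩ := exists_specOp hσ.1
  rw [sqrtOp, h2]
  exact specOp_posSemidef _ fun i => Real.sqrt_nonneg _

lemma sqrtOp_mul_self {σ : Matrix H H ℂ} (hσ : σ.PosSemidef) : sqrtOp σ * sqrtOp σ = σ := by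
  obtain ⟨U, hU, h1, h2⟩ := exists_specOp hσ.1
  rw [sqrtOp, h2, specOp_mul hU]
  simp only [Real.mul_self_sqrt (hσ.eigenvalues_nonneg _)]
  exact h1.symm

lemma sqrtOp_isHermitian {σ : Matrix H H ℂ} (hσ : σ.PosSemidef) : (sqrtOp σ).IsHermitian :=
  (sqrtOp_posSemidef hσ).1

/-- Uniqueness of the positive root: `σ` is a function of `R`, and √(x²) = x on the nonnegative
spectrum of `R`. -/
lemma sqrtOp_eq_of_mul_self {σ R : Matrix H H ℂ} (hR : R.PosSemidef) (h : R * R = σ) :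
    sqrtOp σ = R := by
  obtain ⟨U, hU, h1, h2⟩ := exists_specOp hR.1
  have e : σ = cfc (fun x : ℝ => x ^ 2) R := by
    rw [h2, ← h]; conv_lhs => rw [h1]
    rw [specOp_mul hU]; congr 1; ext i; ring
  have hs : IsSelfAdjoint R := hR.1
  rw [sqrtOp, e, ← cfc_comp' Real.sqrt (fun x : ℝ => x ^ 2) R
    (by exact Real.continuous_sqrt.continuousOn) (by fun_prop), h2]
  conv_rhs => rw [h1]
  congr 1; ext i
  exact Real.sqrt_sq (hR.eigenvalues_nonneg i)

/-- Cauchy–Schwarz for `L β R†` with a positive `β`. -/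
lemma abs_re_trace_contr_sandwich_le {C β : Matrix H H ℂ} (hC : IsContr C) (hβ : β.PosSemidef)
    (L R : Matrix H H ℂ) :
    |(C * (L * β * R.conjTranspose)).trace.re| ≤
      √((L * β * L.conjTranspose).trace.re) * √((R * β * R.conjTranspose).trace.re) := by
  set s := sqrtOp β with hs
  have h1 : s * s = β := sqrtOp_mul_self hβ
  have h2 : s.conjTranspose = s := sqrtOp_isHermitian hβ
  have key : ∀ X : Matrix H H ℂ, (X * β * X.conjTranspose).trace.re = hsSq (X * s) := by
    intro X
    rw [hsSq_eq_trace, Matrix.conjTranspose_mul, h2, ← h1]; simp only [mul_assoc]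
  have e : C * (L * β * R.conjTranspose) = (C * (L * s)) * (R * s).conjTranspose := by
    rw [Matrix.conjTranspose_mul, h2, ← h1]; simp only [mul_assoc]
  rw [e, key, key]
  refine (abs_re_trace_mul_le _ _).trans ?_
  rw [hsSq_conjTranspose]
  gcongr
  exact hC.hsSq_mul_le _

/-- Trace norm in its dual description, as a supremum over contractions. -/
def tn (T : Matrix H H ℂ) : ℝ := sSup {x | ∃ C, IsContr C ∧ x = (C * T).trace.re}

lemma tn_bddAbove (T : Matrix H H ℂ) : BddAbove {x | ∃ C, IsContr C ∧ x = (C * T).trace.re} := by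
  refine ⟨√(hsSq (1 : Matrix H H ℂ)) * √(hsSq T), ?_⟩
  rintro x ⟨C, hC, rfl⟩
  have := hC.hsSq_mul_le (1 : Matrix H H ℂ)
  rw [mul_one] at this
  exact (le_abs_self _).trans ((abs_re_trace_mul_le _ _).trans (by gcongr))

lemma re_trace_le_tn {C : Matrix H H ℂ} (hC : IsContr C) (T : Matrix H H ℂ) :
    (C * T).trace.re ≤ tn T := le_csSup (tn_bddAbove T) ⟨C, hC, rfl⟩

lemma tn_le {T : Matrix H H ℂ} {a : ℝ} (h : ∀ C, IsContr C → (C * T).trace.re ≤ a) : tn T ≤ a :=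
  csSup_le ⟨_, 1, isContr_one, rfl⟩ (by rintro x ⟨C, hC, rfl⟩; exact h C hC)

lemma abs_re_trace_contr_le_tn {C : Matrix H H ℂ} (hC : IsContr C) (T : Matrix H H ℂ) :
    |(C * T).trace.re| ≤ tn T := by
  refine abs_le'.2 ⟨re_trace_le_tn hC T, ?_⟩
  simpa using re_trace_le_tn hC.neg T

lemma abs_re_trace_le_tn (T : Matrix H H ℂ) : |T.trace.re| ≤ tn T := by
  simpa using abs_re_trace_contr_le_tn isContr_one T

lemma tn_nonneg (T : Matrix H H ℂ) : 0 ≤ tn T := (abs_nonneg _).trans (abs_re_trace_le_tn T)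

lemma tn_add_le (S T : Matrix H H ℂ) : tn (S + T) ≤ tn S + tn T :=
  tn_le fun C hC => by
    rw [mul_add, Matrix.trace_add, Complex.add_re]
    exact add_le_add (re_trace_le_tn hC _) (re_trace_le_tn hC _)

lemma tn_neg (T : Matrix H H ℂ) : tn (-T) = tn T := by
  have : ∀ S : Matrix H H ℂ, tn (-S) ≤ tn S := fun S => tn_le fun C hC => by
    have := re_trace_le_tn hC.neg S
    simpa using this
  exact le_antisymm (this T) (by simpa using this (-T))

lemma tn_sub_comm (S T : Matrix H H ℂ) : tn (S - T) = tn (T - S) := by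
  rw [← tn_neg, neg_sub]

lemma tn_sub_le (S T U : Matrix H H ℂ) : tn (S - U) ≤ tn (S - T) + tn (T - U) := by
  simpa using tn_add_le (S - T) (T - U)

lemma tn_zero : tn (0 : Matrix H H ℂ) = 0 :=
  le_antisymm (tn_le fun C _ => by simp) (tn_nonneg _)

lemma tn_smul_le (c : ℝ) (T : Matrix H H ℂ) : tn ((c : ℂ) • T) ≤ |c| * tn T :=
  tn_le fun C hC => by
    rw [Matrix.mul_smul, Matrix.trace_smul, smul_eq_mul, Complex.re_ofReal_mul]
    refine (le_abs_self _).trans ?_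
    rw [abs_mul]
    exact mul_le_mul_of_nonneg_left (abs_re_trace_contr_le_tn hC T) (abs_nonneg _)

lemma tn_sum_le {ι : Type*} (s : Finset ι) (T : ι → Matrix H H ℂ) :
    tn (∑ i ∈ s, T i) ≤ ∑ i ∈ s, tn (T i) := by
  classical
  induction s using Finset.induction_on with
  | empty => simp [tn_zero]
  | insert a s ha ih =>
    rw [Finset.sum_insert ha, Finset.sum_insert ha]
    exact (tn_add_le _ _).trans (by gcongr)

/-- In applications one of `L`, `R` is small when weighted by `β` and the other is bounded. -/
lemma tn_sandwich_le {β : Matrix H H ℂ} (hβ : β.PosSemidef) (L R : Matrix H H ℂ) :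
    tn (L * β * R.conjTranspose) ≤
      √((L * β * L.conjTranspose).trace.re) * √((R * β * R.conjTranspose).trace.re) :=
  tn_le fun _ hC => (le_abs_self _).trans (abs_re_trace_contr_sandwich_le hC hβ L R)

lemma tn_of_posSemidef_le {β : Matrix H H ℂ} (hβ : β.PosSemidef) : tn β ≤ β.trace.re := by
  have := tn_sandwich_le hβ 1 1
  simpa [Real.mul_self_sqrt (re_trace_nonneg hβ)] using this

/-- By cyclicity a test operator `E` becomes the test operator `D * E * C`, again a contraction. -/
lemma tn_contr_mul_contr_le {C D : Matrix H H ℂ} (hC : IsContr C) (hD : IsContr D)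
    (T : Matrix H H ℂ) : tn (C * T * D) ≤ tn T :=
  tn_le fun E hE => by
    have : (E * (C * T * D)).trace = ((D * E * C) * T).trace := by
      rw [← mul_assoc, Matrix.trace_mul_comm]; simp only [mul_assoc]
    rw [this]
    exact re_trace_le_tn ((hD.mul hE).mul hC) T

/-- The sign of `T` in its eigenbasis is a contraction that attains tr |T|. Errors are estimated in
`tn` throughout and converted only at the end. -/
lemma traceNorm_le_tn {T : Matrix H H ℂ} (hT : T.IsHermitian) : traceNorm T ≤ tn T := by
  obtain ⟨U, hU, h1, h2⟩ := exists_specOp hT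
  have e : sqrtOp (T.conjTranspose * T) = specOp U (fun i => |hT.eigenvalues i|) := by
    refine sqrtOp_eq_of_mul_self (specOp_posSemidef _ fun i => abs_nonneg _) ?_
    rw [hT.eq]
    conv_rhs => rw [h1]
    rw [specOp_mul hU, specOp_mul hU]; simp
  have e2 : specOp U (fun i => |hT.eigenvalues i|) =
      specOp U (fun i => (SignType.sign (hT.eigenvalues i) : ℝ)) * T := by
    generalize hT.eigenvalues = d at h1
    rw [h1, specOp_mul hU]; congr 1; ext i; rw [sign_mul_self]
  rw [traceNorm, e, e2]
  refine re_trace_le_tn (isContr_specOp hU fun i => ?_) T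
  rcases lt_trichotomy (hT.eigenvalues i) 0 with h | h | h <;> simp [h]

/-- If `P` is a Hermitian contraction and almost all of `σ` passes `P`, then `P σ P` is close to
`σ`. -/
lemma tn_sub_compress_le {σ P : Matrix H H ℂ} (hσ : σ.PosSemidef) (hP : P.IsHermitian)
    (hPc : IsContr P) :
    tn (σ - P * σ * P) ≤ 2 * √(σ.trace.re) * √(((1 - P) * σ * (1 - P)).trace.re) := by
  have hQ : (1 - P).conjTranspose = 1 - P := by simp [hP.eq]
  -- Each summand carries one factor `1 - P`, the small one in Cauchy–Schwarz.
  have e : σ - P * σ * P = (1 - P) * σ * (1 : Matrix H H ℂ).conjTranspose +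
      P * σ * (1 - P).conjTranspose := by rw [hQ]; simp; noncomm_ring
  have h1 := tn_sandwich_le hσ (1 - P) 1
  have h2 := tn_sandwich_le hσ P (1 - P)
  have h3 : (P * σ * P.conjTranspose).trace.re ≤ σ.trace.re := by
    have := tn_contr_mul_contr_le hPc hPc σ
    rw [hP.eq]
    exact (le_abs_self _).trans ((abs_re_trace_le_tn _).trans (this.trans (tn_of_posSemidef_le hσ)))
  rw [hQ] at h1 h2
  simp only [Matrix.conjTranspose_one, mul_one, one_mul] at h1
  rw [e]
  refine (tn_add_le _ _).trans ?_
  rw [hQ, Matrix.conjTranspose_one, mul_one]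
  have h4 := Real.sqrt_le_sqrt h3
  have h5 := Real.sqrt_nonneg (((1 - P) * σ * (1 - P)).trace.re)
  nlinarith

/-- A test contraction may be multiplied by `P`, whose squared Hilbert–Schmidt norm is its trace.
This is the passage from second moments to trace norm. -/
lemma tn_le_sqrt_trace_mul_hsSq {T P : Matrix H H ℂ} (hP : P.IsHermitian) (hPP : P * P = P)
    (h : P * T = T) : tn T ≤ √(P.trace.re) * √(hsSq T) :=
  tn_le fun C hC => by
    have e : C * T = C * P * T := by rw [mul_assoc, h]
    rw [e]
    refine (le_abs_self _).trans ((abs_re_trace_mul_le _ _).trans ?_)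
    have : hsSq P = P.trace.re := by rw [hsSq_eq_trace, hP.eq, hPP]
    rw [← this]
    gcongr
    exact hC.hsSq_mul_le _

/-- Powers–Størmer inequality. -/
lemma hsSq_sub_le_tn {P R : Matrix H H ℂ} (hP : P.PosSemidef) (hR : R.PosSemidef) :
    ((P - R) * (P - R)).trace.re ≤ tn (P * P - R * R) := by
  have hD : (P - R).IsHermitian := hP.1.sub hR.1
  obtain ⟨U, hU, h1, -⟩ := exists_specOp hD
  set d := hD.eigenvalues
  set S := specOp U (fun i => (SignType.sign (d i) : ℝ)) with hS
  have hSc : IsContr S := by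
    refine isContr_specOp hU fun i => ?_
    rcases lt_trichotomy (d i) 0 with h | h | h <;> simp [h]
  have hSD : S * (P - R) = specOp U (fun i => |d i|) := by
    rw [h1, hS, specOp_mul hU]; congr 1; ext i; rw [sign_mul_self]
  have hDS : (P - R) * S = specOp U (fun i => |d i|) := by
    rw [h1, hS, specOp_mul hU]; congr 1; ext i; rw [mul_comm, sign_mul_self]
  refine le_trans ?_ (re_trace_le_tn hSc _)
  -- Tested with the sign `S` of `P - R`, this identity yields tr |P - R|(P + R), which dominates tr
  -- (P - R)² entry by entry in the eigenbasis of `P - R`.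
  have e1 : (2 : ℂ) • (P * P - R * R) = (P - R) * (P + R) + (P + R) * (P - R) := by
    rw [two_smul]; noncomm_ring
  have e2 : (S * (P * P - R * R)).trace = (specOp U (fun i => |d i|) * (P + R)).trace := by
    have : (2 : ℂ) * (S * (P * P - R * R)).trace =
        2 * (specOp U (fun i => |d i|) * (P + R)).trace := by
      rw [← smul_eq_mul, ← Matrix.trace_smul, ← Matrix.mul_smul, e1, mul_add, Matrix.trace_add,
        ← mul_assoc, hSD, ← mul_assoc, Matrix.trace_mul_comm (S * (P + R)), ← mul_assoc, hDS,
        two_mul]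
    exact mul_left_cancel₀ two_ne_zero this
  rw [e2]
  have key : ∀ (f : H → ℝ) (X : Matrix H H ℂ), (specOp U f * X).trace.re =
      ∑ i, f i * ((U.conjTranspose * X * U) i i).re := by
    intro f X
    unfold specOp
    rw [mul_assoc, mul_assoc, Matrix.trace_mul_comm, mul_assoc, mul_assoc, ← mul_assoc _ X U,
      Matrix.trace, Complex.re_sum]
    refine Finset.sum_congr rfl fun i _ => ?_
    rw [Matrix.diag_apply, Matrix.diagonal_mul, Complex.re_ofReal_mul]
  have e3 : ((P - R) * (P - R)).trace.re = ∑ i, d i * ((U.conjTranspose * (P - R) * U) i i).re := by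
    rw [← key, ← h1]
  have hdd : ∀ i, ((U.conjTranspose * (P - R) * U) i i).re = d i := by
    intro i
    have : U.conjTranspose * (P - R) * U = Matrix.diagonal (fun i => (d i : ℂ)) := by
      rw [h1]; unfold specOp
      calc _ = (U.conjTranspose * U) * Matrix.diagonal (fun i => (d i : ℂ)) *
            (U.conjTranspose * U) := by simp only [mul_assoc]
        _ = _ := by rw [hU.1]; simp
    rw [this]; simp
  rw [e3, key]
  refine Finset.sum_le_sum fun i _ => ?_
  have hp : 0 ≤ ((U.conjTranspose * P * U) i i).re :=
    (Complex.nonneg_iff.1 ((hP.conjTranspose_mul_mul_same U).diag_nonneg)).1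
  have hr : 0 ≤ ((U.conjTranspose * R * U) i i).re :=
    (Complex.nonneg_iff.1 ((hR.conjTranspose_mul_mul_same U).diag_nonneg)).1
  have hs := hdd i
  rw [mul_sub, sub_mul, Matrix.sub_apply, Complex.sub_re] at hs
  rw [hdd, mul_add, add_mul, Matrix.add_apply, Complex.add_re]
  rw [← abs_mul_abs_self (d i)]
  refine mul_le_mul_of_nonneg_left ?_ (abs_nonneg _)
  rw [← hs, abs_le]; constructor <;> linarith

end TraceNormTheory

/-! ### The square-root measurement -/

section PrettyGood

/-- Cauchy–Schwarz over the index: summing the termwise estimates this way loses no factor depending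
on the number of outcomes. -/
lemma sum_le_two_mul_sqrt {ι : Type*} [Fintype ι] {N t : ℝ} (hN : 0 < N) {f x y z : ι → ℝ}
    (hz : ∀ j, 0 ≤ z j) (hx : ∀ j, 0 ≤ x j) (hy : ∀ j, 0 ≤ y j)
    (hf : ∀ j, f j ≤ N⁻¹ * (√(z j) * √(x j) + √(y j) * √(z j)))
    (hzt : ∑ j, z j ≤ N * t) (hxN : ∑ j, x j ≤ N) (hyN : ∑ j, y j ≤ N) :
    ∑ j, f j ≤ 2 * √t := by
  refine (Finset.sum_le_sum fun j _ => hf j).trans ?_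
  rw [← Finset.mul_sum, Finset.sum_add_distrib]
  have key : √(N * t) * √N = N * √t := by
    rw [Real.sqrt_mul hN.le, mul_right_comm, Real.mul_self_sqrt hN.le]
  have c1 : ∑ j, √(z j) * √(x j) ≤ N * √t := by
    refine (Real.sum_sqrt_mul_sqrt_le _ hz hx).trans ?_
    rw [← key]
    gcongr
  have c2 : ∑ j, √(y j) * √(z j) ≤ N * √t := by
    refine (Real.sum_sqrt_mul_sqrt_le _ hy hz).trans ?_
    rw [← key, mul_comm √(N * t)]
    gcongr
  calc _ ≤ N⁻¹ * (N * √t + N * √t) := by gcongr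
    _ = _ := by field_simp; ring

lemma re_trace_mono {H : Type*} [Fintype H] {S T : Matrix H H ℂ} (h : (T - S).PosSemidef) : S.trace.re ≤ T.trace.re := by
  have := re_trace_nonneg h
  rw [Matrix.trace_sub, Complex.sub_re] at this
  linarith

variable {H : Type*} [Fintype H] [DecidableEq H] {ι : Type*} [Fintype ι]

lemma exists_invSqrtOp_spec {S : Matrix H H ℂ} (hS : S.PosSemidef) :
    ∃ (U : Matrix H H ℂ) (d : H → ℝ), IsUnitaryMat U ∧ (∀ i, 0 ≤ d i) ∧ S = specOp U d ∧
      sqrtOp S = specOp U (fun i => √(d i)) ∧ invSqrtOp S = specOp U (fun i => (√(d i))⁻¹) := by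
  obtain ⟨U, hU, h1, h2⟩ := exists_specOp hS.1
  exact ⟨U, _, hU, hS.eigenvalues_nonneg, h1, h2 _, h2 _⟩

lemma invSqrtOp_isHermitian {S : Matrix H H ℂ} (hS : S.PosSemidef) :
    (invSqrtOp S).IsHermitian := by
  obtain ⟨U, d, hU, hd, h1, h2, h3⟩ := exists_invSqrtOp_spec hS
  rw [h3]; exact specOp_isHermitian _ _

lemma invSqrtOp_mul_self_eq_sqrtOp {S : Matrix H H ℂ} (hS : S.PosSemidef) :
    invSqrtOp S * S = sqrtOp S := by
  obtain ⟨U, d, hU, hd, h1, h2, h3⟩ := exists_invSqrtOp_spec hS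
  rw [h2, h3]
  conv_lhs => rw [h1]
  rw [specOp_mul hU]; congr 1; ext i
  rcases (hd i).eq_or_lt with h | h
  · simp [← h]
  · have := Real.sqrt_pos.2 h
    field_simp
    rw [Real.sq_sqrt h.le]

/-- The sandwiched operator has eigenvalues √d·(√d)⁻¹, which are 1 on the support of `S` and 0 off
it. -/
lemma one_sub_invSqrtOp_sandwich_posSemidef {S : Matrix H H ℂ} (hS : S.PosSemidef) :
    (1 - invSqrtOp S * S * invSqrtOp S).PosSemidef := by
  obtain ⟨U, d, hU, hd, h1, h2, h3⟩ := exists_invSqrtOp_spec hS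
  rw [invSqrtOp_mul_self_eq_sqrtOp hS, h2, h3, specOp_mul hU, ← specOp_one hU, specOp_sub]
  refine specOp_posSemidef _ fun i => ?_
  rw [sub_nonneg]
  exact mul_inv_le_one

/-- The square-root measurement of an ensemble whose average is close to `ω` reproduces, on the
purification of `ω`, the ensemble itself. -/
lemma sum_tn_prettyGood_le {β : ι → Matrix H H ℂ} (hβ : ∀ j, (β j).PosSemidef)
    {ω : Matrix H H ℂ} (hω : IsDensity ω) {N : ℝ} (hN : 0 < N)
    (htr : (∑ j, β j).trace.re ≤ N) :
    ∑ j, tn (sqrtOp ω * (invSqrtOp (∑ j, β j) * β j * invSqrtOp (∑ j, β j)) * sqrtOp ω -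
        ((N⁻¹ : ℝ) : ℂ) • β j) ≤
      2 * √(tn (ω - ((N⁻¹ : ℝ) : ℂ) • ∑ j, β j)) := by
  set S := ∑ j, β j with hSdef
  have hS : S.PosSemidef := Matrix.posSemidef_sum _ fun j _ => hβ j
  set J := invSqrtOp S
  set P := sqrtOp ω
  have hJ : J.conjTranspose = J := invSqrtOp_isHermitian hS
  have hP : P.conjTranspose = P := sqrtOp_isHermitian hω.1
  have hPP : P * P = ω := sqrtOp_mul_self hω.1
  set c : ℝ := √N
  have hc : 0 < c := Real.sqrt_pos.2 hN
  have hcc : c * c = N := Real.mul_self_sqrt hN.le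
  -- `X` is √N √ω S^(-1/2). Conjugation by it turns `β j` into `N` times the measured operator, so
  -- `X` ought to act on the ensemble almost as the identity.
  set X : Matrix H H ℂ := (c : ℂ) • (P * J) with hX
  have hXc : X.conjTranspose = (c : ℂ) • (J * P) := by
    rw [hX, Matrix.conjTranspose_smul, Matrix.conjTranspose_mul, hJ, hP]; simp
  set z : ι → ℝ := fun j => ((X - 1) * β j * (X - 1).conjTranspose).trace.re
  set x : ι → ℝ := fun j => (X * β j * X.conjTranspose).trace.re
  set y : ι → ℝ := fun j => (β j).trace.re
  have hz : ∀ j, 0 ≤ z j := fun j => re_trace_nonneg ((hβ j).mul_mul_conjTranspose_same _)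
  have hx : ∀ j, 0 ≤ x j := fun j => re_trace_nonneg ((hβ j).mul_mul_conjTranspose_same _)
  have hy : ∀ j, 0 ≤ y j := fun j => re_trace_nonneg (hβ j)
  have hlin : ∀ L R : Matrix H H ℂ, ∑ j, (L * β j * R).trace.re = (L * S * R).trace.re := by
    intro L R
    rw [← Complex.re_sum, ← Matrix.trace_sum, hSdef, Finset.mul_sum, Finset.sum_mul]
  have hXSX : X * S * X.conjTranspose = (N : ℂ) • (P * (J * S * J) * P) := by
    rw [hXc, hX, ← hcc]
    simp only [Matrix.smul_mul, Matrix.mul_smul, smul_smul, mul_assoc, Complex.ofReal_mul]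
  have hsx : (X * S * X.conjTranspose).trace.re ≤ N := by
    rw [hXSX, Matrix.trace_smul, smul_eq_mul, Complex.re_ofReal_mul]
    refine mul_le_of_le_one_right hN.le ?_
    have h1 := (one_sub_invSqrtOp_sandwich_posSemidef hS).mul_mul_conjTranspose_same P
    rw [mul_sub, sub_mul, mul_one, hP, hPP] at h1
    have h2 := re_trace_mono h1
    rwa [hω.2, Complex.one_re] at h2
  have hsz : (X - 1) * S * (X - 1).conjTranspose =
      X * S * X.conjTranspose - X * S - S * X.conjTranspose + S := by
    rw [Matrix.conjTranspose_sub, Matrix.conjTranspose_one]; noncomm_ring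
  have hXS : X * S = (c : ℂ) • (P * sqrtOp S) := by
    rw [hX, Matrix.smul_mul, mul_assoc, invSqrtOp_mul_self_eq_sqrtOp hS]
  have hSX : (S * X.conjTranspose).trace.re = (X * S).trace.re := by
    rw [← Complex.conj_re, ← Complex.star_def, ← Matrix.trace_conjTranspose,
      Matrix.conjTranspose_mul, Matrix.conjTranspose_conjTranspose, hS.1.eq]
  -- Expanded, tr (X-1)S(X-1)† is at most N tr(√ω - √(S/N))², to which Powers–Størmer applies.
  have hzt : ∑ j, z j ≤ N * tn (ω - ((N⁻¹ : ℝ) : ℂ) • S) := by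
    set R : Matrix H H ℂ := ((c⁻¹ : ℝ) : ℂ) • sqrtOp S with hR
    have hRp : R.PosSemidef := (sqrtOp_posSemidef hS).smul (by
      rw [Complex.zero_le_real]; positivity)
    have hRR : R * R = ((N⁻¹ : ℝ) : ℂ) • S := by
      rw [hR, Matrix.smul_mul, Matrix.mul_smul, smul_smul, sqrtOp_mul_self hS, ← hcc, mul_inv,
        Complex.ofReal_mul]
    have h1 := hsSq_sub_le_tn (sqrtOp_posSemidef hω.1) hRp
    rw [sqrtOp_mul_self hω.1, hRR] at h1
    have h2 : ((P - R) * (P - R)).trace.re =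
        1 - 2 * (c⁻¹ * (P * sqrtOp S).trace.re) + N⁻¹ * S.trace.re := by
      have : (P - R) * (P - R) = ω - P * R - R * P + ((N⁻¹ : ℝ) : ℂ) • S := by
        rw [← hRR, ← hPP]; noncomm_ring
      rw [this, Matrix.trace_add, Matrix.trace_sub, Matrix.trace_sub, Matrix.trace_mul_comm R P,
        hω.2, hR, Matrix.mul_smul, Matrix.trace_smul, Matrix.trace_smul]
      simp only [smul_eq_mul, Complex.add_re, Complex.sub_re, Complex.re_ofReal_mul,
        Complex.one_re]
      ring
    change ((P - R) * (P - R)).trace.re ≤ _ at h1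
    rw [h2] at h1
    rw [hlin, hsz, Matrix.trace_add, Matrix.trace_sub, Matrix.trace_sub]
    simp only [Complex.add_re, Complex.sub_re]
    have h5 : (X * S).trace.re = c * (P * sqrtOp S).trace.re := by
      rw [hXS, Matrix.trace_smul, smul_eq_mul, Complex.re_ofReal_mul]
    rw [hSX, h5]
    have h3 := mul_le_mul_of_nonneg_left h1 hN.le
    have h4 : N * (1 - 2 * (c⁻¹ * (P * sqrtOp S).trace.re) + N⁻¹ * S.trace.re) =
        N - 2 * (c * (P * sqrtOp S).trace.re) + S.trace.re := by
      rw [← hcc]; field_simp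
    linarith
  have hj : ∀ j, tn (P * (J * β j * J) * P - ((N⁻¹ : ℝ) : ℂ) • β j) ≤
      N⁻¹ * (√(z j) * √(x j) + √(y j) * √(z j)) := by
    intro j
    -- Telescoping XβX† - β = (X-1)βX† + β(X-1)†.
    have e : P * (J * β j * J) * P - ((N⁻¹ : ℝ) : ℂ) • β j =
        ((N⁻¹ : ℝ) : ℂ) • ((X - 1) * β j * X.conjTranspose +
          1 * β j * (X - 1).conjTranspose) := by
      have e1 : (X - 1) * β j * X.conjTranspose + 1 * β j * (X - 1).conjTranspose =
          X * β j * X.conjTranspose - β j := by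
        rw [Matrix.conjTranspose_sub, Matrix.conjTranspose_one]; noncomm_ring
      have e2 : X * β j * X.conjTranspose = (N : ℂ) • (P * (J * β j * J) * P) := by
        rw [hXc, hX, ← hcc]
        simp only [Matrix.smul_mul, Matrix.mul_smul, smul_smul, mul_assoc, Complex.ofReal_mul]
      rw [e1, e2, smul_sub, smul_smul, ← Complex.ofReal_mul, inv_mul_cancel₀ hN.ne']
      simp
    rw [e]
    refine (tn_smul_le _ _).trans ?_
    rw [abs_of_pos (inv_pos.2 hN)]
    refine mul_le_mul_of_nonneg_left ?_ (inv_pos.2 hN).le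
    refine (tn_add_le _ _).trans (add_le_add (tn_sandwich_le (hβ j) _ _) ?_)
    have h := tn_sandwich_le (hβ j) 1 (X - 1)
    have e3 : 1 * β j * (1 : Matrix H H ℂ).conjTranspose = β j := by simp
    rw [e3] at h
    exact h
  refine sum_le_two_mul_sqrt hN hz hx hy hj hzt ?_ ?_
  · exact (hlin X X.conjTranspose).trans_le hsx
  · have := hlin 1 1
    simp only [mul_one, one_mul] at this
    exact this.trans_le htr

end PrettyGood

/-! ### Pairwise independence on finite probability spaces -/

section FiniteProbability

/-- The variables `X i` on the finite probability space `(Ω, P)` have law `Q` and are pairwise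
independent. -/
structure PairwiseLaw {Ω I S : Type*} [Fintype Ω] [Fintype S] (P : Ω → ℝ) (X : I → Ω → S)
    (Q : S → ℝ) : Prop where
  nonneg : ∀ ω, 0 ≤ P ω
  sum_one : ∑ ω, P ω = 1
  law_nonneg : ∀ s, 0 ≤ Q s
  law_sum : ∑ s, Q s = 1
  marginal : ∀ i (f : S → ℝ), ∑ ω, P ω * f (X i ω) = ∑ s, Q s * f s
  pair : ∀ i j, i ≠ j → ∀ f g : S → ℝ,
    ∑ ω, P ω * (f (X i ω) * g (X j ω)) = (∑ s, Q s * f s) * ∑ s, Q s * g s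

lemma exists_le_of_average_le {Ω : Type*} [Fintype Ω] {P : Ω → ℝ} (hP : ∀ ω, 0 ≤ P ω)
    (h1 : ∑ ω, P ω = 1) {g : Ω → ℝ} {e : ℝ} (h : ∑ ω, P ω * g ω ≤ e) : ∃ ω, g ω ≤ e := by
  by_contra! hcon
  have hpos : ∃ ω, 0 < P ω := by
    by_contra! hz
    have : ∑ ω, P ω ≤ 0 := Finset.sum_nonpos fun ω _ => hz ω
    linarith
  obtain ⟨ω₀, h₀⟩ := hpos
  have : ∑ ω, P ω * e < ∑ ω, P ω * g ω :=
    Finset.sum_lt_sum (fun ω _ => mul_le_mul_of_nonneg_left (hcon ω).le (hP ω))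
      ⟨ω₀, Finset.mem_univ _, mul_lt_mul_of_pos_left (hcon ω₀) h₀⟩
  rw [← Finset.sum_mul, h1, one_mul] at this
  linarith

/-- Jensen's inequality for the square root. -/
lemma average_sqrt_le {Ω : Type*} [Fintype Ω] {P : Ω → ℝ} (hP : ∀ ω, 0 ≤ P ω)
    (h1 : ∑ ω, P ω ≤ 1) {g : Ω → ℝ} (hg : ∀ ω, 0 ≤ g ω) :
    ∑ ω, P ω * √(g ω) ≤ √(∑ ω, P ω * g ω) := by
  have h : ∑ ω, √(P ω) * √(P ω * g ω) ≤ √(∑ ω, P ω) * √(∑ ω, P ω * g ω) :=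
    Real.sum_sqrt_mul_sqrt_le _ hP fun ω => mul_nonneg (hP ω) (hg ω)
  have e : ∀ ω, P ω * √(g ω) = √(P ω) * √(P ω * g ω) := fun ω => by
    rw [Real.sqrt_mul (hP ω), ← mul_assoc, Real.mul_self_sqrt (hP ω)]
  simp only [e]
  refine h.trans (mul_le_of_le_one_left (Real.sqrt_nonneg _) ?_)
  exact Real.sqrt_le_one.2 h1

/-- After centring `f` the cross terms vanish, and this uses independence of pairs only. -/
lemma PairwiseLaw.second_moment_le {Ω I S : Type*} [Fintype Ω] [Fintype I]
    [Fintype S] {P : Ω → ℝ} {X : I → Ω → S} {Q : S → ℝ} (h : PairwiseLaw P X Q) (a : I → ℝ)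
    (f : S → ℝ) :
    ∑ ω, P ω * (∑ i, a i * f (X i ω) - (∑ i, a i) * ∑ s, Q s * f s) ^ 2 ≤
      (∑ i, a i ^ 2) * ∑ s, Q s * f s ^ 2 := by
  classical
  set m := ∑ s, Q s * f s with hm
  set f' : S → ℝ := fun s => f s - m
  have hf0 : ∑ s, Q s * f' s = 0 := by
    simp only [f', mul_sub, Finset.sum_sub_distrib, ← Finset.sum_mul, h.law_sum, one_mul]
    simp [hm]
  have hf2 : ∑ s, Q s * (f' s * f' s) ≤ ∑ s, Q s * f s ^ 2 := by
    have : ∑ s, Q s * (f' s * f' s) = ∑ s, Q s * f s ^ 2 - m ^ 2 := by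
      have e : ∀ s, Q s * (f' s * f' s) = Q s * f s ^ 2 - 2 * m * (Q s * f s) + m ^ 2 * Q s := by
        intro s; simp only [f']; ring
      simp only [e, Finset.sum_add_distrib, Finset.sum_sub_distrib, ← Finset.mul_sum, h.law_sum,
        ← hm]
      ring
    rw [this]; nlinarith [sq_nonneg m]
  have e1 : ∀ ω, P ω * (∑ i, a i * f (X i ω) - (∑ i, a i) * m) ^ 2 =
      ∑ i, ∑ j, a i * a j * (P ω * (f' (X i ω) * f' (X j ω))) := by
    intro ω
    have : ∑ i, a i * f (X i ω) - (∑ i, a i) * m = ∑ i, a i * f' (X i ω) := by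
      simp only [f', mul_sub, Finset.sum_sub_distrib, ← Finset.sum_mul]
    rw [this, sq, Finset.sum_mul_sum, Finset.mul_sum]
    refine Finset.sum_congr rfl fun i _ => ?_
    rw [Finset.mul_sum]
    exact Finset.sum_congr rfl fun j _ => by ring
  have e2 : ∀ i j, ∑ ω, P ω * (f' (X i ω) * f' (X j ω)) =
      if i = j then ∑ s, Q s * (f' s * f' s) else 0 := by
    intro i j
    split_ifs with hij
    · subst hij; exact h.marginal i fun s => f' s * f' s
    · rw [h.pair i j hij, hf0, zero_mul]
  simp only [e1]
  rw [Finset.sum_comm]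
  simp only [Finset.sum_comm (s := (Finset.univ : Finset Ω)), ← Finset.mul_sum, e2, mul_ite,
    mul_zero, Finset.sum_ite_eq, Finset.mem_univ, if_true, ← Finset.sum_mul]
  have e3 : ∑ i, a i * a i = ∑ i, a i ^ 2 := Finset.sum_congr rfl fun i _ => (sq _).symm
  rw [e3]
  exact mul_le_mul_of_nonneg_left hf2 (Finset.sum_nonneg fun i _ => sq_nonneg _)

/-! ### Product laws and the weak law of large numbers -/

section Product

variable {I S : Type*} [Fintype I] [DecidableEq I] [Fintype S]

lemma sum_prod_eq_one {κ : I → S → ℝ} (h1 : ∀ i, ∑ s, κ i s = 1) :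
    ∑ x : I → S, ∏ i, κ i (x i) = 1 := by
  classical
  rw [← Fintype.prod_sum]
  simp [h1]

lemma sum_prod_mul_one {κ : I → S → ℝ} (h1 : ∀ i, ∑ s, κ i s = 1) (i : I) (φ : S → ℝ) :
    ∑ x : I → S, (∏ k, κ k (x k)) * φ (x i) = ∑ s, κ i s * φ s := by
  classical
  have e : ∀ x : I → S, (∏ k, κ k (x k)) * φ (x i) =
      ∏ k, (κ k (x k) * if k = i then φ (x k) else 1) := by
    intro x
    rw [Finset.prod_mul_distrib]
    simp
  simp only [e]
  rw [← Fintype.prod_sum (fun k s => κ k s * if k = i then φ s else 1),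
    Finset.prod_eq_single i]
  · simp
  · intro k _ hk; simp [hk, h1]
  · simp

lemma sum_prod_mul_two {κ : I → S → ℝ} (h1 : ∀ i, ∑ s, κ i s = 1) {i j : I} (hij : i ≠ j)
    (φ ψ : S → ℝ) :
    ∑ x : I → S, (∏ k, κ k (x k)) * (φ (x i) * ψ (x j)) =
      (∑ s, κ i s * φ s) * ∑ s, κ j s * ψ s := by
  classical
  have e : ∀ x : I → S, (∏ k, κ k (x k)) * (φ (x i) * ψ (x j)) =
      ∏ k, (κ k (x k) * ((if k = i then φ (x k) else 1) * if k = j then ψ (x k) else 1)) := by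
    intro x
    rw [Finset.prod_mul_distrib, Finset.prod_mul_distrib]
    simp
  simp only [e]
  rw [← Fintype.prod_sum
      (fun k s => κ k s * ((if k = i then φ s else 1) * if k = j then ψ s else 1)),
    Finset.prod_eq_mul i j hij]
  · simp [hij, hij.symm]
  · intro k _ hk; simp [hk.1, hk.2, h1]
  · simp
  · simp

lemma pairwiseLaw_pi {Q : S → ℝ} (h0 : ∀ s, 0 ≤ Q s) (h1 : ∑ s, Q s = 1) :
    PairwiseLaw (fun x : I → S => ∏ i, Q (x i)) (fun i x => x i) Q where
  nonneg _ := Finset.prod_nonneg fun _ _ => h0 _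
  sum_one := sum_prod_eq_one (κ := fun _ => Q) fun _ => h1
  law_nonneg := h0
  law_sum := h1
  marginal := sum_prod_mul_one (κ := fun _ => Q) fun _ => h1
  pair _ _ := sum_prod_mul_two (κ := fun _ => Q) fun _ => h1

/-- Weak law of large numbers. -/
lemma exists_weak_law {Q : S → ℝ} (h0 : ∀ s, 0 ≤ Q s) (h1 : ∑ s, Q s = 1) (f : S → ℝ)
    {δ ε : ℝ} (hδ : 0 < δ) (hε : 0 < ε) :
    ∃ N : ℕ, ∀ n : ℕ, N ≤ n →
      ∑ x : Fin n → S, (∏ t, Q (x t)) *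
        (if n * δ < |∑ t, f (x t) - n * ∑ s, Q s * f s| then (1 : ℝ) else 0) ≤ ε := by
  set V := ∑ s, Q s * f s ^ 2 with hV
  have hV0 : 0 ≤ V := Finset.sum_nonneg fun s _ => mul_nonneg (h0 s) (sq_nonneg _)
  obtain ⟨N, hN⟩ := exists_nat_gt (V / (δ ^ 2 * ε))
  refine ⟨N + 1, fun n hn => ?_⟩
  have hn0 : (0 : ℝ) < n := by exact_mod_cast (by omega : 0 < n)
  have hNn : V / (δ ^ 2 * ε) ≤ n := hN.le.trans (by exact_mod_cast (by omega : N ≤ n))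
  have hm := (pairwiseLaw_pi (I := Fin n) h0 h1).second_moment_le (fun _ => (1 : ℝ)) f
  simp only [one_mul, one_pow, Finset.sum_const, Finset.card_univ, Fintype.card_fin, nsmul_eq_mul,
    mul_one] at hm
  -- Chebyshev: the indicator of the deviation is at most the squared deviation over (nδ)².
  have hle : ∀ x : Fin n → S, (∏ t, Q (x t)) *
        (if n * δ < |∑ t, f (x t) - n * ∑ s, Q s * f s| then (1 : ℝ) else 0) ≤
      ((n * δ) ^ 2)⁻¹ * ((∏ t, Q (x t)) * (∑ t, f (x t) - n * ∑ s, Q s * f s) ^ 2) := by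
    intro x
    have hp : 0 ≤ ∏ t, Q (x t) := Finset.prod_nonneg fun t _ => h0 _
    rw [mul_left_comm]
    refine mul_le_mul_of_nonneg_left ?_ hp
    split_ifs with hx
    · rw [inv_mul_eq_div, one_le_div (by positivity), ← sq_abs (∑ t, f (x t) - _)]
      gcongr
    · positivity
  refine (Finset.sum_le_sum fun x _ => hle x).trans ?_
  rw [← Finset.mul_sum]
  refine (mul_le_mul_of_nonneg_left hm (by positivity)).trans ?_
  rw [← hV, inv_mul_le_iff₀ (by positivity)]
  rw [div_le_iff₀ (by positivity)] at hNn
  nlinarith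

end Product

/-! ### Uniformly random affine maps -/

section RandomAffine

variable {F E ι : Type*} [Field F] [AddCommGroup E] [Module F E] [Fintype E]
  [DecidableEq E] [Fintype ι] [DecidableEq ι]

/-- The fibres are cosets of the kernel and so have equal size: a surjective homomorphism preserves
the uniform law. -/
lemma sum_comp_surjective_addMonoidHom {G G' : Type*} [AddCommGroup G] [AddCommGroup G']
    [Fintype G] [Fintype G'] [DecidableEq G'] (Φ : G →+ G') (hΦ : Function.Surjective Φ)
    (f : G' → ℝ) :
    (Fintype.card G : ℝ)⁻¹ * ∑ g, f (Φ g) = (Fintype.card G' : ℝ)⁻¹ * ∑ h, f h := by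
  classical
  have hfib : ∀ h : G', (Finset.univ.filter fun g => Φ g = h).card =
      (Finset.univ.filter fun g => Φ g = 0).card := fun h =>
    AddMonoidHom.card_fiber_eq_of_mem_range Φ (hΦ h) (hΦ 0)
  set c := (Finset.univ.filter fun g => Φ g = 0).card
  have h1 : ∑ g, f (Φ g) = c * ∑ h, f h := by
    rw [← Finset.sum_fiberwise_of_maps_to (t := Finset.univ) (g := Φ) (by simp), Finset.mul_sum]
    refine Finset.sum_congr rfl fun h _ => ?_
    rw [Finset.sum_congr rfl (g := fun _ => f h) (by simp +contextual), Finset.sum_const, hfib,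
      nsmul_eq_mul]
  have h2 : Fintype.card G = c * Fintype.card G' := by
    have := Finset.card_eq_sum_card_fiberwise (s := (Finset.univ : Finset G))
      (t := (Finset.univ : Finset G')) (f := Φ) (by simp)
    simpa [hfib, mul_comm] using this
  have hG : (0 : ℝ) < Fintype.card G := by exact_mod_cast Fintype.card_pos
  have hG' : (0 : ℝ) < Fintype.card G' := by exact_mod_cast Fintype.card_pos
  rw [h1, ← mul_assoc]
  congr 1
  rw [inv_mul_eq_div, inv_eq_one_div, div_eq_div_iff hG.ne' hG'.ne', h2]
  push_cast; ring

/-- The affine map `x ↦ v + ∑ i, x i • g i`. -/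
def affMap (vg : E × (ι → E)) (x : ι → F) : E := vg.1 + ∑ i, x i • vg.2 i

/-- The values of a uniformly random affine map are uniform and pairwise independent. -/
lemma pairwiseLaw_affMap :
    PairwiseLaw (fun _ : E × (ι → E) => (Fintype.card (E × (ι → E)) : ℝ)⁻¹)
      (fun (x : ι → F) vg => affMap vg x) (fun _ : E => (Fintype.card E : ℝ)⁻¹) where
  nonneg _ := by positivity
  sum_one := by
    rw [Finset.sum_const, Finset.card_univ, nsmul_eq_mul, mul_inv_cancel₀]
    exact_mod_cast Fintype.card_ne_zero
  law_nonneg _ := by positivity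
  law_sum := by
    rw [Finset.sum_const, Finset.card_univ, nsmul_eq_mul, mul_inv_cancel₀]
    exact_mod_cast Fintype.card_ne_zero
  marginal x f := by
    let Φ : (E × (ι → E)) →+ E :=
      { toFun := fun vg => affMap vg x
        map_zero' := by simp [affMap]
        map_add' := fun a b => by simp [affMap, Finset.sum_add_distrib]; abel }
    rw [← Finset.mul_sum, ← Finset.mul_sum]
    exact sum_comp_surjective_addMonoidHom Φ (fun e => ⟨(e, 0), by simp [Φ, affMap]⟩) f
  pair x y hxy f g := by
    let Φ : (E × (ι → E)) →+ E × E :=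
      { toFun := fun vg => (affMap vg x, affMap vg y)
        map_zero' := by simp [affMap]
        map_add' := fun a b => by
          simp [affMap, Finset.sum_add_distrib]; constructor <;> abel }
    have hΦ : Function.Surjective Φ := by
      rintro ⟨a, b⟩
      obtain ⟨i, hi⟩ := Function.ne_iff.1 hxy
      have hi' : x i - y i ≠ 0 := sub_ne_zero.2 hi
      -- The base point and the single generator `i` suffice: `d` is the slope between the two
      -- prescribed values.
      set d : E := (x i - y i)⁻¹ • (a - b) with hd
      have hdd : x i • d - y i • d = a - b := by rw [← sub_smul, hd, smul_inv_smul₀ hi']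
      refine ⟨(a - x i • d, Pi.single i d), ?_⟩
      have hs : ∀ z : ι → F, ∑ k, z k • (Pi.single i d : ι → E) k = z i • d := by
        intro z
        rw [Finset.sum_eq_single i] <;> simp +contextual
      simp only [Φ, affMap, AddMonoidHom.coe_mk, ZeroHom.coe_mk, hs, Prod.mk.injEq]
      refine ⟨by abel, ?_⟩
      have : y i • d = x i • d - (a - b) := by rw [← hdd]; abel
      rw [this]; abel
    rw [← Finset.mul_sum, ← Finset.mul_sum, ← Finset.mul_sum]
    have := sum_comp_surjective_addMonoidHom Φ hΦ (fun ab => f ab.1 * g ab.2)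
    refine this.trans ?_
    rw [Fintype.card_prod, Fintype.sum_prod_type, mul_mul_mul_comm, Finset.sum_mul_sum]
    push_cast
    rw [mul_inv]

end RandomAffine
end FiniteProbability

/-! ### Independent selection given pairwise independent variables -/

section Selection

/-- Choosing independently with the kernel `κ` given pairwise independent variables keeps them
pairwise independent. -/
lemma PairwiseLaw.select {Ω I S T S' : Type*} [Fintype Ω] [Fintype I] [DecidableEq I] [Fintype S]
    [Fintype T] [Fintype S'] [DecidableEq S'] {P : Ω → ℝ} {X : I → Ω → S} {U : S → ℝ}
    (h : PairwiseLaw P X U) {κ : S → T → ℝ} (hκ0 : ∀ s t, 0 ≤ κ s t) (hκ1 : ∀ s, ∑ t, κ s t = 1)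
    (out : S → T → S') :
    PairwiseLaw (fun ωb : Ω × (I → T) => P ωb.1 * ∏ i, κ (X i ωb.1) (ωb.2 i))
      (fun i ωb => out (X i ωb.1) (ωb.2 i))
      (fun s' => ∑ s, U s * ∑ t, κ s t * if out s t = s' then 1 else 0) := by
  -- Expectations under the selected law are expectations of the conditional mean of `f`, a function
  -- of the old variable; both marginal and pair formulas then reduce to those of `h`.
  have hexp : ∀ f : S' → ℝ,
      ∑ s', (∑ s, U s * ∑ t, κ s t * if out s t = s' then 1 else 0) * f s' =
        ∑ s, U s * ∑ t, κ s t * f (out s t) := by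
    intro f
    simp only [Finset.sum_mul, Finset.mul_sum]
    rw [Finset.sum_comm]
    refine Finset.sum_congr rfl fun s _ => ?_
    rw [Finset.sum_comm]
    refine Finset.sum_congr rfl fun t _ => ?_
    simp [mul_assoc]
  refine ⟨?_, ?_, ?_, ?_, ?_, ?_⟩
  · exact fun ωb => mul_nonneg (h.nonneg _) (Finset.prod_nonneg fun i _ => hκ0 _ _)
  · rw [Fintype.sum_prod_type]
    simp only [← Finset.mul_sum]
    rw [← h.sum_one]
    refine Finset.sum_congr rfl fun ω _ => ?_
    rw [sum_prod_eq_one (κ := fun i => κ (X i ω)) fun i => hκ1 _, mul_one]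
  · exact fun s' => Finset.sum_nonneg fun s _ => mul_nonneg (h.law_nonneg s)
      (Finset.sum_nonneg fun t _ => mul_nonneg (hκ0 _ _) (by split_ifs <;> norm_num))
  · have := hexp fun _ => 1
    simp only [mul_one] at this
    simpa [hκ1, h.law_sum] using this
  · intro i f
    rw [hexp, ← h.marginal i fun s => ∑ t, κ s t * f (out s t), Fintype.sum_prod_type]
    refine Finset.sum_congr rfl fun ω _ => ?_
    simp only [mul_assoc, ← Finset.mul_sum]
    rw [sum_prod_mul_one (κ := fun i => κ (X i ω)) (fun i => hκ1 _) i
      fun t => f (out (X i ω) t)]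
  · intro i j hij f g
    rw [hexp, hexp, ← h.pair i j hij (fun s => ∑ t, κ s t * f (out s t))
      fun s => ∑ t, κ s t * g (out s t), Fintype.sum_prod_type]
    refine Finset.sum_congr rfl fun ω _ => ?_
    simp only [mul_assoc, ← Finset.mul_sum]
    rw [sum_prod_mul_two (κ := fun i => κ (X i ω)) (fun i => hκ1 _) hij
      (fun t => f (out (X i ω) t)) fun t => g (out (X j ω) t)]

end Selection

/-! ### Linear bins of nearly equal mass -/

section BinSelection

variable {F E ι : Type*} [Field F] [Fintype F] [AddCommGroup E] [Module F E] [Fintype E]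
  [DecidableEq E] [Fintype ι] [DecidableEq ι]

/-- Mass that `p` gives to the bin `u + ⟨g⟩`. -/
def binMass (p : E → ℝ) (g : ι → E) (u : E) : ℝ := ∑ b : ι → F, p (affMap (u, g) b)

/-- Conditional distribution of `p` on the bin `u + ⟨g⟩`. -/
def binKernel (p : E → ℝ) (g : ι → E) (u : E) (b : ι → F) : ℝ :=
  if binMass (F := F) p g u = 0 then (Fintype.card (ι → F) : ℝ)⁻¹
  else p (affMap (u, g) b) / binMass (F := F) p g u

variable (F) in
/-- Law of a word drawn from a uniformly random bin. -/
def binLaw (p : E → ℝ) (g : ι → E) (w : E) : ℝ :=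
  ∑ u : E, (Fintype.card E : ℝ)⁻¹ *
    ∑ b : ι → F, binKernel p g u b * if affMap (u, g) b = w then 1 else 0

lemma binKernel_nonneg {p : E → ℝ} (hp : ∀ w, 0 ≤ p w) (g : ι → E) (u : E) (b : ι → F) :
    0 ≤ binKernel p g u b := by
  unfold binKernel
  split_ifs
  · positivity
  · exact div_nonneg (hp _) (Finset.sum_nonneg fun _ _ => hp _)

lemma sum_binKernel (p : E → ℝ) (g : ι → E) (u : E) :
    ∑ b : ι → F, binKernel p g u b = 1 := by
  unfold binKernel
  split_ifs with h
  · rw [Finset.sum_const, Finset.card_univ, nsmul_eq_mul, mul_inv_cancel₀]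
    exact_mod_cast Fintype.card_ne_zero
  · rw [← Finset.sum_div]; exact div_self h

lemma sum_affMap_base (f : E → ℝ) (g : ι → E) (b : ι → F) :
    ∑ u, f (affMap (u, g) b) = ∑ u, f u :=
  Fintype.sum_equiv (Equiv.addRight (∑ i, b i • g i)) _ _ fun _ => rfl

/-- The law `p` is the same mixture over bins, with weights |E|/|F^ι|·p instead of the conditional
ones. Inside one bin the two weights are proportional, so only the bin mass matters. -/
lemma sum_abs_binLaw_sub_le {p : E → ℝ} (hp : ∀ w, 0 ≤ p w) (g : ι → E) :
    ∑ w, |binLaw F p g w - p w| ≤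
      ∑ u : E, (Fintype.card E : ℝ)⁻¹ *
        |1 - (Fintype.card E / Fintype.card (ι → F) : ℝ) * binMass (F := F) p g u| := by
  set e : ℝ := (Fintype.card E : ℝ)
  set k : ℝ := (Fintype.card (ι → F) : ℝ)
  have he : 0 < e := by simp only [e]; exact_mod_cast Fintype.card_pos
  have hk : 0 < k := by simp only [k]; exact_mod_cast Fintype.card_pos
  have hpw : ∀ w, p w = ∑ u : E, e⁻¹ * ∑ b : ι → F,
      (e / k) * p (affMap (u, g) b) * if affMap (u, g) b = w then 1 else 0 := by
    intro w
    rw [← Finset.mul_sum, Finset.sum_comm]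
    have : ∀ b : ι → F, ∑ u : E, (e / k) * p (affMap (u, g) b) *
        (if affMap (u, g) b = w then 1 else 0) = (e / k) * p w := by
      intro b
      rw [sum_affMap_base (fun u => (e / k) * p u * if u = w then 1 else 0) g b]
      simp
    simp only [this, Finset.sum_const, Finset.card_univ, nsmul_eq_mul]
    change _ = e⁻¹ * (k * _)
    field_simp
  have hdiff : ∀ w, |binLaw F p g w - p w| ≤ ∑ u : E, e⁻¹ * ∑ b : ι → F,
      |binKernel p g u b - (e / k) * p (affMap (u, g) b)| *
        if affMap (u, g) b = w then 1 else 0 := by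
    intro w
    conv_lhs => rw [hpw w]
    unfold binLaw
    rw [← Finset.sum_sub_distrib]
    refine (Finset.abs_sum_le_sum_abs _ _).trans (Finset.sum_le_sum fun u _ => ?_)
    rw [← mul_sub, ← Finset.sum_sub_distrib, abs_mul, abs_of_pos (inv_pos.2 he)]
    refine mul_le_mul_of_nonneg_left ?_ (inv_pos.2 he).le
    refine (Finset.abs_sum_le_sum_abs _ _).trans (Finset.sum_le_sum fun b _ => ?_)
    rw [← sub_mul, abs_mul]
    refine le_of_eq ?_
    congr 1
    split_ifs <;> simp
  refine (Finset.sum_le_sum fun w _ => hdiff w).trans ?_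
  rw [Finset.sum_comm]
  refine Finset.sum_le_sum fun u _ => ?_
  rw [← Finset.mul_sum]
  refine mul_le_mul_of_nonneg_left ?_ (inv_pos.2 he).le
  rw [Finset.sum_comm]
  simp only [← Finset.mul_sum, Finset.sum_ite_eq, Finset.mem_univ, if_true, mul_one]
  have hm0 : 0 ≤ binMass (F := F) p g u := Finset.sum_nonneg fun _ _ => hp _
  rcases hm0.eq_or_lt with h0 | h0
  · have hz : ∀ b : ι → F, p (affMap (u, g) b) = 0 := fun b =>
      (Finset.sum_eq_zero_iff_of_nonneg fun _ _ => hp _).1 h0.symm b (Finset.mem_univ _)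
    simp only [hz, mul_zero, sub_zero]
    rw [Finset.sum_congr rfl fun b _ => abs_of_nonneg (binKernel_nonneg hp g u b), sum_binKernel,
      ← h0]
    simp
  · have : ∀ b : ι → F, |binKernel p g u b - (e / k) * p (affMap (u, g) b)| =
        p (affMap (u, g) b) * ((binMass (F := F) p g u)⁻¹ *
          |1 - (e / k) * binMass (F := F) p g u|) := by
      intro b
      have e1 : binKernel p g u b - (e / k) * p (affMap (u, g) b) =
          p (affMap (u, g) b) * ((binMass (F := F) p g u)⁻¹ *
            (1 - (e / k) * binMass (F := F) p g u)) := by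
        rw [binKernel, if_neg h0.ne']; field_simp
      rw [e1, abs_mul, abs_mul, abs_of_nonneg (hp _), abs_of_pos (inv_pos.2 h0)]
    simp only [this, ← Finset.sum_mul]
    change binMass (F := F) p g u * _ ≤ _
    rw [← mul_assoc, mul_inv_cancel₀ h0.ne', one_mul]

/-- Some linear bin code makes the masses of almost all bins nearly equal. -/
lemma exists_uniform_bins {p : E → ℝ} (hp : ∀ w, 0 ≤ p w) (hp1 : ∑ w, p w = 1) {τ : ℝ}
    (hτ : 0 ≤ τ) :
    ∃ g : ι → E, ∑ w, |binLaw F p g w - p w| ≤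
      √((Fintype.card E : ℝ) * τ / Fintype.card (ι → F)) +
        2 * ∑ w, p w * if τ < p w then 1 else 0 := by
  set e : ℝ := (Fintype.card E : ℝ) with hedef
  set k : ℝ := (Fintype.card (ι → F) : ℝ) with hkdef
  have he : 0 < e := by simp only [e]; exact_mod_cast Fintype.card_pos
  have hk : 0 < k := by simp only [k]; exact_mod_cast Fintype.card_pos
  -- Without the heavy words p'² ≤ τp, which keeps the variance of the bin mass small.
  set p' : E → ℝ := fun w => p w * if τ < p w then 0 else 1 with hp'
  have hp'0 : ∀ w, 0 ≤ p' w := fun w => mul_nonneg (hp w) (by split_ifs <;> norm_num)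
  have hp'p : ∀ w, p' w ≤ p w := fun w =>
    mul_le_of_le_one_right (hp w) (by split_ifs <;> norm_num)
  set m := ∑ w, p' w with hm
  have hm1 : 1 - m = ∑ w, p w * if τ < p w then 1 else 0 := by
    rw [show (1 : ℝ) - m = ∑ w, p w - m by rw [hp1], hm, ← Finset.sum_sub_distrib]
    refine Finset.sum_congr rfl fun w _ => ?_
    simp only [hp']; split_ifs <;> ring
  have hsq : ∑ w, p' w ^ 2 ≤ τ := by
    have : ∀ w, p' w ^ 2 ≤ τ * p w := by
      intro w
      simp only [hp']
      split_ifs with h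
      · simpa using mul_nonneg hτ (hp w)
      · rw [mul_one, sq]; exact mul_le_mul_of_nonneg_right (not_lt.1 h) (hp w)
    refine (Finset.sum_le_sum fun w _ => this w).trans ?_
    rw [← Finset.mul_sum, hp1, mul_one]
  have hlaw := pairwiseLaw_affMap (F := F) (E := E) (ι := ι)
  set P : ℝ := (Fintype.card (E × (ι → E)) : ℝ)⁻¹ with hP
  have hP0 : 0 ≤ P := by positivity
  have hsm := hlaw.second_moment_le (fun _ => e / k) p'
  have hmean : (∑ _b : ι → F, e / k) * ∑ s, e⁻¹ * p' s = m := by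
    rw [Finset.sum_const, Finset.card_univ, nsmul_eq_mul, ← Finset.mul_sum, ← hkdef, ← hm]
    field_simp
  rw [hmean] at hsm
  have hvar : (∑ _b : ι → F, (e / k) ^ 2) * ∑ s, e⁻¹ * p' s ^ 2 ≤ e * τ / k := by
    rw [Finset.sum_const, Finset.card_univ, nsmul_eq_mul, ← Finset.mul_sum, ← hkdef]
    calc _ = (e / k) * ∑ w, p' w ^ 2 := by field_simp
      _ ≤ (e / k) * τ := by gcongr
      _ = _ := by ring
  have hav : ∑ vg : E × (ι → E), P * |1 - (e / k) * binMass (F := F) p vg.2 vg.1| ≤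
      √(e * τ / k) + 2 * (1 - m) := by
    -- The removed mass `1 - m` is paid for twice: as a shift of the mean and as heavy words that
    -- fall into bins.
    have hpt : ∀ vg : E × (ι → E), |1 - (e / k) * binMass (F := F) p vg.2 vg.1| ≤
        √((∑ b : ι → F, (e / k) * p' (affMap vg b) - m) ^ 2) +
          ∑ b : ι → F, (e / k) * (p (affMap vg b) - p' (affMap vg b)) + (1 - m) := by
      intro vg
      have h1 : 0 ≤ ∑ b : ι → F, (e / k) * (p (affMap vg b) - p' (affMap vg b)) :=
        Finset.sum_nonneg fun b _ => mul_nonneg (by positivity) (sub_nonneg.2 (hp'p _))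
      have h2 : 0 ≤ 1 - m := by
        rw [hm1]
        exact Finset.sum_nonneg fun w _ => mul_nonneg (hp w) (by split_ifs <;> norm_num)
      have h3 : (e / k) * binMass (F := F) p vg.2 vg.1 =
          ∑ b : ι → F, (e / k) * p' (affMap vg b) +
            ∑ b : ι → F, (e / k) * (p (affMap vg b) - p' (affMap vg b)) := by
        rw [binMass, Finset.mul_sum, ← Finset.sum_add_distrib]
        exact Finset.sum_congr rfl fun b _ => by ring
      rw [Real.sqrt_sq_eq_abs, h3, abs_le]
      have h4 := neg_abs_le (∑ b : ι → F, (e / k) * p' (affMap vg b) - m)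
      have h5 := le_abs_self (∑ b : ι → F, (e / k) * p' (affMap vg b) - m)
      constructor <;> linarith
    refine (Finset.sum_le_sum fun vg _ => mul_le_mul_of_nonneg_left (hpt vg) hP0).trans ?_
    simp only [mul_add, Finset.sum_add_distrib]
    have t1 : ∑ vg : E × (ι → E), P * √((∑ b : ι → F, (e / k) * p' (affMap vg b) - m) ^ 2) ≤
        √(e * τ / k) :=
      (average_sqrt_le hlaw.nonneg hlaw.sum_one.le fun _ => sq_nonneg _).trans
        (Real.sqrt_le_sqrt (hsm.trans hvar))
    have t2 : ∑ vg : E × (ι → E),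
        P * ∑ b : ι → F, (e / k) * (p (affMap vg b) - p' (affMap vg b)) = 1 - m := by
      simp only [Finset.mul_sum]
      rw [Finset.sum_comm]
      have : ∀ b : ι → F, ∑ vg : E × (ι → E), P * ((e / k) * (p (affMap vg b) - p' (affMap vg b)))
          = k⁻¹ * (1 - m) := by
        intro b
        rw [hlaw.marginal b fun w => (e / k) * (p w - p' w)]
        simp only [← Finset.mul_sum, Finset.sum_sub_distrib, hp1, ← hm, ← hedef]
        field_simp
      simp only [this, Finset.sum_const, Finset.card_univ, nsmul_eq_mul, ← hkdef]
      field_simp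
    have t3 : ∑ _vg : E × (ι → E), P * 1 = 1 := by simpa using hlaw.sum_one
    have t4 : ∑ _vg : E × (ι → E), P * m = m := by
      rw [← Finset.sum_mul, hlaw.sum_one, one_mul]
    have t5 : ∑ _vg : E × (ι → E), P * (1 - m) = 1 - m := by
      rw [← Finset.sum_mul, hlaw.sum_one, one_mul]
    linarith
  have hcardg : (0 : ℝ) < Fintype.card (ι → E) := by exact_mod_cast Fintype.card_pos
  -- The average over base points is part of the bound sought, so only the generators get fixed.
  have hav2 : ∑ g : ι → E, (Fintype.card (ι → E) : ℝ)⁻¹ *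
      (∑ u : E, e⁻¹ * |1 - (e / k) * binMass (F := F) p g u|) ≤ √(e * τ / k) + 2 * (1 - m) := by
    refine le_trans (le_of_eq ?_) hav
    rw [Fintype.sum_prod_type_right]
    refine Finset.sum_congr rfl fun g _ => ?_
    rw [Finset.mul_sum]
    refine Finset.sum_congr rfl fun u _ => ?_
    rw [hP, Fintype.card_prod]; push_cast; rw [mul_inv]; ring
  obtain ⟨g, hg⟩ := exists_le_of_average_le (fun _ => (inv_pos.2 hcardg).le)
    (by rw [Finset.sum_const, Finset.card_univ, nsmul_eq_mul, mul_inv_cancel₀ hcardg.ne']) hav2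
  refine ⟨g, (sum_abs_binLaw_sub_le hp g).trans ?_⟩
  rw [← hm1]
  exact hg

end BinSelection

/-! ### Tensor powers and their spectra -/

section Tensor

variable {H : Type*} [Fintype H] [DecidableEq H] {n : ℕ}

lemma tensorFamily_mul (S T : Fin n → Matrix H H ℂ) :
    tensorFamily S * tensorFamily T = tensorFamily fun t => S t * T t := by
  ext i j
  simp only [tensorFamily, Matrix.mul_apply, Matrix.of_apply, ← Finset.prod_mul_distrib]
  rw [Fintype.prod_sum]

lemma tensorFamily_conjTranspose (T : Fin n → Matrix H H ℂ) :
    (tensorFamily T).conjTranspose = tensorFamily fun t => (T t).conjTranspose := by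
  ext i j
  simp [tensorFamily, Matrix.conjTranspose_apply]

lemma tensorFamily_diagonal (d : Fin n → H → ℂ) :
    tensorFamily (fun t => Matrix.diagonal (d t)) = Matrix.diagonal fun a => ∏ t, d t (a t) := by
  ext i j
  by_cases h : i = j
  · subst h; simp [tensorFamily]
  · obtain ⟨t, ht⟩ := Function.ne_iff.1 h
    rw [Matrix.diagonal_apply_ne _ h, tensorFamily, Matrix.of_apply]
    exact Finset.prod_eq_zero (Finset.mem_univ t) (Matrix.diagonal_apply_ne _ ht)

lemma tensorFamily_one : tensorFamily (fun _ : Fin n => (1 : Matrix H H ℂ)) = 1 := by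
  simp only [← Matrix.diagonal_one, tensorFamily_diagonal]; simp

lemma tensorFamily_trace (T : Fin n → Matrix H H ℂ) :
    (tensorFamily T).trace = ∏ t, (T t).trace := by
  simp only [Matrix.trace, Matrix.diag, tensorFamily, Matrix.of_apply]
  rw [Fintype.prod_sum]

lemma tensorFamily_smul (c : Fin n → ℂ) (T : Fin n → Matrix H H ℂ) :
    tensorFamily (fun t => c t • T t) = (∏ t, c t) • tensorFamily T := by
  ext i j
  simp [tensorFamily, Finset.prod_mul_distrib]

lemma tensorFamily_sum {W : Type*} [Fintype W] (s : Fin n → W → Matrix H H ℂ) :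
    tensorFamily (fun t => ∑ w, s t w) = ∑ w : Fin n → W, tensorFamily fun t => s t (w t) := by
  ext i j
  simp only [tensorFamily, Matrix.of_apply, Matrix.sum_apply]
  rw [Fintype.prod_sum]

lemma tensorFamily_isUnitaryMat {U : Fin n → Matrix H H ℂ} (hU : ∀ t, IsUnitaryMat (U t)) :
    IsUnitaryMat (tensorFamily U) := by
  constructor
  · rw [tensorFamily_conjTranspose, tensorFamily_mul, ← tensorFamily_one]
    congr 1; ext1 t; exact (hU t).1
  · rw [tensorFamily_conjTranspose, tensorFamily_mul, ← tensorFamily_one]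
    congr 1; ext1 t; exact (hU t).2

lemma tensorFamily_specOp (U : Fin n → Matrix H H ℂ) (d : Fin n → H → ℝ) :
    tensorFamily (fun t => specOp (U t) (d t)) =
      specOp (tensorFamily U) fun a => ∏ t, d t (a t) := by
  simp only [specOp, ← tensorFamily_mul, ← tensorFamily_conjTranspose, tensorFamily_diagonal]
  simp

lemma tensorFamily_posSemidef {T : Fin n → Matrix H H ℂ} (hT : ∀ t, (T t).PosSemidef) :
    (tensorFamily T).PosSemidef := by
  have : tensorFamily T = (tensorFamily fun t => sqrtOp (T t)).conjTranspose *
      tensorFamily fun t => sqrtOp (T t) := by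
    rw [tensorFamily_conjTranspose, tensorFamily_mul]
    congr 1; ext1 t
    rw [(sqrtOp_isHermitian (hT t)).eq, sqrtOp_mul_self (hT t)]
  rw [this]
  exact Matrix.posSemidef_conjTranspose_mul_self _

lemma sqrtOp_tensorPow {ρ : Matrix H H ℂ} (hρ : ρ.PosSemidef) :
    sqrtOp (tensorPow n ρ) = tensorPow n (sqrtOp ρ) := by
  refine sqrtOp_eq_of_mul_self (tensorFamily_posSemidef fun _ => sqrtOp_posSemidef hρ) ?_
  rw [tensorPow, tensorFamily_mul, tensorPow]
  simp only [sqrtOp_mul_self hρ]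

lemma tensorPow_isDensity {ρ : Matrix H H ℂ} (hρ : IsDensity ρ) : IsDensity (tensorPow n ρ) :=
  ⟨tensorFamily_posSemidef fun _ => hρ.1, by rw [tensorPow, tensorFamily_trace]; simp [hρ.2]⟩

lemma vnEntropy_eq {b : ℝ} {σ U : Matrix H H ℂ} {d : H → ℝ} (hU : IsUnitaryMat U)
    (h2 : ∀ f : ℝ → ℝ, cfc f σ = specOp U (fun i => f (d i))) :
    vnEntropy b σ = ∑ i, d i * -Real.logb b (d i) := by
  rw [vnEntropy, h2, specOp_trace hU, Complex.ofReal_re]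
  exact Finset.sum_congr rfl fun i _ => by ring

end Tensor

/-! ### Typical subspaces and smoothing of ensembles -/

section Typical

/-- Asymptotic equipartition. -/
lemma exists_equipartition {X : Type*} [Fintype X] {b : ℝ} (hb : 1 < b) {P d : X → ℝ}
    (hP0 : ∀ x, 0 ≤ P x) (hP1 : ∑ x, P x = 1) (hd : ∀ x, 0 < P x → 0 < d x) {μ : ℝ}
    (hμ : μ = ∑ x, P x * -Real.logb b (d x)) {δ ε : ℝ} (hδ : 0 < δ) (hε : 0 < ε) :
    ∃ N : ℕ, ∀ n : ℕ, N ≤ n → ∑ x : Fin n → X, (∏ t, P (x t)) *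
      (if b ^ (-(n * (μ + δ))) ≤ ∏ t, d (x t) ∧ ∏ t, d (x t) ≤ b ^ (-(n * (μ - δ)))
        then (0 : ℝ) else 1) ≤ ε := by
  obtain ⟨N, hN⟩ := exists_weak_law hP0 hP1 (fun x => -Real.logb b (d x)) hδ hε
  refine ⟨N, fun n hn => (Finset.sum_le_sum fun x _ => ?_).trans (hN n hn)⟩
  have hp : 0 ≤ ∏ t, P (x t) := Finset.prod_nonneg fun t _ => hP0 _
  -- Words of mass zero contribute nothing, so logarithms are taken only where every `d (x t)` is
  -- positive.
  rcases hp.eq_or_lt with h0 | h0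
  · simp [← h0]
  refine mul_le_mul_of_nonneg_left ?_ hp
  have hdp : ∀ t, 0 < d (x t) := fun t => hd _ <|
    lt_of_le_of_ne (hP0 _) fun h => h0.ne' (Finset.prod_eq_zero (Finset.mem_univ t) h.symm)
  have hprod : ∏ t, d (x t) = b ^ (-∑ t, -Real.logb b (d (x t))) := by
    rw [Finset.sum_neg_distrib, neg_neg, Real.rpow_sum_of_pos (by linarith)]
    exact Finset.prod_congr rfl fun t _ => (Real.rpow_logb (by linarith) hb.ne' (hdp t)).symm
  simp only [← hμ, hprod, Real.rpow_le_rpow_left_iff hb]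
  split_ifs with h1 h2 h2
  · norm_num
  · norm_num
  · norm_num
  · exfalso
    refine h1 ?_
    rw [not_lt, abs_le] at h2
    constructor <;> linarith [h2.1, h2.2]

variable {H W : Type*} [Fintype H] [DecidableEq H] [Fintype W]

/-- `(p, s)` is an ensemble of states (operators of zero probability need not be normalized). -/
structure IsEnsemble (s : W → Matrix H H ℂ) (p : W → ℝ) : Prop where
  nonneg : ∀ w, 0 ≤ p w
  sum_one : ∑ w, p w = 1
  posSemidef : ∀ w, (s w).PosSemidef
  trace_le : ∀ w, (s w).trace.re ≤ 1
  mul_trace : ∀ w, p w * (s w).trace.re = p w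

lemma IsEnsemble.average_isDensity {s : W → Matrix H H ℂ} {p : W → ℝ} (h : IsEnsemble s p) :
    IsDensity (∑ w, (p w : ℂ) • s w) := by
  refine ⟨Matrix.posSemidef_sum _ fun w _ => (h.posSemidef w).smul
    (Complex.zero_le_real.2 (h.nonneg w)), ?_⟩
  rw [Matrix.trace_sum]
  simp only [Matrix.trace_smul, smul_eq_mul]
  have : ∀ w, (p w : ℂ) * (s w).trace = ((p w : ℝ) : ℂ) := fun w => by
    rw [trace_eq_re (h.posSemidef w).1, ← Complex.ofReal_mul, h.mul_trace]
  simp only [this]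
  rw [← Complex.ofReal_sum, h.sum_one, Complex.ofReal_one]

lemma sum_prod_smul_tensorFamily {n : ℕ} (s : W → Matrix H H ℂ) (p : W → ℝ) :
    ∑ w : Fin n → W, ((∏ t, p (w t) : ℝ) : ℂ) • tensorFamily (fun t => s (w t)) =
      tensorPow n (∑ w, (p w : ℂ) • s w) := by
  rw [tensorPow, tensorFamily_sum]
  refine Finset.sum_congr rfl fun w _ => ?_
  rw [tensorFamily_smul]; simp

/-- A smoothing of the `n`-fold ensemble: the projection `proj` onto the typical subspace and the
truncated states `cut w`, with the bounds on dimensions and eigenvalues. -/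
structure IsSmoothing {b : ℝ} {n : ℕ} (s : W → Matrix H H ℂ) (p : W → ℝ) (S Sc δ ε : ℝ)
    (proj : Matrix (Fin n → H) (Fin n → H) ℂ)
    (cut : (Fin n → W) → Matrix (Fin n → H) (Fin n → H) ℂ) : Prop where
  isHermitian : proj.IsHermitian
  mul_self : proj * proj = proj
  isContr : IsContr proj
  trace_le : proj.trace.re ≤ b ^ (n * (S + δ))
  compress_le : (((b ^ (-(n * (S - δ))) : ℝ) : ℂ) • 1 -
    proj * tensorPow n (∑ w, (p w : ℂ) • s w) * proj).PosSemidef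
  tn_compress_le : tn (tensorPow n (∑ w, (p w : ℂ) • s w) -
    proj * tensorPow n (∑ w, (p w : ℂ) • s w) * proj) ≤ ε
  cut_isHermitian : ∀ w, (cut w).IsHermitian
  proj_mul_cut : ∀ w, proj * cut w = cut w
  hsSq_cut_le : ∀ w, hsSq (cut w) ≤ b ^ (-(n * (Sc - δ)))
  rank_cut_le : ∀ w, ((cut w).rank : ℝ) ≤ b ^ (n * (Sc + δ))
  tn_sub_cut_le_two : ∀ w, tn (tensorFamily (fun t => s (w t)) - cut w) ≤ 2
  sum_tn_sub_cut_le : ∑ w : Fin n → W,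
    (∏ t, p (w t)) * tn (tensorFamily (fun t => s (w t)) - cut w) ≤ ε

lemma card_filter_le_of_le {X : Type*} [Fintype X] {P : X → ℝ} (hP0 : ∀ x, 0 ≤ P x)
    (hP1 : ∑ x, P x ≤ 1) {a : ℝ} (ha : 0 < a) (D : X → Prop) [DecidablePred D]
    (hD : ∀ x, D x → a⁻¹ ≤ P x) :
    ((Finset.univ.filter D).card : ℝ) ≤ a := by
  have h1 : ((Finset.univ.filter D).card : ℝ) * a⁻¹ ≤ 1 := by
    rw [← nsmul_eq_mul, ← Finset.sum_const]
    refine le_trans ?_ hP1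
    refine (Finset.sum_le_sum (g := P) fun x hx => hD x (Finset.mem_filter.1 hx).2).trans ?_
    exact Finset.sum_le_sum_of_subset_of_nonneg (Finset.subset_univ _) fun x _ _ => hP0 x
  rwa [← div_eq_mul_inv, div_le_one ha] at h1

lemma rank_specOp_le (U : Matrix H H ℂ) (d : H → ℝ) (D : H → Prop) [DecidablePred D]
    (hD : ∀ i, d i ≠ 0 → D i) : (specOp U d).rank ≤ (Finset.univ.filter D).card := by
  unfold specOp
  refine (Matrix.rank_mul_le_left _ _).trans ((Matrix.rank_mul_le_right _ _).trans ?_)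
  rw [Matrix.rank_diagonal, Fintype.card_subtype]
  refine Finset.card_le_card fun i hi => ?_
  simp only [Finset.mem_filter, Finset.mem_univ, true_and] at hi ⊢
  exact hD i (by simpa using hi)

/-- `proj` is the typical spectral projection of the n-fold average; `cut w` keeps the typical
eigenvalues of the state of `w` and is then compressed by `proj`. Rank and Hilbert–Schmidt bounds
hold for every word, smallness of the loss only on average. -/
lemma exists_isSmoothing {b : ℝ} (hb : 1 < b) {s : W → Matrix H H ℂ} {p : W → ℝ}
    (h : IsEnsemble s p) {δ ε : ℝ} (hδ : 0 < δ) (hε : 0 < ε) :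
    ∃ N : ℕ, ∀ n : ℕ, N ≤ n → ∃ proj cut,
      IsSmoothing (b := b) (n := n) s p (vnEntropy b (∑ w, (p w : ℂ) • s w))
        (∑ w, p w * vnEntropy b (s w)) δ ε proj cut := by
  have hbp : 0 < b := by linarith
  have hρ := h.average_isDensity
  set σ := ∑ w, (p w : ℂ) • s w with hσ
  obtain ⟨V, hV, hσV, hVf⟩ := exists_specOp hρ.1.1
  have hg0 := hρ.1.eigenvalues_nonneg
  set g := hρ.1.1.eigenvalues
  have hS := vnEntropy_eq (b := b) hV hVf
  set S := vnEntropy b σ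
  have hg1 : ∑ i, g i = 1 := by
    have := hρ.2
    rw [hσV, specOp_trace hV] at this
    exact_mod_cast this
  choose U hU hsU hUf using fun w => exists_specOp (h.posSemidef w).1
  have hd0 := fun w => (h.posSemidef w).eigenvalues_nonneg
  set d : W → H → ℝ := fun w => (h.posSemidef w).1.eigenvalues
  have hd1 : ∀ w, ∑ a, d w a = (s w).trace.re := fun w => by
    conv_rhs => rw [hsU w]
    rw [specOp_trace (hU w), Complex.ofReal_re]
  have hSc : ∑ w, p w * vnEntropy b (s w) =
      ∑ x : W × H, p x.1 * d x.1 x.2 * -Real.logb b (d x.1 x.2) := by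
    rw [Fintype.sum_prod_type]
    refine Finset.sum_congr rfl fun w _ => ?_
    rw [vnEntropy_eq (hU w) (hUf w), Finset.mul_sum]
    exact Finset.sum_congr rfl fun a _ => by ring
  set Sc := ∑ w, p w * vnEntropy b (s w)
  -- This gives e ≤ √e ≤ ε/3, hence 2√e + e ≤ ε.
  set e : ℝ := min 1 ((ε / 3) ^ 2)
  have he : 0 < e := lt_min one_pos (by positivity)
  have he1 : e ≤ √e := by
    conv_lhs => rw [← Real.mul_self_sqrt he.le]
    exact mul_le_of_le_one_left (Real.sqrt_nonneg _) (Real.sqrt_le_one.2 (min_le_left _ _))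
  have he2 : √e ≤ ε / 3 := by
    rw [Real.sqrt_le_left (by positivity)]; exact min_le_right _ _
  obtain ⟨N₁, hN₁⟩ := exists_equipartition hb (P := g) (d := g) hg0 hg1 (fun x hx => hx) hS hδ he
  -- Conditional typicality is equipartition for pairs (letter, eigenvalue index) under the law
  -- p(w)·d_w(a).
  obtain ⟨N₂, hN₂⟩ := exists_equipartition hb (P := fun x : W × H => p x.1 * d x.1 x.2)
    (d := fun x => d x.1 x.2) (fun x => mul_nonneg (h.nonneg _) (hd0 _ _))
    (by
      rw [Fintype.sum_prod_type]
      simp only [← Finset.mul_sum, hd1, h.mul_trace, h.sum_one])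
    (fun x hx => lt_of_le_of_ne (hd0 _ _) fun h0 => by
      change 0 = d x.1 x.2 at h0
      simp [← h0] at hx) hSc hδ he
  refine ⟨max N₁ N₂, fun n hn => ?_⟩
  specialize hN₁ n (le_of_max_le_left hn)
  specialize hN₂ n (le_of_max_le_right hn)
  set G : (Fin n → H) → ℝ := fun a => ∏ t, g (a t) with hG
  have hG0 : ∀ a, 0 ≤ G a := fun a => Finset.prod_nonneg fun t _ => hg0 _
  have hG1 : ∑ a, G a = 1 := sum_prod_eq_one (κ := fun _ => g) fun _ => hg1
  set D : (Fin n → W) → (Fin n → H) → ℝ := fun w a => ∏ t, d (w t) (a t) with hD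
  have hD0 : ∀ w a, 0 ≤ D w a := fun w a => Finset.prod_nonneg fun t _ => hd0 _ _
  have hD1 : ∀ w, ∑ a, D w a ≤ 1 := fun w => by
    simp only [hD]
    rw [← Fintype.prod_sum (fun t a => d (w t) a)]
    refine Finset.prod_le_one (fun t _ => Finset.sum_nonneg fun a _ => hd0 _ _) fun t _ => ?_
    rw [hd1]; exact h.trace_le _
  set VV := tensorFamily fun _ : Fin n => V
  set UU : (Fin n → W) → Matrix (Fin n → H) (Fin n → H) ℂ := fun w => tensorFamily fun t => U (w t)
  have hVV : IsUnitaryMat VV := tensorFamily_isUnitaryMat fun _ => hV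
  have hUU : ∀ w, IsUnitaryMat (UU w) := fun w => tensorFamily_isUnitaryMat fun _ => hU _
  have hω : tensorPow n σ = specOp VV G := by
    rw [tensorPow]
    conv_lhs => rw [hσV]
    exact tensorFamily_specOp _ _
  have hsw : ∀ w : Fin n → W, tensorFamily (fun t => s (w t)) = specOp (UU w) (D w) := fun w => by
    rw [← tensorFamily_specOp]
    congr 1; ext1 t; exact hsU _
  classical
  set TG : (Fin n → H) → Prop := fun a => b ^ (-(n * (S + δ))) ≤ G a ∧ G a ≤ b ^ (-(n * (S - δ)))
  set TD : (Fin n → W) → (Fin n → H) → Prop := fun w a =>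
    b ^ (-(n * (Sc + δ))) ≤ D w a ∧ D w a ≤ b ^ (-(n * (Sc - δ)))
  set iG : (Fin n → H) → ℝ := fun a => if TG a then 1 else 0 with hiG
  set iD : (Fin n → W) → (Fin n → H) → ℝ := fun w a => if TD w a then 1 else 0 with hiD
  set proj := specOp VV iG with hproj
  set cut0 : (Fin n → W) → Matrix (Fin n → H) (Fin n → H) ℂ :=
    fun w => specOp (UU w) fun a => D w a * iD w a with hcut0
  have hGt : ∑ a, G a * (1 - iG a) ≤ e := by
    refine le_trans (le_of_eq (Finset.sum_congr rfl fun a _ => ?_)) hN₁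
    by_cases hT : TG a
    · rw [if_pos hT]; simp [hiG, hT]
    · rw [if_neg hT]; simp [hiG, hT, hG]
  have hDt : ∑ w : Fin n → W, (∏ t, p (w t)) * ∑ a, D w a * (1 - iD w a) ≤ e := by
    refine le_trans (le_of_eq ?_) hN₂
    rw [← (Equiv.arrowProdEquivProdArrow (Fin n) (fun _ => W) (fun _ => H)).symm.sum_comp,
      Fintype.sum_prod_type]
    refine Finset.sum_congr rfl fun w _ => ?_
    rw [Finset.mul_sum]
    refine Finset.sum_congr rfl fun a _ => ?_
    by_cases hT : TD w a
    · rw [if_pos]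
      · simp [hiD, hT]
      · exact hT
    · rw [if_neg]
      · simp [hiD, hT, hD, Equiv.arrowProdEquivProdArrow, Finset.prod_mul_distrib]
      · exact hT
  have hiG01 : ∀ a, 0 ≤ iG a ∧ iG a ≤ 1 := fun a => by
    simp only [hiG]; split_ifs <;> norm_num
  have hiD01 : ∀ w a, 0 ≤ iD w a ∧ iD w a ≤ 1 := fun w a => by
    simp only [hiD]; split_ifs <;> norm_num
  have hherm : proj.IsHermitian := specOp_isHermitian _ _
  have hsq : proj * proj = proj := by
    rw [hproj, specOp_mul hVV]; congr 1; ext a; simp only [hiG]; split_ifs <;> simp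
  have hcontr : IsContr proj := isContr_specOp hVV fun a =>
    abs_le.2 ⟨by linarith [(hiG01 a).1], (hiG01 a).2⟩
  have hone : (1 : Matrix (Fin n → H) (Fin n → H) ℂ) = specOp VV fun _ => 1 := (specOp_one hVV).symm
  have hpωp : proj * tensorPow n σ * proj = specOp VV fun a => iG a * G a * iG a := by
    rw [hω, hproj, specOp_mul hVV, specOp_mul hVV]
  have hspsd : ∀ w : Fin n → W, (tensorFamily fun t => s (w t)).PosSemidef := fun w =>
    tensorFamily_posSemidef fun t => h.posSemidef _
  have hstr : ∀ w : Fin n → W, (tensorFamily fun t => s (w t)).trace.re ≤ 1 := fun w => by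
    rw [hsw, specOp_trace (hUU w), Complex.ofReal_re]; exact hD1 w
  have hcut_psd : ∀ w, (cut0 w).PosSemidef := fun w =>
    specOp_posSemidef _ fun a => mul_nonneg (hD0 w a) (hiD01 w a).1
  have hpow : ∀ x : ℝ, b ^ (-x) = (b ^ x)⁻¹ := fun x => Real.rpow_neg hbp.le x
  have hsub : ∀ w, tensorFamily (fun t => s (w t)) - cut0 w =
      specOp (UU w) fun a => D w a * (1 - iD w a) := fun w => by
    rw [hsw, hcut0, specOp_sub]; congr 1; ext a; ring
  have hsub_tn : ∀ w, tn (tensorFamily (fun t => s (w t)) - cut0 w) ≤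
      ∑ a, D w a * (1 - iD w a) := fun w => by
    rw [hsub]
    refine (tn_of_posSemidef_le (specOp_posSemidef _ fun a =>
      mul_nonneg (hD0 w a) (by linarith [(hiD01 w a).2]))).trans (le_of_eq ?_)
    rw [specOp_trace (hUU w), Complex.ofReal_re]
  refine ⟨proj, fun w => proj * cut0 w * proj, hherm, hsq, hcontr, ?_, ?_, ?_, ?_, ?_, ?_, ?_, ?_,
    ?_⟩
  · rw [hproj, specOp_trace hVV, Complex.ofReal_re]
    have hcard : ∑ a, iG a = ((Finset.univ.filter TG).card : ℝ) :=
      Finset.sum_boole TG _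
    rw [hcard]
    exact card_filter_le_of_le hG0 hG1.le (by positivity) TG fun a ha => by
      rw [← hpow]; exact ha.1
  · rw [hpωp, hone, ← specOp_smul, specOp_sub]
    refine specOp_posSemidef _ fun a => ?_
    rw [mul_one, sub_nonneg]
    simp only [hiG]
    split_ifs with ha
    · simpa using ha.2
    · simp; positivity
  · rw [hpωp, hω, specOp_sub]
    refine (tn_of_posSemidef_le (specOp_posSemidef _ fun a => ?_)).trans ?_
    · simp only [hiG]; split_ifs <;> simp [hG0 a]
    · rw [specOp_trace hVV, Complex.ofReal_re]
      refine le_trans (le_of_eq (Finset.sum_congr rfl fun a _ => ?_)) (hGt.trans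
        (he1.trans (he2.trans (by linarith))))
      simp only [hiG]; split_ifs <;> simp
  · intro w
    have := (hcut_psd w).mul_mul_conjTranspose_same proj
    rw [hherm.eq] at this
    exact this.1
  · intro w; simp only [← mul_assoc, hsq]
  · intro w
    refine (hcontr.hsSq_mul_le' _).trans ((hcontr.hsSq_mul_le _).trans ?_)
    rw [hsSq_eq_trace, (hcut_psd w).1.eq, hcut0, specOp_mul (hUU w), specOp_trace (hUU w),
      Complex.ofReal_re]
    calc _ ≤ ∑ a, b ^ (-(n * (Sc - δ))) * D w a := Finset.sum_le_sum fun a _ => by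
            simp only [hiD]
            split_ifs with ha
            · simpa using mul_le_mul_of_nonneg_right ha.2 (hD0 w a)
            · simpa using mul_nonneg (by positivity) (hD0 w a)
      _ ≤ _ := by
        rw [← Finset.mul_sum]
        exact mul_le_of_le_one_right (by positivity) (hD1 w)
  · intro w
    have h1 : (proj * cut0 w * proj).rank ≤ (cut0 w).rank :=
      (Matrix.rank_mul_le_left _ _).trans (Matrix.rank_mul_le_right _ _)
    have h2 : (cut0 w).rank ≤ (Finset.univ.filter (TD w)).card :=
      rank_specOp_le _ _ _ fun a ha => by
        by_contra hcon
        simp [hiD, hcon] at ha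
    refine le_trans (by exact_mod_cast h1.trans h2) (card_filter_le_of_le (hD0 w) (hD1 w)
      (by positivity) (TD w) fun a ha => ?_)
    rw [← hpow]; exact ha.1
  · intro w
    have h1 : tn (proj * cut0 w * proj) ≤ 1 := by
      refine (tn_contr_mul_contr_le hcontr hcontr _).trans
        ((tn_of_posSemidef_le (hcut_psd w)).trans ?_)
      rw [hcut0, specOp_trace (hUU w), Complex.ofReal_re]
      exact (Finset.sum_le_sum fun a _ => mul_le_of_le_one_right (hD0 w a) (hiD01 w a).2).trans
        (hD1 w)
    have h2 := (tn_of_posSemidef_le (hspsd w)).trans (hstr w)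
    rw [sub_eq_add_neg]
    refine (tn_add_le _ _).trans ?_
    rw [tn_neg]; linarith
  · have hp0 : ∀ w : Fin n → W, 0 ≤ ∏ t, p (w t) := fun w =>
      Finset.prod_nonneg fun t _ => h.nonneg _
    set x : (Fin n → W) → ℝ := fun w =>
      ((1 - proj) * tensorFamily (fun t => s (w t)) * (1 - proj)).trace.re with hx
    have h1p : (1 - proj).conjTranspose = 1 - proj := by simp [hherm.eq]
    have hx0 : ∀ w, 0 ≤ x w := fun w => by
      have := re_trace_nonneg ((hspsd w).mul_mul_conjTranspose_same (1 - proj))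
      rwa [h1p] at this
    have hpt : ∀ w, tn (tensorFamily (fun t => s (w t)) - proj * cut0 w * proj) ≤
        2 * √(x w) + ∑ a, D w a * (1 - iD w a) := by
      intro w
      refine (tn_sub_le _ (proj * tensorFamily (fun t => s (w t)) * proj) _).trans ?_
      refine add_le_add ?_ ?_
      · refine (tn_sub_compress_le (hspsd w) hherm hcontr).trans ?_
        refine mul_le_mul_of_nonneg_right ?_ (Real.sqrt_nonneg _)
        have := Real.sqrt_le_one.2 (hstr w)
        linarith
      · rw [← sub_mul, ← mul_sub]
        exact (tn_contr_mul_contr_le hcontr hcontr _).trans (hsub_tn w)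
    refine (Finset.sum_le_sum fun w _ => mul_le_mul_of_nonneg_left (hpt w) (hp0 w)).trans ?_
    simp only [mul_add, Finset.sum_add_distrib]
    -- By linearity the mean weight outside `proj` is that of the average state, where `proj` is
    -- typical.
    have hsumx : ∑ w, (∏ t, p (w t)) * x w ≤ e := by
      have : ∑ w, (∏ t, p (w t)) * x w =
          ((1 - proj) * tensorPow n σ * (1 - proj)).trace.re := by
        rw [hσ, ← sum_prod_smul_tensorFamily, Finset.mul_sum, Finset.sum_mul, Matrix.trace_sum,
          Complex.re_sum]
        refine Finset.sum_congr rfl fun w _ => ?_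
        rw [Matrix.mul_smul, Matrix.smul_mul, Matrix.trace_smul, smul_eq_mul,
          Complex.re_ofReal_mul]
      rw [this, hone, hω, hproj, specOp_sub, specOp_mul hVV, specOp_mul hVV, specOp_trace hVV,
        Complex.ofReal_re]
      refine le_trans (le_of_eq (Finset.sum_congr rfl fun a _ => ?_)) hGt
      simp only [hiG]; split_ifs <;> simp
    have hpsum : ∑ w : Fin n → W, ∏ t, p (w t) ≤ 1 :=
      (sum_prod_eq_one (κ := fun _ => p) fun _ => h.sum_one).le
    have hj := average_sqrt_le hp0 hpsum hx0
    have hj2 := hj.trans (Real.sqrt_le_sqrt hsumx)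
    have e3 : ∑ w : Fin n → W, (∏ t, p (w t)) * (2 * √(x w)) =
        2 * ∑ w : Fin n → W, (∏ t, p (w t)) * √(x w) := by
      rw [Finset.mul_sum]; exact Finset.sum_congr rfl fun w _ => by ring
    rw [e3]
    linarith

end Typical

/-! ### Quantum soft covering -/

section Covering

lemma sum_mul_hsSq {T H : Type*} [Fintype T] [Fintype H] (c : T → ℝ) (g : T → Matrix H H ℂ) :
    ∑ t, c t * hsSq (g t) =
      ∑ x, ∑ y, (∑ t, c t * (g t x y).re ^ 2 + ∑ t, c t * (g t x y).im ^ 2) := by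
  have hn : ∀ z : ℂ, ‖z‖ ^ 2 = z.re ^ 2 + z.im ^ 2 := fun z => by
    rw [← Complex.normSq_eq_norm_sq, Complex.normSq_apply]; ring
  simp only [hsSq, hn, Finset.mul_sum, ← Finset.sum_add_distrib, ← mul_add]
  rw [Finset.sum_comm]
  refine Finset.sum_congr rfl fun x _ => ?_
  rw [Finset.sum_comm]

/-- The squared norm is a sum over real and imaginary parts of entries, each governed by the scalar
bound. -/
lemma PairwiseLaw.hsSq_second_moment_le {Ω I S H : Type*} [Fintype Ω] [Fintype I] [Fintype S]
    [Fintype H] {P : Ω → ℝ} {X : I → Ω → S} {Q : S → ℝ} (h : PairwiseLaw P X Q) (a : I → ℝ)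
    (ha : ∑ i, a i = 1) (f : S → Matrix H H ℂ) :
    ∑ ω, P ω * hsSq (∑ i, (a i : ℂ) • f (X i ω) - ∑ s, (Q s : ℂ) • f s) ≤
      (∑ i, a i ^ 2) * ∑ s, Q s * hsSq (f s) := by
  have hre : ∀ x y, ∑ ω, P ω * ((∑ i, (a i : ℂ) • f (X i ω) - ∑ s, (Q s : ℂ) • f s) x y).re ^ 2 ≤
      (∑ i, a i ^ 2) * ∑ s, Q s * (f s x y).re ^ 2 := by
    intro x y
    refine le_trans (le_of_eq ?_) (h.second_moment_le a fun s => (f s x y).re)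
    refine Finset.sum_congr rfl fun ω _ => ?_
    simp [Matrix.sub_apply, Matrix.sum_apply, ha]
  have him : ∀ x y, ∑ ω, P ω * ((∑ i, (a i : ℂ) • f (X i ω) - ∑ s, (Q s : ℂ) • f s) x y).im ^ 2 ≤
      (∑ i, a i ^ 2) * ∑ s, Q s * (f s x y).im ^ 2 := by
    intro x y
    refine le_trans (le_of_eq ?_) (h.second_moment_le a fun s => (f s x y).im)
    refine Finset.sum_congr rfl fun ω _ => ?_
    simp [Matrix.sub_apply, Matrix.sum_apply, ha]
  rw [sum_mul_hsSq, sum_mul_hsSq, Finset.mul_sum]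
  refine Finset.sum_le_sum fun x _ => ?_
  rw [Finset.mul_sum]
  refine Finset.sum_le_sum fun y _ => ?_
  rw [mul_add]
  exact add_le_add (hre x y) (him x y)

variable {H W : Type*} [Fintype H] [DecidableEq H] [Fintype W] {b : ℝ} {n : ℕ}
  {s : W → Matrix H H ℂ} {p : W → ℝ} {S Sc δ ε : ℝ}
  {proj : Matrix (Fin n → H) (Fin n → H) ℂ}
  {cut : (Fin n → W) → Matrix (Fin n → H) (Fin n → H) ℂ}

lemma IsEnsemble.tn_tensorFamily_le (hens : IsEnsemble s p) (w : Fin n → W) :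
    tn (tensorFamily fun t => s (w t)) ≤ 1 := by
  refine (tn_of_posSemidef_le (tensorFamily_posSemidef fun t => hens.posSemidef _)).trans ?_
  have : (tensorFamily fun t => s (w t)).trace = ((∏ t, (s (w t)).trace.re : ℝ) : ℂ) := by
    rw [tensorFamily_trace, Complex.ofReal_prod]
    exact Finset.prod_congr rfl fun t _ => trace_eq_re (hens.posSemidef _).1
  rw [this, Complex.ofReal_re]
  exact Finset.prod_le_one (fun t _ => re_trace_nonneg (hens.posSemidef _))
    fun t _ => hens.trace_le _

/-- The loss never exceeds 2, so replacing the law p^n by `Q` costs at most twice their ℓ¹ distance.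
-/
lemma IsSmoothing.sum_law_tn_le (hs : IsSmoothing (b := b) (n := n) s p S Sc δ ε proj cut)
    (Q : (Fin n → W) → ℝ) :
    ∑ w, Q w * tn (tensorFamily (fun t => s (w t)) - cut w) ≤
      ε + 2 * ∑ w, |Q w - ∏ t, p (w t)| := by
  have : ∀ w, Q w * tn (tensorFamily (fun t => s (w t)) - cut w) ≤
      (∏ t, p (w t)) * tn (tensorFamily (fun t => s (w t)) - cut w) +
        2 * |Q w - ∏ t, p (w t)| := by
    intro w
    have h1 := le_abs_self (Q w - ∏ t, p (w t))
    have h2 := hs.tn_sub_cut_le_two w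
    have h3 := tn_nonneg (tensorFamily (fun t => s (w t)) - cut w)
    have h4 := abs_nonneg (Q w - ∏ t, p (w t))
    nlinarith
  refine (Finset.sum_le_sum fun w _ => this w).trans ?_
  rw [Finset.sum_add_distrib, ← Finset.mul_sum]
  linarith [hs.sum_tn_sub_cut_le]

/-- Quantum soft covering with pairwise independent codewords. -/
lemma IsSmoothing.covering (hs : IsSmoothing (b := b) (n := n) s p S Sc δ ε proj cut)
    (hb : 1 < b) (hens : IsEnsemble s p) {Ω I : Type*} [Fintype Ω] [Fintype I] {P : Ω → ℝ}
    {X : I → Ω → (Fin n → W)} {Q : (Fin n → W) → ℝ} (h : PairwiseLaw P X Q) {a : I → ℝ}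
    (ha0 : ∀ i, 0 ≤ a i) (ha : ∑ i, a i = 1) {α : ℝ} (hα : ∀ i, a i ≤ α) :
    ∑ ω, P ω * tn (∑ i, (a i : ℂ) • tensorFamily (fun t => s (X i ω t)) -
        tensorPow n (∑ w, (p w : ℂ) • s w)) ≤
      2 * ε + 5 * ∑ w, |Q w - ∏ t, p (w t)| + √(α * b ^ (n * (S - Sc + 2 * δ))) := by
  set σ : (Fin n → W) → Matrix (Fin n → H) (Fin n → H) ℂ := fun w =>
    tensorFamily fun t => s (w t) with hσ
  set D := ∑ w, |Q w - ∏ t, p (w t)| with hD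
  have hb0 : 0 < b := by linarith
  have hpw : tensorPow n (∑ w, (p w : ℂ) • s w) =
      ∑ w : Fin n → W, ((∏ t, p (w t) : ℝ) : ℂ) • σ w := (sum_prod_smul_tensorFamily s p).symm
  have hQcut := hs.sum_law_tn_le Q
  have hmean : tn (∑ w, (Q w : ℂ) • cut w - tensorPow n (∑ w, (p w : ℂ) • s w)) ≤
      ε + 3 * D := by
    have e : ∑ w, (Q w : ℂ) • cut w - tensorPow n (∑ w, (p w : ℂ) • s w) =
        ∑ w, (Q w : ℂ) • (cut w - σ w) + ∑ w, ((Q w - ∏ t, p (w t) : ℝ) : ℂ) • σ w := by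
      rw [hpw, ← Finset.sum_sub_distrib, ← Finset.sum_add_distrib]
      refine Finset.sum_congr rfl fun w _ => ?_
      rw [Complex.ofReal_sub, sub_smul, smul_sub]; abel
    rw [e]
    refine (tn_add_le _ _).trans ?_
    have h1 : tn (∑ w, (Q w : ℂ) • (cut w - σ w)) ≤ ε + 2 * D := by
      refine (tn_sum_le _ _).trans (le_trans (Finset.sum_le_sum fun w _ => ?_) hQcut)
      refine (tn_smul_le _ _).trans (le_of_eq ?_)
      rw [abs_of_nonneg (h.law_nonneg w), tn_sub_comm]
    have h2 : tn (∑ w, ((Q w - ∏ t, p (w t) : ℝ) : ℂ) • σ w) ≤ D := by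
      refine (tn_sum_le _ _).trans (Finset.sum_le_sum fun w _ => ?_)
      refine (tn_smul_le _ _).trans ?_
      exact mul_le_of_le_one_right (abs_nonneg _) (hens.tn_tensorFamily_le w)
    linarith
  -- The fluctuation of the truncated average about its mean. It lies in the range of `proj`, so its
  -- trace norm costs only a factor √(tr proj) over its Hilbert–Schmidt norm.
  set T : Ω → Matrix (Fin n → H) (Fin n → H) ℂ := fun ω =>
    ∑ i, (a i : ℂ) • cut (X i ω) - ∑ w, (Q w : ℂ) • cut w with hT
  have hpt : ∀ ω, tn (∑ i, (a i : ℂ) • σ (X i ω) - tensorPow n (∑ w, (p w : ℂ) • s w)) ≤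
      ∑ i, a i * tn (σ (X i ω) - cut (X i ω)) + √(proj.trace.re) * √(hsSq (T ω)) +
        (ε + 3 * D) := by
    intro ω
    have e : ∑ i, (a i : ℂ) • σ (X i ω) - tensorPow n (∑ w, (p w : ℂ) • s w) =
        ∑ i, (a i : ℂ) • (σ (X i ω) - cut (X i ω)) + T ω +
          (∑ w, (Q w : ℂ) • cut w - tensorPow n (∑ w, (p w : ℂ) • s w)) := by
      simp only [hT, smul_sub, Finset.sum_sub_distrib]; abel
    rw [e]
    refine (tn_add_le _ _).trans (add_le_add ((tn_add_le _ _).trans (add_le_add ?_ ?_)) hmean)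
    · refine (tn_sum_le _ _).trans (Finset.sum_le_sum fun i _ => ?_)
      refine (tn_smul_le _ _).trans (le_of_eq ?_)
      rw [abs_of_nonneg (ha0 i)]
    · refine tn_le_sqrt_trace_mul_hsSq hs.isHermitian hs.mul_self ?_
      simp only [hT, mul_sub, Finset.mul_sum, Matrix.mul_smul, hs.proj_mul_cut]
  refine (Finset.sum_le_sum fun ω _ => mul_le_mul_of_nonneg_left (hpt ω) (h.nonneg ω)).trans ?_
  simp only [mul_add, Finset.sum_add_distrib, ← Finset.sum_mul, h.sum_one, one_mul]
  have t1 : ∑ ω, P ω * ∑ i, a i * tn (σ (X i ω) - cut (X i ω)) ≤ ε + 2 * D := by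
    have : ∑ ω, P ω * ∑ i, a i * tn (σ (X i ω) - cut (X i ω)) =
        ∑ i, a i * ∑ ω, P ω * tn (σ (X i ω) - cut (X i ω)) := by
      simp only [Finset.mul_sum]
      rw [Finset.sum_comm]
      exact Finset.sum_congr rfl fun i _ => Finset.sum_congr rfl fun ω _ => by ring
    rw [this]
    simp only [h.marginal _ fun w => tn (σ w - cut w), ← Finset.sum_mul, ha, one_mul]
    exact hQcut
  have t2 : ∑ ω, P ω * (√(proj.trace.re) * √(hsSq (T ω))) ≤
      √(α * b ^ (n * (S - Sc + 2 * δ))) := by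
    have e : ∑ ω, P ω * (√(proj.trace.re) * √(hsSq (T ω))) =
        √(proj.trace.re) * ∑ ω, P ω * √(hsSq (T ω)) := by
      rw [Finset.mul_sum]; exact Finset.sum_congr rfl fun ω _ => by ring
    rw [e]
    have hsq : ∑ i, a i ^ 2 ≤ α := by
      calc ∑ i, a i ^ 2 ≤ ∑ i, α * a i := Finset.sum_le_sum fun i _ => by
            rw [sq]; exact mul_le_mul_of_nonneg_right (hα i) (ha0 i)
        _ = α := by rw [← Finset.mul_sum, ha, mul_one]
    have hα0 : 0 ≤ α := le_trans (Finset.sum_nonneg fun i _ => sq_nonneg (a i)) hsq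
    have hm := h.hsSq_second_moment_le a ha cut
    have hc : ∑ w, Q w * hsSq (cut w) ≤ b ^ (-(n * (Sc - δ))) := by
      calc _ ≤ ∑ w, Q w * b ^ (-(n * (Sc - δ))) := Finset.sum_le_sum fun w _ =>
            mul_le_mul_of_nonneg_left (hs.hsSq_cut_le w) (h.law_nonneg w)
        _ = _ := by rw [← Finset.sum_mul, h.law_sum, one_mul]
    have hm2 : ∑ ω, P ω * hsSq (T ω) ≤ α * b ^ (-(n * (Sc - δ))) :=
      hm.trans (mul_le_mul hsq hc (Finset.sum_nonneg fun w _ =>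
        mul_nonneg (h.law_nonneg w) (hsSq_nonneg _)) hα0)
    have hj := (average_sqrt_le h.nonneg h.sum_one.le fun ω => hsSq_nonneg (T ω)).trans
      (Real.sqrt_le_sqrt hm2)
    calc _ ≤ √(b ^ (n * (S + δ))) * √(α * b ^ (-(n * (Sc - δ)))) := by
          exact mul_le_mul (Real.sqrt_le_sqrt hs.trace_le) hj (Finset.sum_nonneg fun ω _ =>
            mul_nonneg (h.nonneg ω) (Real.sqrt_nonneg _)) (Real.sqrt_nonneg _)
      _ = √(α * (b ^ (n * (S + δ)) * b ^ (-(n * (Sc - δ))))) := by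
          rw [← Real.sqrt_mul (by positivity)]; congr 1; ring
      _ = _ := by
          rw [← Real.rpow_add hb0]; congr 3; ring
  rw [mul_add (n : ℝ)] at t2
  linarith

/-- On average the truncation keeps almost all the trace, while each truncated operator has trace at
most √(tr proj) times its Hilbert–Schmidt norm. A negative S - Sc would be incompatible with this
for large n. -/
lemma IsSmoothing.one_sub_le (hs : IsSmoothing (b := b) (n := n) s p S Sc δ ε proj cut)
    (hb : 1 < b) (hens : IsEnsemble s p) :
    1 - ε ≤ √(b ^ (n * (S - Sc + 2 * δ))) := by
  have hb0 : 0 < b := by linarith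
  set P : (Fin n → W) → ℝ := fun w => ∏ t, p (w t)
  have hP0 : ∀ w, 0 ≤ P w := fun w => Finset.prod_nonneg fun t _ => hens.nonneg _
  have hP1 : ∑ w, P w = 1 := sum_prod_eq_one (κ := fun _ => p) fun _ => hens.sum_one
  have hcut : ∀ w, (cut w).trace.re ≤ √(b ^ (n * (S - Sc + 2 * δ))) := by
    intro w
    refine (le_abs_self _).trans ((abs_re_trace_le_tn _).trans
      ((tn_le_sqrt_trace_mul_hsSq hs.isHermitian hs.mul_self (hs.proj_mul_cut w)).trans ?_))
    calc _ ≤ √(b ^ (n * (S + δ))) * √(b ^ (-(n * (Sc - δ)))) := by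
          gcongr
          · exact hs.trace_le
          · exact hs.hsSq_cut_le w
      _ = _ := by
          rw [← Real.sqrt_mul (by positivity), ← Real.rpow_add hb0]; congr 2; ring
  have htr : ∑ w : Fin n → W, P w * (tensorFamily fun t => s (w t)).trace.re = 1 := by
    have := (tensorPow_isDensity (n := n) hens.average_isDensity).2
    rw [← sum_prod_smul_tensorFamily, Matrix.trace_sum] at this
    have h2 := congrArg Complex.re this
    simpa only [Matrix.trace_smul, Complex.re_sum, smul_eq_mul, Complex.re_ofReal_mul,
      Complex.one_re] using h2
  have h1 : ∀ w, P w * (tensorFamily fun t => s (w t)).trace.re ≤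
      P w * tn (tensorFamily (fun t => s (w t)) - cut w) +
        P w * √(b ^ (n * (S - Sc + 2 * δ))) := by
    intro w
    rw [← mul_add]
    refine mul_le_mul_of_nonneg_left ?_ (hP0 w)
    have h3 := (le_abs_self _).trans (abs_re_trace_le_tn (tensorFamily (fun t => s (w t)) - cut w))
    rw [Matrix.trace_sub, Complex.sub_re] at h3
    linarith [hcut w]
  have h2 := Finset.sum_le_sum fun w (_ : w ∈ Finset.univ) => h1 w
  rw [htr, Finset.sum_add_distrib, ← Finset.sum_mul, hP1, one_mul] at h2
  linarith [hs.sum_tn_sub_cut_le]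

/-- The Holevo information is nonnegative. -/
lemma holevo_nonneg (hb : 1 < b) (hens : IsEnsemble s p) : 0 ≤ holevo b s p := by
  by_contra! hneg
  -- The exponent χ + 2δ becomes -2δ, so the right side of `one_sub_le` tends to 0 while the left
  -- side is 3/4.
  set δ : ℝ := -holevo b s p / 4 with hδ
  have hδ0 : 0 < δ := by rw [hδ]; linarith
  obtain ⟨N, hN⟩ := exists_isSmoothing hb hens hδ0 (ε := 1 / 4) (by norm_num)
  have hb0 : 0 < b := by linarith
  have hlim : ∀ᶠ n : ℕ in Filter.atTop, b ^ ((n : ℝ) * (-(2 * δ))) < 1 / 4 := by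
    have : Filter.Tendsto (fun n : ℕ => (b ^ (-(2 * δ))) ^ n) Filter.atTop (nhds 0) :=
      tendsto_pow_atTop_nhds_zero_of_lt_one (by positivity)
        (Real.rpow_lt_one_of_one_lt_of_neg hb (by linarith))
    filter_upwards [this.eventually (gt_mem_nhds (show (0 : ℝ) < 1 / 4 by norm_num))] with n hn
    rwa [mul_comm, Real.rpow_mul hb0.le, Real.rpow_natCast]
  obtain ⟨n, hn, hnN⟩ := (hlim.and (Filter.eventually_ge_atTop N)).exists
  obtain ⟨proj, cut, hs⟩ := hN n hnN
  have h1 := hs.one_sub_le hb hens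
  have e : vnEntropy b (∑ w, (p w : ℂ) • s w) - ∑ w, p w * vnEntropy b (s w) + 2 * δ =
      -(2 * δ) := by
    change holevo b s p + 2 * δ = _
    rw [hδ]; ring
  rw [e] at h1
  have h2 : √(b ^ ((n : ℝ) * (-(2 * δ)))) < 1 / 2 := by
    rw [Real.sqrt_lt' (by norm_num)]; linarith
  linarith

end Covering

/-! ### Converse to covering and monotonicity of Holevo information -/

section Converse

variable {H W : Type*} [Fintype H] [DecidableEq H] [Fintype W] {b : ℝ} {n : ℕ}
  {s : W → Matrix H H ℂ} {p : W → ℝ} {S Sc δ ε : ℝ}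
  {proj : Matrix (Fin n → H) (Fin n → H) ℂ}
  {cut : (Fin n → W) → Matrix (Fin n → H) (Fin n → H) ℂ}

lemma exists_range_projection {T : Matrix H H ℂ} (hT : T.IsHermitian) :
    ∃ P : Matrix H H ℂ, P.PosSemidef ∧ P.IsHermitian ∧ P * P = P ∧ IsContr P ∧ P * T = T ∧
      P.trace.re = T.rank := by
  obtain ⟨U, hU, h1, -⟩ := exists_specOp hT
  have hr := hT.rank_eq_card_non_zero_eigs
  generalize hT.eigenvalues = d at h1 hr
  classical
  refine ⟨specOp U fun i => if d i = 0 then 0 else 1, specOp_posSemidef _ fun i => ?_,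
    specOp_isHermitian _ _, ?_, isContr_specOp hU fun i => ?_, ?_, ?_⟩
  · split_ifs <;> norm_num
  · rw [specOp_mul hU]; congr 1; ext i; split_ifs <;> norm_num
  · split_ifs <;> norm_num
  · conv_rhs => rw [h1]
    rw [h1, specOp_mul hU]; congr 1; ext i; split_ifs with h <;> simp [h]
  · rw [specOp_trace hU, Complex.ofReal_re, hr, Fintype.card_subtype]
    simp [Finset.sum_ite]

lemma matrix_rank_add_le (S T : Matrix H H ℂ) : (S + T).rank ≤ S.rank + T.rank := by
  unfold Matrix.rank
  rw [Matrix.mulVecLin_add]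
  exact (Submodule.finrank_mono (LinearMap.range_add_le _ _)).trans
    (Submodule.finrank_add_le_finrank_add_finrank _ _)

lemma rank_sum_le {ι : Type*} (t : Finset ι) (T : ι → Matrix H H ℂ) :
    (∑ i ∈ t, T i).rank ≤ ∑ i ∈ t, (T i).rank := by
  classical
  induction t using Finset.induction_on with
  | empty => simp
  | insert a t ha ih =>
    rw [Finset.sum_insert ha, Finset.sum_insert ha]
    exact (matrix_rank_add_le _ _).trans (by gcongr)

/-- A covering of the average state needs about `b ^ (n (S - Sc))` states. -/
lemma IsSmoothing.converse (hs : IsSmoothing (b := b) (n := n) s p S Sc δ ε proj cut)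
    (hb : 1 < b) (hens : IsEnsemble s p) {I : Type*} [Fintype I] (a : I → ℝ)
    (ha0 : ∀ i, 0 ≤ a i) (w : I → Fin n → W) {ε₁ ε₂ : ℝ}
    (h1 : ∑ i, a i * tn (tensorFamily (fun t => s (w i t)) - cut (w i)) ≤ ε₁)
    (h2 : tn (∑ i, (a i : ℂ) • tensorFamily (fun t => s (w i t)) -
      tensorPow n (∑ w, (p w : ℂ) • s w)) ≤ ε₂) :
    1 - ε - 2 * (ε₁ + ε₂) ≤ Fintype.card I * b ^ (-(n * (S - Sc - 2 * δ))) := by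
  have hb0 : 0 < b := by linarith
  set σ := tensorPow n (∑ w, (p w : ℂ) • s w)
  have hσtr : σ.trace = 1 := (tensorPow_isDensity hens.average_isDensity).2
  set T := ∑ i, (a i : ℂ) • cut (w i) with hT
  have hherm : T.IsHermitian := by
    rw [hT, Matrix.IsHermitian, Matrix.conjTranspose_sum]
    refine Finset.sum_congr rfl fun i _ => ?_
    rw [Matrix.conjTranspose_smul, (hs.cut_isHermitian _).eq]; simp
  have hTσ : tn (σ - T) ≤ ε₁ + ε₂ := by
    have e : σ - T = ∑ i, (a i : ℂ) • (tensorFamily (fun t => s (w i t)) - cut (w i)) +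
        (σ - ∑ i, (a i : ℂ) • tensorFamily (fun t => s (w i t))) := by
      simp only [hT, smul_sub, Finset.sum_sub_distrib]; abel
    rw [e]
    refine (tn_add_le _ _).trans (add_le_add (le_trans ?_ h1) (by rwa [tn_sub_comm]))
    refine (tn_sum_le _ _).trans (Finset.sum_le_sum fun i _ => ?_)
    refine (tn_smul_le _ _).trans (le_of_eq ?_)
    rw [abs_of_nonneg (ha0 i)]
  -- `P` has rank at most |I| b^(n(Sc+δ)), yet it must capture most of the average state, whose
  -- compression has eigenvalues at most b^(-n(S-δ)).
  obtain ⟨P, hPpsd, hPh, hPP, hPc, hPT, hPr⟩ := exists_range_projection hherm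
  have hrank : P.trace.re ≤ Fintype.card I * b ^ (n * (Sc + δ)) := by
    rw [hPr]
    have h3 : (T.rank : ℝ) ≤ ∑ i, ((cut (w i)).rank : ℝ) := by
      rw [hT]
      refine le_trans (Nat.cast_le.2 (rank_sum_le _ _)) ?_
      rw [Nat.cast_sum]
      refine Finset.sum_le_sum fun i _ => Nat.cast_le.2 ?_
      have := Matrix.rank_mul_le_right ((a i : ℂ) • (1 : Matrix (Fin n → H) (Fin n → H) ℂ))
        (cut (w i))
      rwa [Matrix.smul_mul, Matrix.one_mul] at this
    refine h3.trans ((Finset.sum_le_sum fun i _ => hs.rank_cut_le _).trans (le_of_eq ?_))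
    simp
  have c1 : 1 - (ε₁ + ε₂) ≤ T.trace.re := by
    have := (le_abs_self _).trans (abs_re_trace_le_tn (σ - T))
    rw [Matrix.trace_sub, Complex.sub_re, hσtr, Complex.one_re] at this
    linarith
  have c2 : T.trace.re - (ε₁ + ε₂) ≤ (P * σ).trace.re := by
    have := (neg_le_abs _).trans (abs_re_trace_contr_le_tn hPc (σ - T))
    rw [mul_sub, hPT, Matrix.trace_sub, Complex.sub_re] at this
    linarith
  have c3 : (P * σ).trace.re ≤ ε + (P * (proj * σ * proj)).trace.re := by
    have := (re_trace_le_tn hPc (σ - proj * σ * proj)).trans hs.tn_compress_le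
    rw [mul_sub, Matrix.trace_sub, Complex.sub_re] at this
    linarith
  have c4 : (P * (proj * σ * proj)).trace.re ≤ b ^ (-(n * (S - δ))) * P.trace.re := by
    have h5 := re_trace_nonneg (hs.compress_le.mul_mul_conjTranspose_same P)
    rw [hPh.eq, Matrix.trace_mul_comm, ← mul_assoc, hPP, mul_sub, Matrix.trace_sub,
      Complex.sub_re, Matrix.mul_smul, mul_one, Matrix.trace_smul, smul_eq_mul,
      Complex.re_ofReal_mul] at h5
    linarith
  have c5 : b ^ (-(n * (S - δ))) * P.trace.re ≤
      Fintype.card I * b ^ (-(n * (S - Sc - 2 * δ))) := by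
    refine (mul_le_mul_of_nonneg_left hrank (by positivity)).trans (le_of_eq ?_)
    rw [mul_left_comm, ← Real.rpow_add hb0]; congr 2; ring
  linarith

lemma eventually_rpow_lt (hb : 1 < b) {δ ε : ℝ} (hδ : 0 < δ) (hε : 0 < ε) :
    ∃ N : ℕ, ∀ n : ℕ, N ≤ n → b ^ (-((n : ℝ) * δ)) < ε := by
  have hb0 : 0 < b := by linarith
  have : Filter.Tendsto (fun n : ℕ => (b ^ (-δ)) ^ n) Filter.atTop (nhds 0) :=
    tendsto_pow_atTop_nhds_zero_of_lt_one (by positivity)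
      (Real.rpow_lt_one_of_one_lt_of_neg hb (by linarith))
  obtain ⟨N, hN⟩ := Filter.eventually_atTop.1 (this.eventually (gt_mem_nhds hε))
  refine ⟨N, fun n hn => ?_⟩
  have := hN n hn
  rwa [← Real.rpow_natCast, ← Real.rpow_mul hb0.le, mul_comm, mul_neg] at this

/-- If coverings of the ensemble `s'` are coverings of the ensemble `s`, then `s'` has the larger
Holevo information. -/
lemma holevo_le_holevo_of_covering {H' : Type*} [Fintype H'] [DecidableEq H']
    {s' : W → Matrix H' H' ℂ} (hb : 1 < b) (hens : IsEnsemble s p) (hens' : IsEnsemble s' p)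
    (hred : ∀ (n M : ℕ) (a : Fin M → ℝ) (w : Fin M → Fin n → W),
      tn (∑ i, (a i : ℂ) • tensorFamily (fun t => s (w i t)) -
        tensorPow n (∑ w, (p w : ℂ) • s w)) ≤
      tn (∑ i, (a i : ℂ) • tensorFamily (fun t => s' (w i t)) -
        tensorPow n (∑ w, (p w : ℂ) • s' w))) :
    holevo b s p ≤ holevo b s' p := by
  by_contra! hlt
  have hb0 : 0 < b := by linarith
  set R := holevo b s p with hR
  set R' := holevo b s' p with hR'
  have hR'0 : 0 ≤ R' := holevo_nonneg hb hens'
  -- Rate R' + 3δ suffices to cover with `s'`, while the converse for `s` demands about R - 2δ = R'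
  -- + 4δ.
  set δ : ℝ := (R - R') / 6 with hδ
  have hδ0 : 0 < δ := by rw [hδ]; linarith
  obtain ⟨N₁, hN₁⟩ := exists_isSmoothing hb hens hδ0 (ε := 1 / 40) (by norm_num)
  obtain ⟨N₂, hN₂⟩ := exists_isSmoothing hb hens' hδ0 (ε := 1 / 40) (by norm_num)
  obtain ⟨N₃, hN₃⟩ := eventually_rpow_lt hb hδ0 (ε := 1 / 1600) (by norm_num)
  set n := max N₁ (max N₂ N₃)
  obtain ⟨proj, cut, hs⟩ := hN₁ n (le_max_left _ _)
  obtain ⟨proj', cut', hs'⟩ := hN₂ n ((le_max_left _ _).trans (le_max_right _ _))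
  have h3 := hN₃ n ((le_max_right _ _).trans (le_max_right _ _))
  set M := ⌈b ^ (n * (R' + 3 * δ))⌉₊ with hM
  have hge1 : 1 ≤ b ^ (n * (R' + 3 * δ)) := Real.one_le_rpow hb.le (by positivity)
  have hMge : b ^ (n * (R' + 3 * δ)) ≤ M := Nat.le_ceil _
  have hMle : (M : ℝ) ≤ 2 * b ^ (n * (R' + 3 * δ)) := by
    have := Nat.ceil_lt_add_one (zero_le_one.trans hge1)
    linarith
  have hM0 : (0 : ℝ) < M := by linarith
  have hlaw := pairwiseLaw_pi (I := Fin M) (S := Fin n → W) (Q := fun w => ∏ t, p (w t))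
    (fun w => Finset.prod_nonneg fun t _ => hens.nonneg _)
    (sum_prod_eq_one (κ := fun _ => p) fun _ => hens.sum_one)
  have hasum : ∑ _i : Fin M, (M : ℝ)⁻¹ = 1 := by
    rw [Finset.sum_const, Finset.card_univ, Fintype.card_fin, nsmul_eq_mul,
      mul_inv_cancel₀ hM0.ne']
  have hcov := hs'.covering hb hens' hlaw (a := fun _ => (M : ℝ)⁻¹) (fun _ => by positivity)
    hasum (α := (M : ℝ)⁻¹) fun _ => le_rfl
  simp only [sub_self, abs_zero, Finset.sum_const_zero, mul_zero, add_zero] at hcov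
  have e1 : vnEntropy b (∑ w, (p w : ℂ) • s' w) - ∑ w, p w * vnEntropy b (s' w) = R' := rfl
  have e2 : vnEntropy b (∑ w, (p w : ℂ) • s w) - ∑ w, p w * vnEntropy b (s w) = R := rfl
  rw [e1] at hcov
  have hsm : √((M : ℝ)⁻¹ * b ^ (n * (R' + 2 * δ))) ≤ 1 / 40 := by
    rw [Real.sqrt_le_left (by norm_num)]
    calc (M : ℝ)⁻¹ * b ^ (n * (R' + 2 * δ))
        ≤ (b ^ (n * (R' + 3 * δ)))⁻¹ * b ^ (n * (R' + 2 * δ)) := by gcongr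
      _ = b ^ (-(n * δ)) := by
          rw [← Real.rpow_neg hb0.le, ← Real.rpow_add hb0]; congr 1; ring
      _ ≤ _ := by norm_num at h3 ⊢; exact h3.le
  set P : (Fin M → Fin n → W) → ℝ := fun x => ∏ i, ∏ t, p (x i t)
  have hcut : ∑ x : Fin M → Fin n → W, P x *
      ∑ i, (M : ℝ)⁻¹ * tn (tensorFamily (fun t => s (x i t)) - cut (x i)) ≤ 1 / 40 := by
    have : ∑ x : Fin M → Fin n → W, P x *
        ∑ i, (M : ℝ)⁻¹ * tn (tensorFamily (fun t => s (x i t)) - cut (x i)) =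
        ∑ i : Fin M, (M : ℝ)⁻¹ * ∑ x : Fin M → Fin n → W, P x *
          tn (tensorFamily (fun t => s (x i t)) - cut (x i)) := by
      simp only [Finset.mul_sum]
      rw [Finset.sum_comm]
      exact Finset.sum_congr rfl fun i _ => Finset.sum_congr rfl fun ω _ => by ring
    rw [this]
    simp only [P, hlaw.marginal _ fun w => tn (tensorFamily (fun t => s (w t)) - cut w)]
    rw [← Finset.sum_mul, hasum, one_mul]
    exact hs.sum_tn_sub_cut_le
  -- One list must do both: cover well with `s'` and lose little under truncation for `s`.
  obtain ⟨x, hx⟩ := exists_le_of_average_le hlaw.nonneg hlaw.sum_one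
    (g := fun x => tn (∑ i, (((M : ℝ)⁻¹ : ℝ) : ℂ) • tensorFamily (fun t => s' (x i t)) -
        tensorPow n (∑ w, (p w : ℂ) • s' w)) +
      ∑ i, (M : ℝ)⁻¹ * tn (tensorFamily (fun t => s (x i t)) - cut (x i)))
    (e := 2 * (1 / 40) + 1 / 40 + 1 / 40) (by
      simp only [mul_add, Finset.sum_add_distrib]
      have := hcov.trans (add_le_add_right hsm (2 * (1 / 40)))
      exact add_le_add this hcut)
  have hcon := hs.converse hb hens (fun _ : Fin M => (M : ℝ)⁻¹) (fun _ => by positivity) x le_rfl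
    (hred n M (fun _ => (M : ℝ)⁻¹) x)
  rw [e2, Fintype.card_fin] at hcon
  have hfin : (M : ℝ) * b ^ (-(n * (R - 2 * δ))) ≤ 2 * b ^ (-(n * δ)) := by
    calc _ ≤ 2 * b ^ (n * (R' + 3 * δ)) * b ^ (-(n * (R - 2 * δ))) := by gcongr
      _ = _ := by
        rw [mul_assoc, ← Real.rpow_add hb0]
        have : R = R' + 6 * δ := by rw [hδ]; ring
        congr 2; rw [this]; ring
  linarith

end Converse

/-! ### Block-diagonal operators with a classical register -/

section Blocks

variable {A Y : Type*} [Fintype A] [DecidableEq A] [Fintype Y] [DecidableEq Y]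

lemma isContr_blockDiagonal {C : Y → Matrix A A ℂ} (hC : ∀ y, IsContr (C y)) :
    IsContr (Matrix.blockDiagonal C) := by
  have key : ∀ D : Y → Matrix A A ℂ, (∀ y v, vecSq ((D y).mulVec v) ≤ vecSq v) → ∀ v : A × Y → ℂ,
      vecSq ((Matrix.blockDiagonal D).mulVec v) ≤ vecSq v := by
    intro D hD v
    have e : ∀ a y, (Matrix.blockDiagonal D).mulVec v (a, y) =
        (D y).mulVec (fun a' => v (a', y)) a := by
      intro a y
      simp [Matrix.mulVec, dotProduct, Fintype.sum_prod_type, Matrix.blockDiagonal_apply]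
    unfold vecSq
    rw [Fintype.sum_prod_type_right, Fintype.sum_prod_type_right]
    refine Finset.sum_le_sum fun y _ => ?_
    simp only [e]
    exact hD y _
  refine ⟨key C fun y => (hC y).1, ?_⟩
  rw [Matrix.blockDiagonal_transpose]
  exact key _ fun y => (hC y).2

lemma IsContr.submatrix_equiv {H H' : Type*} [Fintype H] [Fintype H'] {C : Matrix H H ℂ}
    (hC : IsContr C) (e : H' ≃ H) : IsContr (C.submatrix e e) := by
  have key : ∀ D : Matrix H H ℂ, (∀ v, vecSq (D.mulVec v) ≤ vecSq v) → ∀ v : H' → ℂ,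
      vecSq ((D.submatrix e e).mulVec v) ≤ vecSq v := by
    intro D hD v
    have h1 : (D.submatrix e e).mulVec v = fun i => D.mulVec (v ∘ e.symm) (e i) := by
      rw [Matrix.submatrix_mulVec_equiv]; rfl
    have h2 : ∀ u : H → ℂ, vecSq (fun i => u (e i)) = vecSq u := fun u =>
      e.sum_comp fun i => ‖u i‖ ^ 2
    rw [h1, h2]
    refine (hD _).trans (le_of_eq ?_)
    exact e.symm.sum_comp fun i => ‖v i‖ ^ 2
  exact ⟨key C hC.1, by rw [Matrix.transpose_submatrix]; exact key _ hC.2⟩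

/-- A vector is extended by zero to the other blocks; restricting the result to one block only
lowers the norm. -/
lemma IsContr.block {C : Matrix (A × Y) (A × Y) ℂ} (hC : IsContr C) (y : Y) :
    IsContr (C.submatrix (fun a => (a, y)) fun a => (a, y)) := by
  have key : ∀ D : Matrix (A × Y) (A × Y) ℂ, (∀ v, vecSq (D.mulVec v) ≤ vecSq v) → ∀ v : A → ℂ,
      vecSq ((D.submatrix (fun a => (a, y)) fun a => (a, y)).mulVec v) ≤ vecSq v := by
    intro D hD v
    set u : A × Y → ℂ := fun x => if x.2 = y then v x.1 else 0 with hu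
    have h1 : vecSq u = vecSq v := by
      unfold vecSq
      rw [Fintype.sum_prod_type]
      refine Finset.sum_congr rfl fun a _ => ?_
      rw [Finset.sum_eq_single y] <;> simp +contextual [hu]
    have h2 : ∀ a, (D.submatrix (fun a => (a, y)) fun a => (a, y)).mulVec v a =
        D.mulVec u (a, y) := by
      intro a
      simp only [Matrix.mulVec, dotProduct, Fintype.sum_prod_type, Matrix.submatrix_apply]
      refine Finset.sum_congr rfl fun a' _ => ?_
      rw [Finset.sum_eq_single y] <;> simp +contextual [hu]
    rw [← h1]
    refine le_trans ?_ (hD u)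
    unfold vecSq
    rw [Fintype.sum_prod_type]
    refine Finset.sum_le_sum fun a _ => ?_
    rw [h2]
    exact Finset.single_le_sum (f := fun y' => ‖D.mulVec u (a, y')‖ ^ 2)
      (fun _ _ => sq_nonneg _) (Finset.mem_univ y)
  exact ⟨key C hC.1, by rw [Matrix.transpose_submatrix]; exact key _ hC.2⟩

/-- Only the diagonal blocks of a test contraction are seen, and these are contractions. The
transposes are the ones that measuring half of a purification produces. -/
lemma tn_blockDiagonal_transpose_le {T : Y → Matrix A A ℂ} {x : ℝ}
    (h : ∀ C : Y → Matrix A A ℂ, (∀ y, IsContr (C y)) → ∑ y, (C y * T y).trace.re ≤ x) :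
    tn (Matrix.blockDiagonal fun y => (T y).transpose) ≤ x :=
  tn_le fun C hC => by
    refine le_trans (le_of_eq ?_) (h (fun y => (C.submatrix (fun a => (a, y))
      fun a => (a, y)).transpose) fun y => (hC.block y).transpose)
    rw [← Complex.re_sum]
    congr 1
    simp only [Matrix.trace, Matrix.diag, Matrix.mul_apply,
      Matrix.transpose_apply, Matrix.submatrix_apply, Fintype.sum_prod_type,
      Matrix.blockDiagonal_apply]
    rw [Finset.sum_comm]
    refine Finset.sum_congr rfl fun y _ => ?_
    rw [Finset.sum_comm]
    refine Finset.sum_congr rfl fun a _ => ?_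
    simp

/-- The operator on `(A ⊗ Y)^{⊗ n}` with blocks `T y` on `A^{⊗ n}`. -/
def blockOp {n : ℕ} (T : (Fin n → Y) → Matrix (Fin n → A) (Fin n → A) ℂ) :
    Matrix (Fin n → A × Y) (Fin n → A × Y) ℂ :=
  (Matrix.blockDiagonal T).submatrix
    (Equiv.arrowProdEquivProdArrow (Fin n) (fun _ => A) (fun _ => Y))
    (Equiv.arrowProdEquivProdArrow (Fin n) (fun _ => A) (fun _ => Y))

lemma sum_re_trace_le_tn_blockOp {n : ℕ} (C T : (Fin n → Y) → Matrix (Fin n → A) (Fin n → A) ℂ)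
    (hC : ∀ y, IsContr (C y)) : ∑ y, (C y * T y).trace.re ≤ tn (blockOp T) := by
  have h := re_trace_le_tn ((isContr_blockDiagonal hC).submatrix_equiv
    (Equiv.arrowProdEquivProdArrow (Fin n) (fun _ => A) (fun _ => Y))) (blockOp T)
  refine le_trans (le_of_eq ?_) h
  rw [blockOp, Matrix.submatrix_mul_equiv, ← Matrix.blockDiagonal_mul]
  have : ∀ Z : Matrix ((Fin n → A) × (Fin n → Y)) ((Fin n → A) × (Fin n → Y)) ℂ,
      (Z.submatrix (Equiv.arrowProdEquivProdArrow (Fin n) (fun _ => A) (fun _ => Y))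
        (Equiv.arrowProdEquivProdArrow (Fin n) (fun _ => A) (fun _ => Y))).trace = Z.trace :=
    fun Z => (Equiv.arrowProdEquivProdArrow (Fin n) (fun _ => A) (fun _ => Y)).sum_comp
      fun i => Z i i
  rw [this, Matrix.trace_blockDiagonal, Complex.re_sum]

end Blocks

/-! ### The ensembles β and γ -/

section States

variable {A Y W : Type*} [Fintype A] [DecidableEq A] [Fintype Y] [DecidableEq Y] [Fintype W]
  {ρ : Matrix A A ℂ} {mu : W → Matrix A A ℂ} {p : W → Y → ℝ} {n : ℕ}

lemma sqrt_sandwich_posSemidef (hρ : IsDensity ρ) {X : Matrix A A ℂ} (hX : X.PosSemidef) :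
    (sqrtOp ρ * X * sqrtOp ρ).PosSemidef := by
  have := hX.mul_mul_conjTranspose_same (sqrtOp ρ)
  rwa [(sqrtOp_isHermitian hρ.1).eq] at this

lemma trace_sqrt_sandwich (hρ : ρ.PosSemidef) (X : Matrix A A ℂ) :
    (sqrtOp ρ * X * sqrtOp ρ).trace = (ρ * X).trace := by
  rw [Matrix.trace_mul_comm, ← mul_assoc, sqrtOp_mul_self hρ]

lemma trace_mul_eq_pW (hρ : IsDensity ρ) (hmu : IsPOVM mu) (w : W) :
    (ρ * mu w).trace = (pW ρ mu w : ℂ) := by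
  rw [pW, ← trace_sqrt_sandwich hρ.1]
  exact trace_eq_re (sqrt_sandwich_posSemidef hρ (hmu.1 w)).1

lemma pW_nonneg (hρ : IsDensity ρ) (hmu : IsPOVM mu) (w : W) : 0 ≤ pW ρ mu w := by
  rw [pW, ← trace_sqrt_sandwich hρ.1]
  exact re_trace_nonneg (sqrt_sandwich_posSemidef hρ (hmu.1 w))

lemma sum_pW (hρ : IsDensity ρ) (hmu : IsPOVM mu) : ∑ w, pW ρ mu w = 1 := by
  simp only [pW]
  rw [← Complex.re_sum, ← Matrix.trace_sum, ← Finset.mul_sum, hmu.2, mul_one, hρ.2,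
    Complex.one_re]

/-- At probability zero the right side is positive with zero trace, hence zero; the convention 0⁻¹ =
0 loses nothing. -/
lemma pW_smul_betaState (hρ : IsDensity ρ) (hmu : IsPOVM mu) (w : W) :
    (pW ρ mu w : ℂ) • betaState ρ mu w = sqrtOp ρ * mu w * sqrtOp ρ := by
  rw [betaState, smul_smul, ← Complex.ofReal_mul]
  by_cases h : pW ρ mu w = 0
  · have h0 : sqrtOp ρ * mu w * sqrtOp ρ = 0 := by
      rw [← (sqrt_sandwich_posSemidef hρ (hmu.1 w)).trace_eq_zero_iff, trace_sqrt_sandwich hρ.1,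
        trace_mul_eq_pW hρ hmu, h, Complex.ofReal_zero]
    rw [h0, smul_zero]
  · rw [mul_inv_cancel₀ h, Complex.ofReal_one, one_smul]

lemma betaState_posSemidef (hρ : IsDensity ρ) (hmu : IsPOVM mu) (w : W) :
    (betaState ρ mu w).PosSemidef :=
  (sqrt_sandwich_posSemidef hρ (hmu.1 w)).smul
    (Complex.zero_le_real.2 (inv_nonneg.2 (pW_nonneg hρ hmu w)))

lemma betaState_trace_re (hρ : IsDensity ρ) (w : W) :
    (betaState ρ mu w).trace.re = (pW ρ mu w)⁻¹ * pW ρ mu w := by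
  rw [betaState, Matrix.trace_smul, smul_eq_mul, Complex.re_ofReal_mul, trace_sqrt_sandwich hρ.1]
  rfl

lemma betaState_isEnsemble (hρ : IsDensity ρ) (hmu : IsPOVM mu) :
    IsEnsemble (betaState ρ mu) (pW ρ mu) where
  nonneg := pW_nonneg hρ hmu
  sum_one := sum_pW hρ hmu
  posSemidef := betaState_posSemidef hρ hmu
  trace_le w := by rw [betaState_trace_re hρ]; exact inv_mul_le_one
  mul_trace w := by
    rw [betaState_trace_re hρ, ← mul_assoc, mul_inv_mul_cancel]

lemma sum_pW_smul_betaState (hρ : IsDensity ρ) (hmu : IsPOVM mu) :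
    ∑ w, (pW ρ mu w : ℂ) • betaState ρ mu w = ρ := by
  simp only [pW_smul_betaState hρ hmu]
  rw [← Finset.sum_mul, ← Finset.mul_sum, hmu.2, mul_one, sqrtOp_mul_self hρ.1]

lemma gammaState_apply (w : W) (x x' : A × Y) :
    gammaState ρ mu p w x x' =
      if x.2 = x'.2 then (p w x.2 : ℂ) * betaState ρ mu w x.1 x'.1 else 0 := by
  simp only [gammaState, Matrix.sum_apply, Matrix.smul_apply, Matrix.kroneckerMap_apply,
    Matrix.single_apply, smul_eq_mul]
  rw [Finset.sum_eq_single x.2]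
  · by_cases h : x.2 = x'.2 <;> simp [h]
  · intro y _ hy; simp [hy]
  · simp

lemma gammaState_isEnsemble (hρ : IsDensity ρ) (hmu : IsPOVM mu) (hp : IsStochastic p) :
    IsEnsemble (gammaState ρ mu p) (pW ρ mu) := by
  have htr : ∀ w, (gammaState ρ mu p w).trace.re = (betaState ρ mu w).trace.re := by
    intro w
    have h1 : ∑ y, (p w y : ℂ) = 1 := by
      rw [← Complex.ofReal_sum, hp.2 w, Complex.ofReal_one]
    simp only [gammaState, Matrix.trace_sum, Matrix.trace_smul, Matrix.trace_kronecker,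
      Matrix.trace_single_eq_same, mul_one, smul_eq_mul, ← Finset.sum_mul, h1, one_mul]
  have hb := betaState_isEnsemble hρ hmu
  refine ⟨hb.nonneg, hb.sum_one, fun w => ?_, fun w => ?_, fun w => ?_⟩
  · refine Matrix.posSemidef_sum _ fun y _ => Matrix.PosSemidef.smul
      ((hb.posSemidef w).kronecker ?_) (Complex.zero_le_real.2 (hp.1 w y))
    rw [← Matrix.diagonal_single]
    refine Matrix.PosSemidef.diagonal fun i => ?_
    by_cases h : i = y
    · subst h; simp
    · simp [h]
  · rw [htr]; exact hb.trace_le w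
  · rw [htr]; exact hb.mul_trace w

/-- `p^n(y|w)`. -/
def prodKernel (p : W → Y → ℝ) (w : Fin n → W) (y : Fin n → Y) : ℝ := ∏ t, p (w t) (y t)

lemma prodKernel_nonneg (hp : IsStochastic p) (w : Fin n → W) (y : Fin n → Y) :
    0 ≤ prodKernel p w y := Finset.prod_nonneg fun _ _ => hp.1 _ _

lemma sum_prodKernel (hp : IsStochastic p) (w : Fin n → W) : ∑ y, prodKernel p w y = 1 :=
  sum_prod_eq_one (κ := fun t => p (w t)) fun _ => hp.2 _

lemma tensorFamily_gammaState (w : Fin n → W) :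
    tensorFamily (fun t => gammaState ρ mu p (w t)) =
      blockOp fun y => (prodKernel p w y : ℂ) • tensorFamily fun t => betaState ρ mu (w t) := by
  ext x x'
  simp only [tensorFamily, Matrix.of_apply, gammaState_apply, blockOp, Matrix.submatrix_apply,
    Matrix.blockDiagonal_apply, Matrix.smul_apply, smul_eq_mul, prodKernel,
    Equiv.arrowProdEquivProdArrow, Equiv.coe_fn_mk]
  by_cases h : (fun t => (x t).2) = fun t => (x' t).2
  · rw [if_pos h, Complex.ofReal_prod, ← Finset.prod_mul_distrib]
    refine Finset.prod_congr rfl fun t _ => ?_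
    rw [if_pos (congrFun h t)]
  · rw [if_neg h]
    obtain ⟨t, ht⟩ := Function.ne_iff.1 h
    exact Finset.prod_eq_zero (Finset.mem_univ t) (if_neg ht)

/-- The difference between a covering by the states `γ_w` and their average, in blocks. -/
lemma gammaState_covering_eq {I : Type*} [Fintype I] (a : I → ℝ) (w : I → Fin n → W)
    (P : W → ℝ) :
    ∑ i, (a i : ℂ) • tensorFamily (fun t => gammaState ρ mu p (w i t)) -
        tensorPow n (∑ w, (P w : ℂ) • gammaState ρ mu p w) =
      blockOp fun y => ∑ i, (a i : ℂ) •
          (prodKernel p (w i) y : ℂ) • tensorFamily (fun t => betaState ρ mu (w i t)) -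
        ∑ w : Fin n → W, ((∏ t, P (w t) : ℝ) : ℂ) •
          (prodKernel p w y : ℂ) • tensorFamily fun t => betaState ρ mu (w t) := by
  rw [← sum_prod_smul_tensorFamily]
  simp only [tensorFamily_gammaState]
  ext x x'
  simp only [blockOp, Matrix.sub_apply, Matrix.sum_apply, Matrix.smul_apply,
    Matrix.submatrix_apply, Matrix.blockDiagonal_apply]
  split_ifs <;> simp

/-- Monotonicity under discarding the classical register: one contraction is used in all blocks, and
the kernel sums to 1. -/
lemma tn_betaState_covering_le (hp : IsStochastic p) {I : Type*} [Fintype I] (a : I → ℝ)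
    (w : I → Fin n → W) (P : W → ℝ) :
    tn (∑ i, (a i : ℂ) • tensorFamily (fun t => betaState ρ mu (w i t)) -
        tensorPow n (∑ w, (P w : ℂ) • betaState ρ mu w)) ≤
      tn (∑ i, (a i : ℂ) • tensorFamily (fun t => gammaState ρ mu p (w i t)) -
        tensorPow n (∑ w, (P w : ℂ) • gammaState ρ mu p w)) := by
  rw [gammaState_covering_eq]
  refine tn_le fun C hC => le_trans (le_of_eq ?_)
    (sum_re_trace_le_tn_blockOp (fun _ => C) _ fun _ => hC)
  rw [← Complex.re_sum, ← Matrix.trace_sum, ← Finset.mul_sum, Finset.sum_sub_distrib,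
    ← sum_prod_smul_tensorFamily]
  have h1 : ∀ w : Fin n → W, ∑ y, (prodKernel p w y : ℂ) = 1 := fun w => by
    rw [← Complex.ofReal_sum, sum_prodKernel hp, Complex.ofReal_one]
  congr 5
  · rw [Finset.sum_comm]
    refine Finset.sum_congr rfl fun i _ => ?_
    rw [← Finset.smul_sum, ← Finset.sum_smul, h1, one_smul]
  · rw [Finset.sum_comm]
    refine Finset.sum_congr rfl fun i _ => ?_
    rw [← Finset.smul_sum, ← Finset.sum_smul, h1, one_smul]

lemma rateR_nonneg {b : ℝ} (hb : 1 < b) (hρ : IsDensity ρ) (hmu : IsPOVM mu) :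
    0 ≤ rateR b ρ mu := holevo_nonneg hb (betaState_isEnsemble hρ hmu)

lemma rateR_le_rateRC {b : ℝ} (hb : 1 < b) (hρ : IsDensity ρ) (hmu : IsPOVM mu)
    (hp : IsStochastic p) : rateR b ρ mu ≤ rateRC b ρ mu p :=
  holevo_le_holevo_of_covering hb (betaState_isEnsemble hρ hmu) (gammaState_isEnsemble hρ hmu hp)
    fun _ _ a w => tn_betaState_covering_le hp a w _

end States

/-! ### Explicit form of the original and simulated states -/

section Formulas

variable {H : Type*} [Fintype H] [DecidableEq H]

/-- Steering: an outcome on one half of the purification leaves the transposed sandwich √σ θ √σ on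
the reference. -/
lemma idTensor_measMap_ketbra {O : Type*} [DecidableEq O] {σ : Matrix H H ℂ} (hσ : σ.PosSemidef)
    (th : O → Matrix H H ℂ) (x x' : H × O) :
    idTensor H (measMap th) (ketbra (canonicalPurification σ)) x x' =
      if x.2 = x'.2 then (sqrtOp σ * th x.2 * sqrtOp σ) x'.1 x.1 else 0 := by
  have hs : ∀ a b, star (sqrtOp σ a b) = sqrtOp σ b a := fun a b => by
    rw [← Matrix.conjTranspose_apply, (sqrtOp_isHermitian hσ).eq]
  simp only [idTensor, measMap, Matrix.of_apply, LinearMap.coe_mk, AddHom.coe_mk,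
    Matrix.diagonal_apply]
  refine if_congr Iff.rfl ?_ rfl
  simp only [Matrix.trace, Matrix.diag, Matrix.mul_apply, Matrix.of_apply, ketbra,
    Matrix.vecMulVec_apply, canonicalPurification, Pi.star_apply, hs, Finset.sum_mul]
  refine Finset.sum_congr rfl fun h _ => Finset.sum_congr rfl fun h' _ => ?_
  ring

lemma idTensor_stochMap_apply {X W Y : Type*} [Fintype W] [DecidableEq Y] (p : W → Y → ℝ)
    (s : Matrix (X × W) (X × W) ℂ) (x x' : X × Y) :
    idTensor X (stochMap p) s x x' =
      if x.2 = x'.2 then ∑ w, (p w x.2 : ℂ) * s (x.1, w) (x'.1, w) else 0 := by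
  simp only [idTensor, stochMap, Matrix.of_apply, LinearMap.coe_mk, AddHom.coe_mk,
    Matrix.diagonal_apply]

lemma idTensor_measMap_apply {X O Y : Type*} [Fintype O] [DecidableEq O] [DecidableEq Y]
    (Δ : Y → Matrix O O ℂ) (s : Matrix (X × O) (X × O) ℂ) (x x' : X × Y) :
    idTensor X (measMap Δ) s x x' =
      if x.2 = x'.2 then ∑ o, ∑ o', s (x.1, o) (x'.1, o') * Δ x.2 o' o else 0 := by
  simp only [idTensor, measMap, Matrix.of_apply, LinearMap.coe_mk, AddHom.coe_mk,
    Matrix.diagonal_apply, Matrix.trace, Matrix.diag, Matrix.mul_apply]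

variable {A Y W : Type*} [Fintype A] [DecidableEq A] [Fintype Y] [DecidableEq Y] [Fintype W]
  {ρ : Matrix A A ℂ} {n : ℕ}

lemma IsTestTriple.sum_eq [DecidableEq W] {lam : Y → Matrix A A ℂ} {mu : W → Matrix A A ℂ}
    {p : W → Y → ℝ} (hρ : IsDensity ρ) (h : IsTestTriple ρ lam mu p) (y : Y) :
    ∑ w, (p w y : ℂ) • (sqrtOp ρ * mu w * sqrtOp ρ) = sqrtOp ρ * lam y * sqrtOp ρ := by
  ext a a'
  have := congrFun (congrFun h.2.2 (a', y)) (a, y)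
  rw [idTensor_stochMap_apply, idTensor_measMap_ketbra hρ.1, if_pos rfl, if_pos rfl] at this
  simp only [idTensor_measMap_ketbra hρ.1, if_true] at this
  rw [← this]
  simp [Matrix.sum_apply]

lemma alphaO_eq (hρ : IsDensity ρ) (lam : Y → Matrix A A ℂ) :
    alphaO n ρ lam = Matrix.blockDiagonal fun y =>
      (sqrtOp (tensorPow n ρ) * productPOVM n lam y * sqrtOp (tensorPow n ρ)).transpose := by
  ext x x'
  rw [alphaO, idTensor_measMap_ketbra (tensorPow_isDensity hρ).1, Matrix.blockDiagonal_apply]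
  rfl

lemma sqrtOp_inputState (hρ : IsDensity ρ) (K : ℕ) :
    sqrtOp (inputState n K ρ) = (((√(K : ℝ))⁻¹ : ℝ) : ℂ) •
      (sqrtOp (tensorPow n ρ) ⊗ₖ (1 : Matrix (Fin K) (Fin K) ℂ)) := by
  have hω := (tensorPow_isDensity (n := n) hρ).1
  refine sqrtOp_eq_of_mul_self (((sqrtOp_posSemidef hω).kronecker Matrix.PosSemidef.one).smul
    (Complex.zero_le_real.2 (by positivity))) ?_
  have h1 : ∑ k : Fin K, tensorPow n ρ ⊗ₖ Matrix.single k k (1 : ℂ) = tensorPow n ρ ⊗ₖ 1 := by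
    ext x x'
    simp only [Matrix.sum_apply, Matrix.kroneckerMap_apply, ← Finset.mul_sum, Matrix.one_apply,
      Matrix.single_apply]
    by_cases h : x.2 = x'.2
    · simp [h]
    · rw [if_neg h, Finset.sum_eq_zero]
      rintro k -
      rw [if_neg]
      rintro ⟨h1, h2⟩; exact h (h1.symm.trans h2)
  rw [inputState, h1, Matrix.smul_mul, Matrix.mul_smul, smul_smul, ← Matrix.mul_kronecker_mul,
    sqrtOp_mul_self hω, mul_one, ← Complex.ofReal_mul, ← mul_inv,
    Real.mul_self_sqrt (Nat.cast_nonneg K)]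
  simp

lemma inputState_posSemidef (hρ : IsDensity ρ) (K : ℕ) : (inputState n K ρ).PosSemidef := by
  refine Matrix.PosSemidef.smul (Matrix.posSemidef_sum _ fun k _ =>
    (tensorPow_isDensity hρ).1.kronecker ?_) ?_
  · rw [← Matrix.diagonal_single]
    refine Matrix.PosSemidef.diagonal fun i => ?_
    by_cases h : i = k
    · subst h; simp
    · simp [h]
  · rw [← Complex.ofReal_natCast, ← Complex.ofReal_inv, Complex.zero_le_real]
    positivity

/-- What reaches the decoder is diagonal, so only the diagonal of `Δ` matters; the factor 1/K comes
from the two square roots of the input state. -/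
lemma alphaS_eq {K : ℕ} {O : Type*} [Fintype O] [DecidableEq O] (hρ : IsDensity ρ)
    (th : Fin K → O → Matrix (Fin n → A) (Fin n → A) ℂ)
    (Δ : (Fin n → Y) → Matrix (Fin K × O) (Fin K × O) ℂ) :
    alphaS ρ th Δ = Matrix.blockDiagonal fun y =>
      (∑ k, ∑ o, ((K : ℂ)⁻¹ * Δ y (k, o) (k, o)) •
        (sqrtOp (tensorPow n ρ) * th k o * sqrtOp (tensorPow n ρ))).transpose := by
  have hblock : ∀ (k k₁ : Fin K) (o : O) (a a' : Fin n → A),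
      (sqrtOp (inputState n K ρ) * controlled th (k₁, o) * sqrtOp (inputState n K ρ))
        (a', k) (a, k) = if k = k₁ then
          (K : ℂ)⁻¹ * (sqrtOp (tensorPow n ρ) * th k o * sqrtOp (tensorPow n ρ)) a' a else 0 := by
    intro k k₁ o a a'
    rw [sqrtOp_inputState hρ, controlled, Matrix.smul_mul, Matrix.mul_smul, Matrix.smul_mul,
      smul_smul, ← Matrix.mul_kronecker_mul, ← Matrix.mul_kronecker_mul, one_mul, mul_one,
      ← Complex.ofReal_mul, ← mul_inv, Real.mul_self_sqrt (Nat.cast_nonneg K)]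
    simp only [Matrix.smul_apply, Matrix.kroneckerMap_apply, Matrix.single_apply, smul_eq_mul]
    by_cases h : k = k₁
    · subst h; simp
    · simp [h, Ne.symm h]
  ext x x'
  rw [alphaS, traceMiddle, Matrix.of_apply, Matrix.blockDiagonal_apply]
  simp only [idTensor_measMap_apply, idTensor_measMap_ketbra (inputState_posSemidef hρ K)]
  by_cases hy : x.2 = x'.2
  · simp only [if_pos hy, ite_mul, zero_mul, Finset.sum_ite_eq, Finset.mem_univ, if_true, hblock,
      Matrix.transpose_apply, Matrix.sum_apply, Matrix.smul_apply, smul_eq_mul,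
      Fintype.sum_prod_type]
    refine Finset.sum_congr rfl fun k _ => ?_
    rw [Finset.sum_eq_single k]
    · simp only [if_true]
      exact Finset.sum_congr rfl fun o _ => by ring
    · intro k₁ _ hk; simp [Ne.symm hk]
    · simp
  · simp [hy]

/-- Numerator and denominator factor over letters, which brings the operators of the protocol within
reach of the covering lemmas. -/
lemma codewordOp_eq {mu : W → Matrix A A ℂ} (hρ : IsDensity ρ) (hmu : IsPOVM mu)
    (w : Fin n → W) : codewordOp ρ mu w = tensorFamily fun t => betaState ρ mu (w t) := by
  have h1 : (tensorPow n ρ * productPOVM n mu w).trace = ∏ t, (pW ρ mu (w t) : ℂ) := by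
    rw [tensorPow, productPOVM, tensorFamily_mul, tensorFamily_trace]
    exact Finset.prod_congr rfl fun t _ => trace_mul_eq_pW hρ hmu _
  simp only [betaState]
  rw [tensorFamily_smul, codewordOp, h1, sqrtOp_tensorPow hρ.1, tensorPow, productPOVM,
    tensorFamily_mul, tensorFamily_mul]
  simp

/-- The test-triple identity tensorizes, so the target state is exactly the mean that the γ-covering
approximates. -/
lemma sqrt_sandwich_productPOVM_eq [DecidableEq W] {lam : Y → Matrix A A ℂ}
    {mu : W → Matrix A A ℂ} {p : W → Y → ℝ} (hρ : IsDensity ρ) (h : IsTestTriple ρ lam mu p)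
    (y : Fin n → Y) :
    sqrtOp (tensorPow n ρ) * productPOVM n lam y * sqrtOp (tensorPow n ρ) =
      ∑ w : Fin n → W, ((∏ t, pW ρ mu (w t) : ℝ) : ℂ) • (prodKernel p w y : ℂ) •
        tensorFamily fun t => betaState ρ mu (w t) := by
  rw [sqrtOp_tensorPow hρ.1, tensorPow, productPOVM, tensorFamily_mul, tensorFamily_mul]
  simp only [← h.sum_eq hρ, ← pW_smul_betaState hρ h.1]
  rw [tensorFamily_sum]
  refine Finset.sum_congr rfl fun w _ => ?_
  simp only [smul_smul]
  rw [tensorFamily_smul, prodKernel, ← Complex.ofReal_mul, ← Finset.prod_mul_distrib]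
  congr 1
  push_cast
  exact Finset.prod_congr rfl fun t _ => mul_comm _ _

end Formulas

/-! ### The operators of the simulating measurement -/

section Measurement

variable {A Y W : Type*} [Fintype A] [DecidableEq A] [Fintype Y] [DecidableEq Y] [Fintype W]
  {ρ : Matrix A A ℂ} {n K M B : ℕ} {mu : W → Matrix A A ℂ}
  (c : Fin K × Fin M × Fin B → (Fin n → W))

lemma codewordOp_posSemidef (hρ : IsDensity ρ) (hmu : IsPOVM mu) (w : Fin n → W) :
    (codewordOp ρ mu w).PosSemidef := by
  rw [codewordOp_eq hρ hmu]
  exact tensorFamily_posSemidef fun t => betaState_posSemidef hρ hmu _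

lemma tn_codewordOp_le (hρ : IsDensity ρ) (hmu : IsPOVM mu) (w : Fin n → W) :
    tn (codewordOp ρ mu w) ≤ 1 := by
  rw [codewordOp_eq hρ hmu]
  exact (betaState_isEnsemble hρ hmu).tn_tensorFamily_le w

lemma sHat_posSemidef (hρ : IsDensity ρ) (hmu : IsPOVM mu) (k : Fin K) :
    (sHat ρ mu c k).PosSemidef :=
  Matrix.posSemidef_sum _ fun _ _ => codewordOp_posSemidef hρ hmu _

lemma thetaHat_posSemidef (hρ : IsDensity ρ) (hmu : IsPOVM mu) (k : Fin K) (mb : Fin M × Fin B) :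
    (thetaHat ρ mu c k mb).PosSemidef := by
  have := (codewordOp_posSemidef hρ hmu (c (k, mb))).mul_mul_conjTranspose_same
    (invSqrtOp (sHat ρ mu c k))
  rwa [(invSqrtOp_isHermitian (sHat_posSemidef c hρ hmu k)).eq] at this

lemma sum_thetaHat (k : Fin K) :
    ∑ mb, thetaHat ρ mu c k mb =
      invSqrtOp (sHat ρ mu c k) * sHat ρ mu c k * invSqrtOp (sHat ρ mu c k) := by
  simp only [thetaHat]
  rw [← Finset.sum_mul, ← Finset.mul_sum]
  rfl

lemma thetaFull_posSemidef (hρ : IsDensity ρ) (hmu : IsPOVM mu) (k : Fin K)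
    (o : Option (Fin M × Fin B)) : (thetaFull ρ mu c k o).PosSemidef := by
  cases o with
  | none =>
    rw [thetaFull, sum_thetaHat]
    exact one_sub_invSqrtOp_sandwich_posSemidef (sHat_posSemidef c hρ hmu k)
  | some mb => exact thetaHat_posSemidef c hρ hmu k mb

lemma isPOVM_controlled_thetaFull (hρ : IsDensity ρ) (hmu : IsPOVM mu) :
    IsPOVM (controlled (thetaFull ρ mu c)) := by
  refine ⟨fun ko => (thetaFull_posSemidef c hρ hmu _ _).kronecker ?_, ?_⟩
  · rw [← Matrix.diagonal_single]
    refine Matrix.PosSemidef.diagonal fun i => ?_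
    by_cases h : i = ko.1
    · subst h; simp
    · simp [h]
  · have h1 : ∀ k, ∑ o, thetaFull ρ mu c k o = 1 := fun k => by
      rw [Fintype.sum_option]; simp [thetaFull]
    rw [Fintype.sum_prod_type]
    ext x x'
    simp only [controlled, Matrix.sum_apply, Matrix.kroneckerMap_apply, ← Finset.sum_mul]
    have h2 : ∀ k, ∑ o, thetaFull ρ mu c k o x.1 x'.1 =
        (1 : Matrix (Fin n → A) (Fin n → A) ℂ) x.1 x'.1 := fun k => by
      rw [← h1 k, Matrix.sum_apply]
    simp only [h2, ← Finset.mul_sum, Matrix.single_apply]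
    obtain ⟨a, k⟩ := x
    obtain ⟨a', k'⟩ := x'
    simp only [Matrix.one_apply, Prod.mk.injEq]
    by_cases hk : k = k'
    · subst hk; simp
    · have : ∀ i : Fin K, ¬(i = k ∧ i = k') := fun i hi => hk (hi.1.symm.trans hi.2)
      simp [hk, this]

lemma thetaSent_some (k : Fin K) (m : Fin M) :
    thetaSent ρ mu c k (some m) = ∑ b, thetaHat ρ mu c k (m, b) := by
  classical
  rw [thetaSent, Finset.sum_filter, Fintype.sum_option, Fintype.sum_prod_type]
  simp only [Option.map_none, Option.map_some, thetaFull, Option.some.injEq]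
  rw [if_neg (by simp), zero_add, Finset.sum_eq_single m]
  · simp
  · intro m' _ hm; simp [hm]
  · simp

lemma thetaSent_none (k : Fin K) :
    thetaSent ρ mu c k none = 1 - ∑ mb, thetaHat ρ mu c k mb := by
  rw [thetaSent, Finset.sum_filter, Fintype.sum_option]
  simp [thetaFull]

end Measurement

/-! ### From coverings to simulation -/

section Simulation

/-- Randomly post-processing an outcome does not enlarge its error, since the test contractions are
merely averaged. -/
lemma sum_re_trace_kernel_le {H Y : Type*} [Fintype H] [DecidableEq H] [Fintype Y]
    {C : Y → Matrix H H ℂ} (hC : ∀ y, IsContr (C y)) {π : Y → ℝ} (h0 : ∀ y, 0 ≤ π y)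
    (h1 : ∑ y, π y = 1) (X : Matrix H H ℂ) :
    ∑ y, (C y * ((π y : ℂ) • X)).trace.re ≤ tn X := by
  calc _ = ∑ y, π y * (C y * X).trace.re := Finset.sum_congr rfl fun y _ => by
        rw [Matrix.mul_smul, Matrix.trace_smul, smul_eq_mul, Complex.re_ofReal_mul]
    _ ≤ ∑ y, π y * tn X := Finset.sum_le_sum fun y _ =>
        mul_le_mul_of_nonneg_left (re_trace_le_tn (hC y) X) (h0 y)
    _ = tn X := by rw [← Finset.sum_mul, h1, one_mul]

variable {A Y W : Type*} [Fintype A] [DecidableEq A] [Fintype Y] [DecidableEq Y] [Fintype W]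
  [DecidableEq W] {ρ : Matrix A A ℂ} {n K M B : ℕ} {mu : W → Matrix A A ℂ}
  {lam : Y → Matrix A A ℂ} {p : W → Y → ℝ}

/-- What the measurement `θ̂_k` does on the purification, in terms of the quality of the covering. -/
lemma measurement_error_le (hρ : IsDensity ρ) (hmu : IsPOVM mu)
    (c : Fin K × Fin M × Fin B → (Fin n → W)) (w : Fin K × Fin M → (Fin n → W))
    (V : Finset (Fin K × Fin M × Fin B))
    (hc : ∀ k m b, (k, m, b) ∉ V → c (k, m, b) = w (k, m)) (hM : 0 < M) (hB : 0 < B)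
    (k : Fin K) :
    ∑ mb : Fin M × Fin B, tn (sqrtOp (tensorPow n ρ) * thetaHat ρ mu c k mb *
          sqrtOp (tensorPow n ρ) - (((M * B : ℝ)⁻¹ : ℝ) : ℂ) • codewordOp ρ mu (w (k, mb.1))) +
        tn (sqrtOp (tensorPow n ρ) * (1 - ∑ mb, thetaHat ρ mu c k mb) *
          sqrtOp (tensorPow n ρ)) ≤
      4 * √(tn (∑ m, (((M : ℝ)⁻¹ : ℝ) : ℂ) • codewordOp ρ mu (w (k, m)) - tensorPow n ρ) +
          2 * ((∑ mb : Fin M × Fin B, if (k, mb) ∈ V then 1 else 0) / (M * B))) +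
        (tn (∑ m, (((M : ℝ)⁻¹ : ℝ) : ℂ) • codewordOp ρ mu (w (k, m)) - tensorPow n ρ) +
          2 * ((∑ mb : Fin M × Fin B, if (k, mb) ∈ V then 1 else 0) / (M * B))) +
        2 * ((∑ mb : Fin M × Fin B, if (k, mb) ∈ V then 1 else 0) / (M * B)) := by
  set ω := tensorPow n ρ
  have hω : IsDensity ω := tensorPow_isDensity hρ
  set N : ℝ := M * B with hNdef
  have hMr : (0 : ℝ) < M := by exact_mod_cast hM
  have hBr : (0 : ℝ) < B := by exact_mod_cast hB
  have hN : 0 < N := by positivity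
  set v : ℝ := (∑ mb : Fin M × Fin B, if (k, mb) ∈ V then 1 else 0) / N with hv
  set β : Fin M × Fin B → Matrix (Fin n → A) (Fin n → A) ℂ := fun mb => codewordOp ρ mu (c (k, mb))
  have hβ : ∀ mb, (β mb).PosSemidef := fun mb => codewordOp_posSemidef hρ hmu _
  have hS : sHat ρ mu c k = ∑ mb, β mb := rfl
  have htr : (∑ mb, β mb).trace.re ≤ N := by
    rw [Matrix.trace_sum, Complex.re_sum]
    calc _ ≤ ∑ _mb : Fin M × Fin B, (1 : ℝ) := Finset.sum_le_sum fun mb _ =>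
          (le_abs_self _).trans ((abs_re_trace_le_tn _).trans (tn_codewordOp_le hρ hmu _))
      _ = N := by simp [hNdef]
  have hpg := sum_tn_prettyGood_le hβ hω hN htr
  set t := tn (ω - ((N⁻¹ : ℝ) : ℂ) • ∑ mb, β mb) with ht
  set u := tn (∑ m, (((M : ℝ)⁻¹ : ℝ) : ℂ) • codewordOp ρ mu (w (k, m)) - ω) with hu
  have hdiff : ∀ mb : Fin M × Fin B, tn (β mb - codewordOp ρ mu (w (k, mb.1))) ≤
      2 * if (k, mb) ∈ V then 1 else 0 := by
    rintro ⟨m, b⟩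
    split_ifs with hV
    · rw [sub_eq_add_neg]
      refine (tn_add_le _ _).trans ?_
      rw [tn_neg]
      linarith [tn_codewordOp_le hρ hmu (c (k, m, b)), tn_codewordOp_le hρ hmu (w (k, m))]
    · simp only [β]
      rw [hc k m b hV, sub_self, tn_zero, mul_zero]
  have hsumdiff : ∑ mb : Fin M × Fin B, tn (((N⁻¹ : ℝ) : ℂ) •
      (β mb - codewordOp ρ mu (w (k, mb.1)))) ≤ 2 * v := by
    calc _ ≤ ∑ mb : Fin M × Fin B, N⁻¹ * (2 * if (k, mb) ∈ V then 1 else 0) :=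
          Finset.sum_le_sum fun mb _ => (tn_smul_le _ _).trans (by
            rw [abs_of_pos (inv_pos.2 hN)]
            exact mul_le_mul_of_nonneg_left (hdiff mb) (inv_pos.2 hN).le)
      _ = 2 * v := by rw [← Finset.mul_sum, ← Finset.mul_sum, hv]; field_simp
  have hmean : ∑ m, (((M : ℝ)⁻¹ : ℝ) : ℂ) • codewordOp ρ mu (w (k, m)) =
      ∑ mb : Fin M × Fin B, ((N⁻¹ : ℝ) : ℂ) • codewordOp ρ mu (w (k, mb.1)) := by
    rw [Fintype.sum_prod_type]
    refine Finset.sum_congr rfl fun m _ => ?_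
    dsimp only
    rw [Finset.sum_const, Finset.card_univ, Fintype.card_fin, ← Nat.cast_smul_eq_nsmul ℂ,
      smul_smul]
    congr 1
    rw [← Complex.ofReal_natCast, ← Complex.ofReal_mul, hNdef]
    congr 1; field_simp
  have htu : t ≤ u + 2 * v := by
    have e : ω - ((N⁻¹ : ℝ) : ℂ) • ∑ mb, β mb =
        (ω - ∑ m, (((M : ℝ)⁻¹ : ℝ) : ℂ) • codewordOp ρ mu (w (k, m))) +
          -∑ mb : Fin M × Fin B, ((N⁻¹ : ℝ) : ℂ) • (β mb - codewordOp ρ mu (w (k, mb.1))) := by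
      rw [hmean]
      simp only [smul_sub, Finset.sum_sub_distrib, Finset.smul_sum]
      abel
    rw [ht, e]
    refine (tn_add_le _ _).trans ?_
    rw [tn_neg, tn_sub_comm]
    exact add_le_add le_rfl ((tn_sum_le _ _).trans hsumdiff)
  have ht0 : 0 ≤ t := tn_nonneg _
  have hsq : √t ≤ √(u + 2 * v) := Real.sqrt_le_sqrt htu
  set Θ : Fin M × Fin B → Matrix (Fin n → A) (Fin n → A) ℂ := fun mb =>
    sqrtOp ω * thetaHat ρ mu c k mb * sqrtOp ω
  have hpg' : ∑ mb, tn (Θ mb - ((N⁻¹ : ℝ) : ℂ) • β mb) ≤ 2 * √t := hpg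
  have a1 : ∑ mb : Fin M × Fin B, tn (Θ mb - ((N⁻¹ : ℝ) : ℂ) • codewordOp ρ mu (w (k, mb.1))) ≤
      2 * √t + 2 * v := by
    refine le_trans (Finset.sum_le_sum fun mb _ => tn_sub_le _ (((N⁻¹ : ℝ) : ℂ) • β mb) _) ?_
    rw [Finset.sum_add_distrib]
    refine add_le_add hpg' (le_trans (le_of_eq ?_) hsumdiff)
    exact Finset.sum_congr rfl fun mb _ => by rw [smul_sub]
  have hpsd0 : (1 - ∑ mb, thetaHat ρ mu c k mb).PosSemidef := by
    rw [sum_thetaHat]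
    exact one_sub_invSqrtOp_sandwich_posSemidef (sHat_posSemidef c hρ hmu k)
  -- The extra outcome takes the trace that the others leave over, so the two errors already bounded
  -- control it.
  have a2 : tn (sqrtOp ω * (1 - ∑ mb, thetaHat ρ mu c k mb) * sqrtOp ω) ≤ t + 2 * √t := by
    refine (tn_of_posSemidef_le (sqrt_sandwich_posSemidef hω hpsd0)).trans ?_
    have e : sqrtOp ω * (1 - ∑ mb, thetaHat ρ mu c k mb) * sqrtOp ω =
        (ω - ((N⁻¹ : ℝ) : ℂ) • ∑ mb, β mb) - ∑ mb, (Θ mb - ((N⁻¹ : ℝ) : ℂ) • β mb) := by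
      rw [mul_sub, sub_mul, mul_one, sqrtOp_mul_self hω.1, Finset.mul_sum, Finset.sum_mul,
        Finset.sum_sub_distrib, Finset.smul_sum]
      abel
    rw [e, Matrix.trace_sub, Complex.sub_re]
    have b1 := (le_abs_self _).trans (abs_re_trace_le_tn (ω - ((N⁻¹ : ℝ) : ℂ) • ∑ mb, β mb))
    have b2 := (neg_le_abs _).trans ((abs_re_trace_le_tn
      (∑ mb, (Θ mb - ((N⁻¹ : ℝ) : ℂ) • β mb))).trans ((tn_sum_le _ _).trans hpg'))
    linarith
  linarith

/-- A table that agrees, but for few entries, with a good covering simulates the measurement. -/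
lemma exists_decoder (hρ : IsDensity ρ) (hlam : IsPOVM lam) (h : IsTestTriple ρ lam mu p)
    (hK : 0 < K) (hM : 0 < M) (hB : 0 < B)
    (c : Fin K × Fin M × Fin B → (Fin n → W)) (w : Fin K × Fin M → (Fin n → W))
    (V : Finset (Fin K × Fin M × Fin B))
    (hc : ∀ k m b, (k, m, b) ∉ V → c (k, m, b) = w (k, m)) {e₁ e₂ v : ℝ}
    (h1 : ∑ k, (K : ℝ)⁻¹ * tn (∑ m, (((M : ℝ)⁻¹ : ℝ) : ℂ) •
      tensorFamily (fun t => betaState ρ mu (w (k, m) t)) - tensorPow n ρ) ≤ e₁)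
    (h2 : tn (∑ i, (((K * M : ℝ)⁻¹ : ℝ) : ℂ) • tensorFamily (fun t => gammaState ρ mu p (w i t)) -
      tensorPow n (∑ w, (pW ρ mu w : ℂ) • gammaState ρ mu p w)) ≤ e₂)
    (hv : (V.card : ℝ) / (K * M * B) ≤ v) :
    ∃ Δ : (Fin n → Y) → Matrix (Fin K × Option (Fin M)) (Fin K × Option (Fin M)) ℂ,
      IsPOVM Δ ∧ traceNorm (alphaO n ρ lam - alphaS ρ (thetaSent ρ mu c) Δ) ≤
        4 * √(e₁ + 2 * v) + (e₁ + 2 * v) + 2 * v + e₂ := by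
  have hp := h.2.1
  have hmu := h.1
  have hKr : (0 : ℝ) < K := by exact_mod_cast hK
  have hMr : (0 : ℝ) < M := by exact_mod_cast hM
  have hBr : (0 : ℝ) < B := by exact_mod_cast hB
  set ω := tensorPow n ρ with hωdef
  have hω : IsDensity ω := tensorPow_isDensity hρ
  -- The failure outcome is decoded like the first message; any choice would do, since its whole
  -- weight is counted as error.
  set dw : Fin K → Option (Fin M) → (Fin n → W) := fun k o => w (k, o.getD ⟨0, hM⟩) with hdw
  set Δ : (Fin n → Y) → Matrix (Fin K × Option (Fin M)) (Fin K × Option (Fin M)) ℂ := fun y =>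
    Matrix.diagonal fun ko => (prodKernel p (dw ko.1 ko.2) y : ℂ) with hΔ
  have hΔP : IsPOVM Δ := by
    refine ⟨fun y => Matrix.PosSemidef.diagonal fun ko =>
      Complex.zero_le_real.2 (prodKernel_nonneg hp _ _), ?_⟩
    ext i j
    simp only [hΔ, Matrix.sum_apply, Matrix.diagonal_apply, Matrix.one_apply]
    split_ifs
    · rw [← Complex.ofReal_sum, sum_prodKernel hp, Complex.ofReal_one]
    · simp
  refine ⟨Δ, hΔP, ?_⟩
  set Θ : Fin K → Fin M × Fin B → Matrix (Fin n → A) (Fin n → A) ℂ := fun k mb =>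
    sqrtOp ω * thetaHat ρ mu c k mb * sqrtOp ω with hΘ
  set Θ₀ : Fin K → Matrix (Fin n → A) (Fin n → A) ℂ := fun k =>
    sqrtOp ω * (1 - ∑ mb, thetaHat ρ mu c k mb) * sqrtOp ω with hΘ₀
  set β : Fin K × Fin M → Matrix (Fin n → A) (Fin n → A) ℂ := fun i =>
    tensorFamily fun t => betaState ρ mu (w i t) with hβ
  set N : ℝ := M * B with hN
  set G : (Fin n → Y) → Matrix (Fin n → A) (Fin n → A) ℂ := fun y =>
    sqrtOp ω * productPOVM n lam y * sqrtOp ω with hG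
  set D : (Fin n → Y) → Matrix (Fin n → A) (Fin n → A) ℂ := fun y =>
    ∑ i, (((K * M : ℝ)⁻¹ : ℝ) : ℂ) • (prodKernel p (w i) y : ℂ) • β i - G y with hD
  have hDtn : tn (blockOp D) ≤ e₂ := by
    rw [gammaState_covering_eq] at h2
    refine le_trans (le_of_eq ?_) h2
    congr 2
    ext1 y
    simp only [hD, hG, sqrt_sandwich_productPOVM_eq hρ h, hβ, hωdef]
  have hs : ∀ y, ∑ k, ∑ o, ((K : ℂ)⁻¹ * Δ y (k, o) (k, o)) •
      (sqrtOp ω * thetaSent ρ mu c k o * sqrtOp ω) =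
      ∑ k, (((K : ℝ)⁻¹ : ℝ) : ℂ) • (∑ mb : Fin M × Fin B,
        (prodKernel p (w (k, mb.1)) y : ℂ) • Θ k mb +
          (prodKernel p (dw k none) y : ℂ) • Θ₀ k) := by
    intro y
    refine Finset.sum_congr rfl fun k _ => ?_
    rw [Fintype.sum_option, Fintype.sum_prod_type, smul_add, add_comm, Finset.smul_sum]
    congr 1
    · refine Finset.sum_congr rfl fun m _ => ?_
      rw [thetaSent_some, Finset.mul_sum, Finset.sum_mul, Finset.smul_sum, Finset.smul_sum]
      refine Finset.sum_congr rfl fun b _ => ?_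
      rw [smul_smul]
      simp [hΔ, hdw, hΘ]
    · rw [thetaSent_none, smul_smul]
      simp [hΔ, hΘ₀]
  set T : (Fin n → Y) → Matrix (Fin n → A) (Fin n → A) ℂ := fun y => G y -
    ∑ k, (((K : ℝ)⁻¹ : ℝ) : ℂ) • (∑ mb : Fin M × Fin B,
        (prodKernel p (w (k, mb.1)) y : ℂ) • Θ k mb +
          (prodKernel p (dw k none) y : ℂ) • Θ₀ k) with hT
  have hdiff : alphaO n ρ lam - alphaS ρ (thetaSent ρ mu c) Δ =
      Matrix.blockDiagonal fun y => (T y).transpose := by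
    rw [alphaO_eq hρ, alphaS_eq hρ, ← Matrix.blockDiagonal_sub]
    congr 1
    ext1 y
    rw [Pi.sub_apply, ← Matrix.transpose_sub, hs y]
  have hΘpsd : ∀ k mb, (Θ k mb).PosSemidef := fun k mb =>
    sqrt_sandwich_posSemidef hω (thetaHat_posSemidef c hρ hmu k mb)
  have hΘ₀psd : ∀ k, (Θ₀ k).PosSemidef := fun k =>
    sqrt_sandwich_posSemidef hω (thetaFull_posSemidef c hρ hmu k none)
  have hTherm : ∀ y, (T y).IsHermitian := by
    intro y
    refine Matrix.IsHermitian.sub (sqrt_sandwich_posSemidef hω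
      (tensorFamily_posSemidef fun t => hlam.1 _)).1 (Matrix.PosSemidef.isHermitian ?_)
    refine Matrix.posSemidef_sum _ fun k _ => Matrix.PosSemidef.smul (Matrix.PosSemidef.add
      (Matrix.posSemidef_sum _ fun mb _ => (hΘpsd k mb).smul
        (Complex.zero_le_real.2 (prodKernel_nonneg hp _ _)))
      ((hΘ₀psd k).smul (Complex.zero_le_real.2 (prodKernel_nonneg hp _ _))))
      (Complex.zero_le_real.2 (by positivity))
  have hherm : (Matrix.blockDiagonal fun y => (T y).transpose).IsHermitian := by
    rw [Matrix.IsHermitian, Matrix.blockDiagonal_conjTranspose]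
    congr 1
    ext1 y
    exact (hTherm y).transpose
  rw [hdiff]
  refine (traceNorm_le_tn hherm).trans (tn_blockDiagonal_transpose_le fun C hC => ?_)
  -- Two errors separate: `D` compares the γ-covering with the target, the rest compares the
  -- measured operators with the ideal `N⁻¹`-weighted β.
  have hTe : ∀ y, C y * T y = -C y * D y +
      ∑ k, (((K : ℝ)⁻¹ : ℝ) : ℂ) • (∑ mb : Fin M × Fin B, -C y *
        ((prodKernel p (w (k, mb.1)) y : ℂ) • (Θ k mb - ((N⁻¹ : ℝ) : ℂ) • β (k, mb.1))) +
          -C y * ((prodKernel p (dw k none) y : ℂ) • Θ₀ k)) := by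
    intro y
    have e1 : ∑ i, (((K * M : ℝ)⁻¹ : ℝ) : ℂ) • (prodKernel p (w i) y : ℂ) • β i =
        ∑ k, (((K : ℝ)⁻¹ : ℝ) : ℂ) • ∑ mb : Fin M × Fin B,
          (prodKernel p (w (k, mb.1)) y : ℂ) • ((N⁻¹ : ℝ) : ℂ) • β (k, mb.1) := by
      rw [Fintype.sum_prod_type]
      refine Finset.sum_congr rfl fun k _ => ?_
      rw [Fintype.sum_prod_type, Finset.smul_sum]
      refine Finset.sum_congr rfl fun m _ => ?_
      dsimp only
      rw [Finset.sum_const, Finset.card_univ, Fintype.card_fin, ← Nat.cast_smul_eq_nsmul ℂ]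
      simp only [smul_smul]
      congr 1
      have : ((K * M : ℝ)⁻¹ : ℝ) = (K : ℝ)⁻¹ * (B * N⁻¹) := by rw [hN]; field_simp
      rw [this]
      push_cast
      ring
    have e2 : T y = -D y - ∑ k, (((K : ℝ)⁻¹ : ℝ) : ℂ) • (∑ mb : Fin M × Fin B,
        (prodKernel p (w (k, mb.1)) y : ℂ) • (Θ k mb - ((N⁻¹ : ℝ) : ℂ) • β (k, mb.1)) +
          (prodKernel p (dw k none) y : ℂ) • Θ₀ k) := by
      simp only [hT, hD]
      rw [e1]
      simp only [smul_sub, smul_add, Finset.sum_sub_distrib, Finset.sum_add_distrib]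
      abel
    rw [e2]
    simp only [mul_sub, mul_neg, neg_mul, Finset.mul_sum, Matrix.mul_smul, mul_add,
      Finset.sum_neg_distrib, smul_add, smul_neg, Finset.sum_add_distrib, Finset.sum_sub_distrib,
      smul_sub]
    abel
  have hC' : ∀ y, IsContr (-C y) := fun y => (hC y).neg
  have b1 : ∑ y, (-C y * D y).trace.re ≤ e₂ :=
    (sum_re_trace_le_tn_blockOp _ _ hC').trans hDtn
  have hswap : ∑ y, (C y * T y).trace.re = ∑ y, (-C y * D y).trace.re +
      ∑ k, (K : ℝ)⁻¹ * (∑ mb : Fin M × Fin B, ∑ y, (-C y *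
        ((prodKernel p (w (k, mb.1)) y : ℂ) •
          (Θ k mb - ((N⁻¹ : ℝ) : ℂ) • β (k, mb.1)))).trace.re +
          ∑ y, (-C y * ((prodKernel p (dw k none) y : ℂ) • Θ₀ k)).trace.re) := by
    simp only [hTe, Matrix.trace_add, Matrix.trace_sum, Matrix.trace_smul, Complex.add_re,
      Complex.re_sum, smul_eq_mul, Complex.re_ofReal_mul, Finset.sum_add_distrib]
    congr 1
    rw [Finset.sum_comm]
    refine Finset.sum_congr rfl fun k _ => ?_
    rw [← Finset.mul_sum, Finset.sum_add_distrib, Finset.sum_comm]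
  rw [hswap]
  set vk : Fin K → ℝ := fun k => (∑ mb : Fin M × Fin B, if (k, mb) ∈ V then 1 else 0) / N with hvk
  set uk : Fin K → ℝ := fun k => tn (∑ m, (((M : ℝ)⁻¹ : ℝ) : ℂ) • β (k, m) - ω) with huk
  have hvk0 : ∀ k, 0 ≤ vk k := fun k => div_nonneg (Finset.sum_nonneg fun _ _ => by
    split_ifs <;> norm_num) (by positivity)
  have hk : ∀ k, ∑ mb : Fin M × Fin B, ∑ y, (-C y * ((prodKernel p (w (k, mb.1)) y : ℂ) •
          (Θ k mb - ((N⁻¹ : ℝ) : ℂ) • β (k, mb.1)))).trace.re +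
          ∑ y, (-C y * ((prodKernel p (dw k none) y : ℂ) • Θ₀ k)).trace.re ≤
      4 * √(uk k + 2 * vk k) + (uk k + 2 * vk k) + 2 * vk k := by
    intro k
    have := measurement_error_le hρ hmu c w V hc hM hB k
    simp only [codewordOp_eq hρ hmu] at this
    refine le_trans (add_le_add (Finset.sum_le_sum fun mb _ => ?_) ?_) this
    · exact sum_re_trace_kernel_le hC' (prodKernel_nonneg hp _) (sum_prodKernel hp _) _
    · exact sum_re_trace_kernel_le hC' (prodKernel_nonneg hp _) (sum_prodKernel hp _) _
  have hKsum : ∑ _k : Fin K, (K : ℝ)⁻¹ = 1 := by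
    rw [Finset.sum_const, Finset.card_univ, Fintype.card_fin, nsmul_eq_mul,
      mul_inv_cancel₀ hKr.ne']
  have hvsum : ∑ k, (K : ℝ)⁻¹ * vk k ≤ v := by
    refine le_trans (le_of_eq ?_) hv
    have : (V.card : ℝ) = ∑ k, ∑ mb : Fin M × Fin B, if (k, mb) ∈ V then 1 else 0 := by
      rw [← Fintype.sum_prod_type' (f := fun k mb => if (k, mb) ∈ V then (1 : ℝ) else 0)]
      simp
    rw [this, ← Finset.mul_sum]
    simp only [hvk]
    rw [← Finset.sum_div, hN]
    field_simp
  have husum : ∑ k, (K : ℝ)⁻¹ * (uk k + 2 * vk k) ≤ e₁ + 2 * v := by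
    have e : ∑ k, (K : ℝ)⁻¹ * (uk k + 2 * vk k) =
        ∑ k, (K : ℝ)⁻¹ * uk k + 2 * ∑ k, (K : ℝ)⁻¹ * vk k := by
      rw [Finset.mul_sum, ← Finset.sum_add_distrib]
      exact Finset.sum_congr rfl fun k _ => by ring
    rw [e]
    have : ∑ k, (K : ℝ)⁻¹ * uk k ≤ e₁ := h1
    linarith
  -- By concavity of the root, covering quality is needed only on average over `k`.
  have hsqrt : ∑ k, (K : ℝ)⁻¹ * √(uk k + 2 * vk k) ≤ √(e₁ + 2 * v) :=
    (average_sqrt_le (fun _ => by positivity) hKsum.le fun k =>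
      add_nonneg (tn_nonneg _) (mul_nonneg zero_le_two (hvk0 k))).trans (Real.sqrt_le_sqrt husum)
  have hfin : ∑ k, (K : ℝ)⁻¹ * (4 * √(uk k + 2 * vk k) + (uk k + 2 * vk k) + 2 * vk k) ≤
      4 * √(e₁ + 2 * v) + (e₁ + 2 * v) + 2 * v := by
    have e : ∑ k, (K : ℝ)⁻¹ * (4 * √(uk k + 2 * vk k) + (uk k + 2 * vk k) + 2 * vk k) =
        4 * ∑ k, (K : ℝ)⁻¹ * √(uk k + 2 * vk k) + ∑ k, (K : ℝ)⁻¹ * (uk k + 2 * vk k) +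
          2 * ∑ k, (K : ℝ)⁻¹ * vk k := by
      rw [Finset.mul_sum, Finset.mul_sum, ← Finset.sum_add_distrib, ← Finset.sum_add_distrib]
      exact Finset.sum_congr rfl fun k _ => by ring
    rw [e]
    linarith
  have hb2 := (Finset.sum_le_sum fun k (_ : k ∈ Finset.univ) =>
    mul_le_mul_of_nonneg_left (hk k) (inv_pos.2 hKr).le).trans hfin
  linarith

end Simulation

/-! ### Affine codes and tables that exhaust them -/

section Cosets

variable {F : Type*} [Field F] {n : ℕ}

lemma isCosetOfLinearCode_range_affMap {ι : Type*} [Fintype ι] (vg : (Fin n → F) × (ι → Fin n → F)) :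
    IsCosetOfLinearCode (Set.range fun x : ι → F => affMap vg x) := by
  refine ⟨LinearMap.range (Fintype.linearCombination F vg.2), vg.1, ?_⟩
  ext y
  constructor
  · rintro ⟨x, rfl⟩
    exact ⟨Fintype.linearCombination F vg.2 x, ⟨x, rfl⟩, rfl⟩
  · rintro ⟨-, ⟨x, rfl⟩, rfl⟩
    exact ⟨x, rfl⟩

/-- A word chosen inside a bin is a value of one affine map with the bin generators adjoined, so all
candidates lie in one coset. -/
lemma affMap_affMap {E ι κ : Type*} [AddCommGroup E] [Module F E] [Fintype ι] [Fintype κ]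
    (vg : E × (ι → E)) (g : κ → E) (x : ι → F) (b : κ → F) :
    affMap (affMap vg x, g) b = affMap (vg.1, Sum.elim vg.2 g) (Sum.elim x b) := by
  simp [affMap, Fintype.sum_sum_type, add_assoc]

/-- A table which agrees with `w` off a set of `D.card` entries and whose range is `D`. -/
lemma exists_table {T : Type*} {K M B : ℕ} (w : Fin K × Fin M → T) (D : Finset T)
    (hw : ∀ i, w i ∈ D) (hD : D.card ≤ K * M * B) :
    ∃ (c : Fin K × Fin M × Fin B → T) (V : Finset (Fin K × Fin M × Fin B)),
      V.card = D.card ∧ (∀ k m b, (k, m, b) ∉ V → c (k, m, b) = w (k, m)) ∧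
        Set.range c = (D : Set T) := by
  -- Any set of `D.card` entries will do; it is overwritten by a bijective listing of `D`.
  obtain ⟨V, -, hV⟩ := Finset.exists_subset_card_eq
    (s := (Finset.univ : Finset (Fin K × Fin M × Fin B))) (n := D.card)
    (by simpa [mul_assoc] using hD)
  let e := Finset.equivOfCardEq hV
  classical
  refine ⟨fun x => if h : x ∈ V then e ⟨x, h⟩ else w (x.1, x.2.1), V, hV,
    fun k m b h => dif_neg h, ?_⟩
  ext y
  constructor
  · rintro ⟨x, rfl⟩
    by_cases h : x ∈ V
    · simp only [h, dif_pos]; exact (e ⟨x, h⟩).2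
    · simp only [h, dif_neg, not_false_iff]; exact hw _
  · intro hy
    refine ⟨e.symm ⟨y, hy⟩, ?_⟩
    simp

end Cosets

/-! ### Codeword lists with bounded repetition -/

section Grouping

/-- Within a residue class the quotient by `N` is injective, and the rounding term 1 is at most M/N.
-/
lemma card_mod_fiber_le {M N : ℕ} (hN : 0 < N) (hNM : N ≤ M) (r : ℕ) :
    ((Finset.univ.filter fun m : Fin M => (m : ℕ) % N = r).card : ℝ) ≤ 2 * M / N := by
  have h1 : (Finset.univ.filter fun m : Fin M => (m : ℕ) % N = r).card ≤ M / N + 1 := by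
    rw [← Finset.card_range (M / N + 1)]
    refine Finset.card_le_card_of_injOn (fun m => (m : ℕ) / N) (fun m _ => ?_) ?_
    · simp only [Finset.coe_range, Set.mem_Iio]
      exact Nat.lt_succ_of_le (Nat.div_le_div_right m.2.le)
    · intro a ha b hb hab
      simp only [Finset.coe_filter, Finset.mem_univ, true_and, Set.mem_ofPred_eq] at ha hb
      simp only at hab
      apply Fin.ext
      rw [← Nat.div_add_mod (a : ℕ) N, ← Nat.div_add_mod (b : ℕ) N, ha, hb, hab]
  have hNr : (0 : ℝ) < N := by exact_mod_cast hN
  calc ((Finset.univ.filter fun m : Fin M => (m : ℕ) % N = r).card : ℝ) ≤ ((M / N + 1 : ℕ) : ℝ) := by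
        exact_mod_cast h1
    _ ≤ (M : ℝ) / N + 1 := by push_cast; gcongr; exact Nat.cast_div_le
    _ ≤ (M : ℝ) / N + M / N := by
        gcongr
        rw [le_div_iff₀ hNr, one_mul]
        exact_mod_cast hNM
    _ = 2 * M / N := by ring

/-- A map `Fin M → T` with nearly equal fibres. -/
lemma exists_balanced_map (T : Type*) [Fintype T] [DecidableEq T] [Nonempty T] {M : ℕ}
    (h : Fintype.card T ≤ M) :
    ∃ f : Fin M → T, ∀ t, ((Finset.univ.filter fun m => f m = t).card : ℝ) ≤
      2 * M / Fintype.card T := by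
  let e := Fintype.equivFin T
  refine ⟨fun m => e.symm ⟨m % Fintype.card T, Nat.mod_lt _ Fintype.card_pos⟩, fun t => ?_⟩
  refine le_trans (le_of_eq ?_) (card_mod_fiber_le Fintype.card_pos h (e t))
  congr 2
  ext m
  simp only [Finset.mem_filter, Finset.mem_univ, true_and, Equiv.symm_apply_eq, Fin.ext_iff]

variable {W H : Type*} [Fintype W] [DecidableEq W] [Fintype H] [DecidableEq H]
  {b : ℝ} {n : ℕ} {s : W → Matrix H H ℂ} {p : W → ℝ} {S Sc δ ε : ℝ}
  {proj : Matrix (Fin n → H) (Fin n → H) ℂ} {cut : (Fin n → W) → Matrix (Fin n → H) (Fin n → H) ℂ}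

/-- Covering by a list of codewords in which each variable occurs at most `L` times. -/
lemma IsSmoothing.covering_list (hs : IsSmoothing (b := b) (n := n) s p S Sc δ ε proj cut)
    (hb : 1 < b) (hens : IsEnsemble s p) {Ω I J : Type*} [Fintype Ω] [Fintype I] [DecidableEq I]
    [Fintype J] [Nonempty J] {P : Ω → ℝ}
    {X : I → Ω → (Fin n → W)} {Q : (Fin n → W) → ℝ} (h : PairwiseLaw P X Q) (f : J → I) {L : ℝ}
    (hL : ∀ i, ((Finset.univ.filter fun j => f j = i).card : ℝ) ≤ L) :
    ∑ ω, P ω * tn (∑ j, (((Fintype.card J : ℝ)⁻¹ : ℝ) : ℂ) •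
        tensorFamily (fun t => s (X (f j) ω t)) - tensorPow n (∑ w, (p w : ℂ) • s w)) ≤
      2 * ε + 5 * ∑ w, |Q w - ∏ t, p (w t)| +
        √(L / Fintype.card J * b ^ (n * (S - Sc + 2 * δ))) := by
  have hJ : (0 : ℝ) < Fintype.card J := by exact_mod_cast Fintype.card_pos
  -- Repetitions are merged into weights, which restores pairwise independence of the summands.
  set a : I → ℝ := fun i => (Finset.univ.filter fun j => f j = i).card * (Fintype.card J : ℝ)⁻¹
    with hadef
  have hsum : ∑ i, a i = 1 := by
    rw [hadef, ← Finset.sum_mul, ← Nat.cast_sum, ← Finset.card_eq_sum_card_fiberwise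
      (fun _ _ => Finset.mem_coe.2 (Finset.mem_univ _)), Finset.card_univ, mul_inv_cancel₀ hJ.ne']
  have := hs.covering hb hens h (a := a) (fun i => by positivity) hsum (α := L / Fintype.card J)
    (fun i => by rw [div_eq_mul_inv]; exact mul_le_mul_of_nonneg_right (hL i) (by positivity))
  refine le_trans (le_of_eq (Finset.sum_congr rfl fun ω _ => ?_)) this
  congr 3
  rw [← Finset.sum_fiberwise (s := Finset.univ) (g := f)]
  refine Finset.sum_congr rfl fun i _ => ?_
  rw [Finset.sum_congr rfl (g := fun _ => (((Fintype.card J : ℝ)⁻¹ : ℝ) : ℂ) •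
        tensorFamily (fun t => s (X i ω t))) fun j hj => by rw [(Finset.mem_filter.1 hj).2],
    Finset.sum_const, ← Nat.cast_smul_eq_nsmul ℂ, smul_smul, hadef]
  simp

end Grouping

/-! ### Existence of a good code at one block length -/

section Existence

variable {A Y F : Type*} [Fintype A] [DecidableEq A] [Fintype Y] [DecidableEq Y]
  [Field F] [Fintype F] [DecidableEq F] {ρ : Matrix A A ℂ} {lam : Y → Matrix A A ℂ}
  {mu : F → Matrix A A ℂ} {p : F → Y → ℝ} {n K M B : ℕ}

/-- `v` bounds the overwritten fraction of the table. `e` bounds the sum of the expected β- and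
γ-covering errors, so that a single code serves both coverings. -/
lemma exists_cosetSimulates (hρ : IsDensity ρ) (hlam : IsPOVM lam) (h : IsTestTriple ρ lam mu p)
    {b : ℝ} (hb : 1 < b) (hK : 0 < K) (hM : 0 < M) (hB : 0 < B) {d₁ d₂ l : ℕ}
    (hd₁ : K ≤ Fintype.card F ^ d₁) (hd₂ : Fintype.card F ^ d₂ ≤ M)
    {δ ε ζ v : ℝ} {S Sc S' Sc' : ℝ}
    {proj : Matrix (Fin n → A) (Fin n → A) ℂ} {cut : (Fin n → F) → Matrix (Fin n → A) (Fin n → A) ℂ}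
    (hs : IsSmoothing (b := b) (n := n) (betaState ρ mu) (pW ρ mu) S Sc δ ε proj cut)
    {proj' : Matrix (Fin n → A × Y) (Fin n → A × Y) ℂ}
    {cut' : (Fin n → F) → Matrix (Fin n → A × Y) (Fin n → A × Y) ℂ}
    (hs' : IsSmoothing (b := b) (n := n) (gammaState ρ mu p) (pW ρ mu) S' Sc' δ ε proj' cut')
    (g : Fin l → Fin n → F)
    (hg : ∑ w, |binLaw F (fun w : Fin n → F => ∏ t, pW ρ mu (w t)) g w - ∏ t, pW ρ mu (w t)| ≤ ζ)
    (hv : (Fintype.card F : ℝ) ^ (d₁ + d₂ + l) / (K * M * B) ≤ v) (hv1 : v ≤ 1) {e : ℝ}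
    (he : (2 * ε + 5 * ζ +
        √(2 / (Fintype.card F : ℝ) ^ d₂ * b ^ (n * (S - Sc + 2 * δ)))) +
      (2 * ε + 5 * ζ +
        √(2 / (K * (Fintype.card F : ℝ) ^ d₂) * b ^ (n * (S' - Sc' + 2 * δ)))) ≤ e) :
    CosetSimulates ρ lam mu n K M B (4 * √(e + 2 * v) + (e + 2 * v) + 2 * v + e) := by
  classical
  have hmu := h.1
  have hKr : (0 : ℝ) < K := by exact_mod_cast hK
  have hMr : (0 : ℝ) < M := by exact_mod_cast hM
  have hBr : (0 : ℝ) < B := by exact_mod_cast hB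
  have hp0 : ∀ w : Fin n → F, 0 ≤ ∏ t, pW ρ mu (w t) :=
    fun w => Finset.prod_nonneg fun t _ => pW_nonneg hρ hmu _
  -- The random code: an affine map picks the bins, a conditional draw picks the word in each bin.
  have hlaw := (pairwiseLaw_affMap (F := F) (E := Fin n → F) (ι := Fin d₁ ⊕ Fin d₂)).select
    (κ := fun u b => binKernel (F := F) (fun w : Fin n → F => ∏ t, pW ρ mu (w t)) g u b)
    (fun u b => binKernel_nonneg hp0 g u b) (fun u => sum_binKernel _ g u)
    (fun u b => affMap (u, g) b)
  obtain ⟨φ₂, hφ₂⟩ := exists_balanced_map (Fin d₂ → F) (M := M) (by simpa using hd₂)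
  -- Injectivity keeps different `k` apart, so repetitions among all pairs (k,m) are no more
  -- frequent than among the messages alone.
  obtain ⟨φ₁⟩ : Nonempty (Fin K ↪ (Fin d₁ → F)) :=
    Function.Embedding.nonempty_of_card_le (by simpa using hd₁)
  have : Nonempty (Fin K) := ⟨⟨0, hK⟩⟩
  have : Nonempty (Fin M) := ⟨⟨0, hM⟩⟩
  have hcard : (Fintype.card (Fin d₂ → F) : ℝ) = (Fintype.card F : ℝ) ^ d₂ := by simp
  have hqd : (0 : ℝ) < (Fintype.card F : ℝ) ^ d₂ :=
    pow_pos (by exact_mod_cast Fintype.card_pos) _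
  rw [hcard] at hφ₂
  have hβ := fun k : Fin K => hs.covering_list hb (betaState_isEnsemble hρ hmu) hlaw
    (J := Fin M) (fun m => Sum.elim (φ₁ k) (φ₂ m)) (L := 2 * M / (Fintype.card F : ℝ) ^ d₂) (by
      intro i
      refine le_trans ?_ (hφ₂ fun j => i (Sum.inr j))
      exact_mod_cast Finset.card_le_card fun m hm => by
        simp only [Finset.mem_filter, Finset.mem_univ, true_and] at hm ⊢
        rw [← hm]; rfl)
  have hγ := hs'.covering_list hb (gammaState_isEnsemble hρ hmu h.2.1) hlaw
    (J := Fin K × Fin M) (fun km => Sum.elim (φ₁ km.1) (φ₂ km.2))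
    (L := 2 * M / (Fintype.card F : ℝ) ^ d₂) (by
      intro i
      refine le_trans ?_ (hφ₂ fun j => i (Sum.inr j))
      have : (Finset.univ.filter fun km : Fin K × Fin M =>
          Sum.elim (φ₁ km.1) (φ₂ km.2) = i).card ≤
          (Finset.univ.filter fun m => φ₂ m = fun j => i (Sum.inr j)).card := by
        refine Finset.card_le_card_of_injOn Prod.snd (fun km hm => ?_) ?_
        · simp only [Finset.coe_filter, Finset.mem_univ, true_and, Set.mem_ofPred_eq] at hm ⊢
          rw [← hm]; rfl
        · intro x hx y hy hxy
          simp only [Finset.coe_filter, Finset.mem_univ, true_and, Set.mem_ofPred_eq] at hx hy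
          refine Prod.ext (φ₁.injective (funext fun j => ?_)) hxy
          exact congrFun (hx.trans hy.symm) (Sum.inl j)
      exact_mod_cast this)
  rw [sum_pW_smul_betaState hρ hmu] at hβ
  rw [Fintype.card_fin] at hβ
  rw [Fintype.card_prod (Fin K) (Fin M), Fintype.card_fin, Fintype.card_fin, Nat.cast_mul] at hγ
  have e1 : 2 * (M : ℝ) / (Fintype.card F : ℝ) ^ d₂ / M = 2 / (Fintype.card F : ℝ) ^ d₂ := by
    field_simp
  have e2 : 2 * (M : ℝ) / (Fintype.card F : ℝ) ^ d₂ / (K * M) =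
      2 / (K * (Fintype.card F : ℝ) ^ d₂) := by
    field_simp
  rw [e1] at hβ
  rw [e2] at hγ
  set wd : (((Fin n → F) × (Fin d₁ ⊕ Fin d₂ → Fin n → F)) ×
      ((Fin d₁ ⊕ Fin d₂ → F) → (Fin l → F))) → Fin K × Fin M → (Fin n → F) := fun ω km =>
    affMap (affMap ω.1 (Sum.elim (φ₁ km.1) (φ₂ km.2)), g) (ω.2 (Sum.elim (φ₁ km.1) (φ₂ km.2)))
    with hwd
  have havg := exists_le_of_average_le hlaw.nonneg hlaw.sum_one (g := fun ω =>
      ∑ k, (K : ℝ)⁻¹ * tn (∑ m, (((M : ℝ)⁻¹ : ℝ) : ℂ) •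
        tensorFamily (fun t => betaState ρ mu (wd ω (k, m) t)) - tensorPow n ρ) +
      tn (∑ i, (((K * M : ℝ)⁻¹ : ℝ) : ℂ) •
        tensorFamily (fun t => gammaState ρ mu p (wd ω i t)) -
        tensorPow n (∑ w, (pW ρ mu w : ℂ) • gammaState ρ mu p w))) (e := e) (by
    refine le_trans ?_ he
    rw [Finset.sum_congr rfl fun ω _ => mul_add _ _ _, Finset.sum_add_distrib]
    refine add_le_add ?_ ?_
    · simp only [Finset.mul_sum]
      rw [Finset.sum_comm]
      refine (Finset.sum_le_sum fun k _ => ?_).trans (b := ∑ k : Fin K, (K : ℝ)⁻¹ *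
        (2 * ε + 5 * ζ + √(2 / (Fintype.card F : ℝ) ^ d₂ * b ^ (n * (S - Sc + 2 * δ))))) ?_
      · refine le_trans (le_of_eq ?_) (mul_le_mul_of_nonneg_left ((hβ k).trans
          (add_le_add_left (add_le_add_right (mul_le_mul_of_nonneg_left hg (by norm_num)) _) _))
          (by positivity))
        rw [Finset.mul_sum]
        exact Finset.sum_congr rfl fun ω _ => by ring
      · rw [Finset.sum_const, Finset.card_univ, Fintype.card_fin, nsmul_eq_mul, ← mul_assoc,
          mul_inv_cancel₀ hKr.ne', one_mul]
    · exact hγ.trans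
        (add_le_add_left (add_le_add_right (mul_le_mul_of_nonneg_left hg (by norm_num)) _) _))
  obtain ⟨ω, hω⟩ := havg
  have h1 : 0 ≤ ∑ k, (K : ℝ)⁻¹ * tn (∑ m, (((M : ℝ)⁻¹ : ℝ) : ℂ) •
        tensorFamily (fun t => betaState ρ mu (wd ω (k, m) t)) - tensorPow n ρ) :=
    Finset.sum_nonneg fun k _ => mul_nonneg (by positivity) (tn_nonneg _)
  have h2 := tn_nonneg (∑ i, (((K * M : ℝ)⁻¹ : ℝ) : ℂ) •
        tensorFamily (fun t => gammaState ρ mu p (wd ω i t)) -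
        tensorPow n (∑ w, (pW ρ mu w : ℂ) • gammaState ρ mu p w))
  -- The random affine map and the bin code together generate the coset that is to be the range.
  set gen : (Fin n → F) × ((Fin d₁ ⊕ Fin d₂) ⊕ Fin l → Fin n → F) :=
    (ω.1.1, Sum.elim ω.1.2 g) with hgen
  set D : Finset (Fin n → F) :=
    Finset.univ.image fun x : (Fin d₁ ⊕ Fin d₂) ⊕ Fin l → F => affMap gen x with hD
  have hDcard : (D.card : ℝ) ≤ (Fintype.card F : ℝ) ^ (d₁ + d₂ + l) := by
    have : D.card ≤ Fintype.card F ^ (d₁ + d₂ + l) := by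
      refine Finset.card_image_le.trans (le_of_eq ?_)
      simp
    exact_mod_cast this
  have hDv : (D.card : ℝ) / (K * M * B) ≤ v :=
    (div_le_div_of_nonneg_right hDcard (by positivity)).trans hv
  obtain ⟨c, V, hVc, hcV, hrange⟩ := exists_table (B := B) (wd ω) D
    (fun i => by simp only [hwd]; rw [affMap_affMap]; exact Finset.mem_image_of_mem _ (Finset.mem_univ _))
    (by
      have := hDv.trans hv1
      rw [div_le_one (by positivity)] at this
      exact_mod_cast this)
  refine ⟨c, ?_, isPOVM_controlled_thetaFull c hρ hmu,
    exists_decoder hρ hlam h hK hM hB c (wd ω) V hcV (by linarith) (by linarith)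
      (by rw [hVc]; exact hDv)⟩
  rw [hrange, hD, Finset.coe_image, Finset.coe_univ, Set.image_univ]
  exact isCosetOfLinearCode_range_affMap gen

end Existence

/-! ### Rounding of rates and the entropy bound -/

section Rates

lemma rpow_le_pow_ceil {q : ℝ} (hq : 1 < q) (x : ℝ) : q ^ x ≤ q ^ ⌈x⌉₊ := by
  rw [← Real.rpow_natCast]
  exact Real.rpow_le_rpow_of_exponent_le hq.le (Nat.le_ceil x)

lemma pow_ceil_le_mul_rpow {q x : ℝ} (hq : 1 < q) (hx : 0 ≤ x) : q ^ ⌈x⌉₊ ≤ q * q ^ x := by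
  have hq0 : 0 < q := by linarith
  rw [← Real.rpow_natCast, mul_comm, ← Real.rpow_add_one hq0.ne']
  exact Real.rpow_le_rpow_of_exponent_le hq.le (Nat.ceil_lt_add_one hx).le

lemma pow_floor_le_rpow {q x : ℝ} (hq : 1 < q) (hx : 0 ≤ x) : q ^ ⌊x⌋₊ ≤ q ^ x := by
  rw [← Real.rpow_natCast]
  exact Real.rpow_le_rpow_of_exponent_le hq.le (Nat.floor_le hx)

lemma rpow_le_mul_pow_floor {q : ℝ} (hq : 1 < q) (x : ℝ) : q ^ x ≤ q * q ^ ⌊x⌋₊ := by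
  have hq0 : 0 < q := by linarith
  rw [← Real.rpow_natCast, mul_comm, ← Real.rpow_add_one hq0.ne']
  exact Real.rpow_le_rpow_of_exponent_le hq.le (Nat.lt_floor_add_one x).le

lemma rpow_le_indexSize (q n : ℕ) (x : ℝ) : (q : ℝ) ^ ((n : ℝ) * x) ≤ indexSize q n x :=
  Nat.le_ceil _

lemma indexSize_pos {q : ℕ} (hq : 1 < q) (n : ℕ) (x : ℝ) : 0 < indexSize q n x :=
  Nat.ceil_pos.2 (Real.rpow_pos_of_pos (by exact_mod_cast zero_lt_one.trans hq) _)

lemma one_le_rpow_rate {q : ℕ} (hq : 1 < q) (n : ℕ) {x : ℝ} (hx : 0 ≤ x) :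
    1 ≤ (q : ℝ) ^ ((n : ℝ) * x) :=
  Real.one_le_rpow (by exact_mod_cast hq.le) (by positivity)

lemma indexSize_le {q : ℕ} (hq : 1 < q) (n : ℕ) {x : ℝ} (hx : 0 ≤ x) :
    (indexSize q n x : ℝ) ≤ 2 * (q : ℝ) ^ ((n : ℝ) * x) := by
  have h1 := one_le_rpow_rate hq n hx
  have h2 := (Nat.ceil_lt_add_one (zero_le_one.trans h1)).le
  rw [indexSize]
  linarith

/-- A constant factor `C` adds only log C / n to a rate. The threshold does not depend on `X` or
`x`, so one serves all index sizes. -/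
lemma eventually_logb_div_le {q : ℝ} (hq : 1 < q) {C η : ℝ} (hC : 0 < C) (hη : 0 < η) :
    ∃ N : ℕ, ∀ n : ℕ, N ≤ n → ∀ X x : ℝ, 0 < X → X ≤ C * q ^ ((n : ℝ) * x) →
      Real.logb q X / n ≤ x + η := by
  have hq0 : 0 < q := by linarith
  refine ⟨⌈Real.logb q C / η⌉₊ + 1, fun n hn X x hX hXC => ?_⟩
  have hn0 : (0 : ℝ) < n := by exact_mod_cast (Nat.succ_pos _).trans_le hn
  have hnC : Real.logb q C ≤ n * η := by
    rw [← div_le_iff₀ hη]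
    refine (Nat.le_ceil _).trans ?_
    exact_mod_cast (Nat.le_succ _).trans hn
  rw [div_le_iff₀ hn0]
  have h1 : Real.logb q X ≤ Real.logb q (C * q ^ ((n : ℝ) * x)) :=
    Real.logb_le_logb_of_le hq hX hXC
  rw [Real.logb_mul hC.ne' (Real.rpow_pos_of_pos hq0 _).ne',
    Real.logb_rpow hq0 hq.ne'] at h1
  linarith

/-- Gibbs: log t ≤ t - 1 at t = 1/(P w · |W|), weighted by `P w` and summed. -/
lemma shannon_le_logb_card {W : Type*} [Fintype W] [Nonempty W] {b : ℝ} (hb : 1 < b) {P : W → ℝ}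
    (h0 : ∀ w, 0 ≤ P w) (h1 : ∑ w, P w = 1) : shannon b P ≤ Real.logb b (Fintype.card W) := by
  have hlb : 0 < Real.log b := Real.log_pos hb
  have hc : (0 : ℝ) < Fintype.card W := by exact_mod_cast Fintype.card_pos
  have key : ∀ w, -(P w * Real.log (P w)) ≤
      P w * Real.log (Fintype.card W) + ((Fintype.card W : ℝ)⁻¹ - P w) := by
    intro w
    rcases (h0 w).eq_or_lt with h | h
    · rw [← h]; simp
    have := Real.log_le_sub_one_of_pos (x := (P w * Fintype.card W)⁻¹) (by positivity)
    rw [Real.log_inv, Real.log_mul h.ne' hc.ne'] at this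
    have h2 := mul_le_mul_of_nonneg_left this h.le
    have h3 : P w * ((P w * (Fintype.card W : ℝ))⁻¹ - 1) = (Fintype.card W : ℝ)⁻¹ - P w := by
      field_simp
    rw [h3] at h2
    linarith
  have hsum := Finset.sum_le_sum fun w (_ : w ∈ Finset.univ) => key w
  rw [Finset.sum_add_distrib, ← Finset.sum_mul, h1, Finset.sum_sub_distrib, h1, Finset.sum_const,
    Finset.card_univ, nsmul_eq_mul, mul_inv_cancel₀ hc.ne', sub_self, add_zero, one_mul,
    Finset.sum_neg_distrib] at hsum
  have e : shannon b P = (-∑ w, P w * Real.log (P w)) / Real.log b := by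
    simp only [shannon, Real.logb, neg_div, Finset.sum_div, mul_div_assoc]
  rw [e, Real.logb]
  exact div_le_div_of_nonneg_right hsum hlb.le

end Rates

/-! ### Choice of parameters for large block length -/

section Asymptotics

variable {A Y F : Type*} [Fintype A] [DecidableEq A] [Fintype Y] [DecidableEq Y]
  [Field F] [Fintype F] [DecidableEq F] {ρ : Matrix A A ℂ} {lam : Y → Matrix A A ℂ}
  {mu : F → Matrix A A ℂ} {p : F → Y → ℝ}

/-- For large `n` there are linear bins of rate slightly above `1 - H(P)` with nearly equal masses. -/
lemma eventually_exists_uniform_bins {q : ℝ} (hq : q = Fintype.card F) {P : F → ℝ}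
    (h0 : ∀ w, 0 ≤ P w) (h1 : ∑ w, P w = 1) {δ ζ : ℝ} (hδ : 0 < δ) (hζ : 0 < ζ) :
    ∃ N : ℕ, ∀ n : ℕ, N ≤ n → ∀ l : ℕ, q ^ ((n : ℝ) * (1 - shannon q P + 2 * δ)) ≤ q ^ l →
      ∃ g : Fin l → Fin n → F,
        ∑ w, |binLaw F (fun w : Fin n → F => ∏ t, P (w t)) g w - ∏ t, P (w t)| ≤ ζ := by
  have hb : 1 < q := by rw [hq]; exact_mod_cast Fintype.one_lt_card (α := F)
  have hq0 : 0 < q := by linarith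
  obtain ⟨N₁, hN₁⟩ := exists_equipartition hb (P := P) (d := P) (μ := shannon q P) h0 h1
    (fun _ h => h) (by simp [shannon]) hδ (ε := ζ / 4) (by positivity)
  obtain ⟨N₂, hN₂⟩ := eventually_rpow_lt hb hδ (ε := (ζ / 2) ^ 2) (by positivity)
  refine ⟨max N₁ N₂, fun n hn l hl => ?_⟩
  -- With τ the upper typical probability, heavy words have mass at most ζ/4, and q^n τ / q^l ≤
  -- q^(-nδ).
  obtain ⟨g, hg⟩ := exists_uniform_bins (F := F) (ι := Fin l) (E := Fin n → F)
    (p := fun w => ∏ t, P (w t)) (fun w => Finset.prod_nonneg fun t _ => h0 _)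
    (sum_prod_eq_one (κ := fun _ => P) fun _ => h1)
    (τ := q ^ (-(n * (shannon q P - δ)))) (Real.rpow_nonneg hq0.le _)
  refine ⟨g, hg.trans ?_⟩
  have ht : ∑ w : Fin n → F, (∏ t, P (w t)) *
      (if q ^ (-(n * (shannon q P - δ))) < ∏ t, P (w t) then (1 : ℝ) else 0) ≤ ζ / 4 := by
    refine (Finset.sum_le_sum fun w _ => ?_).trans (hN₁ n (le_of_max_le_left hn))
    refine mul_le_mul_of_nonneg_left ?_ (Finset.prod_nonneg fun t _ => h0 _)
    split_ifs with ha hb hb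
    · exact absurd hb.2 (not_le.2 ha)
    · exact le_rfl
    · exact le_rfl
    · exact zero_le_one
  have hs : √((Fintype.card (Fin n → F) : ℝ) * q ^ (-(n * (shannon q P - δ))) /
      Fintype.card (Fin l → F)) ≤ ζ / 2 := by
    refine Real.sqrt_le_iff.2 ⟨by positivity, le_trans ?_ (hN₂ n (le_of_max_le_right hn)).le⟩
    have e1 : (Fintype.card (Fin n → F) : ℝ) = q ^ (n : ℝ) := by
      rw [Real.rpow_natCast, hq]; simp
    have e2 : (Fintype.card (Fin l → F) : ℝ) = q ^ l := by rw [hq]; simp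
    rw [e1, e2, div_le_iff₀ (by positivity)]
    refine le_trans (le_of_eq ?_) (mul_le_mul_of_nonneg_left hl (Real.rpow_nonneg hq0.le _))
    rw [← Real.rpow_add hq0, ← Real.rpow_add hq0]
    congr 1
    ring
  linarith

lemma CosetSimulates.mono {n K M B : ℕ} {η η' : ℝ} (h : CosetSimulates ρ lam mu n K M B η)
    (hη : η ≤ η') : CosetSimulates ρ lam mu n K M B η' := by
  obtain ⟨c, h1, h2, Δ, h3, h4⟩ := h
  exact ⟨c, h1, h2, Δ, h3, h4.trans hη⟩

lemma eventually_cosetSimulates (hρ : IsDensity ρ) (hlam : IsPOVM lam)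
    (h : IsTestTriple ρ lam mu p) {c r β : ℝ} (hadm : AdmissibleRates ρ mu p c r β) {η : ℝ}
    (hη : 0 < η) :
    ∃ N : ℕ, ∀ n : ℕ, N ≤ n → CosetSimulates ρ lam mu n (indexSize (Fintype.card F) n c)
      (indexSize (Fintype.card F) n r) (indexSize (Fintype.card F) n β) η := by
  obtain ⟨hc0, hr0, hβ0, hβ, htot, hmsg⟩ := hadm
  have hq1 : 1 < Fintype.card F := Fintype.one_lt_card
  obtain ⟨q, hq⟩ : ∃ q : ℝ, q = Fintype.card F := ⟨_, rfl⟩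
  have hb : 1 < q := by rw [hq]; exact_mod_cast hq1
  have hq0 : 0 < q := by linarith
  rw [← hq] at hβ htot hmsg
  rw [Real.logb_self_eq_one hb] at hβ htot hmsg
  set hh := 1 - shannon q (pW ρ mu) with hhdef
  have hR0 := rateR_nonneg hb hρ h.1
  set R := rateR q ρ mu with hRdef
  set RC := rateRC q ρ mu p with hRCdef
  obtain ⟨gap, hgap, hg1, hg2⟩ : ∃ gap : ℝ, 0 < gap ∧ gap ≤ r + β - hh - R ∧
      gap ≤ c + r + β - hh - RC :=
    ⟨min (r + β - hh - R) (c + r + β - hh - RC), lt_min (by linarith) (by linarith),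
      min_le_left _ _, min_le_right _ _⟩
  -- The effective message rate. It exceeds R, and c + r' exceeds RC, by at least gap/2; β ≤ hh
  -- gives r' ≤ r. With bins of rate hh + 2δ = hh + gap/4, the coset stays gap/4 below c + r + β.
  set r' := r + β - hh - gap / 2 with hr'
  set δ := gap / 8 with hδdef
  have hδ : 0 < δ := by positivity
  have hr'0 : 0 ≤ r' := by linarith
  -- The total error is 4√(3t) + 6t, and each summand is made at most η/2.
  obtain ⟨t, ht0, ht1, htη⟩ : ∃ t : ℝ, 0 < t ∧ t ≤ 1 ∧
      4 * √(t + 2 * t) + (t + 2 * t) + 2 * t + t ≤ η := by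
    refine ⟨min 1 (min (η / 12) ((η / 16) ^ 2)), by positivity, min_le_left _ _, ?_⟩
    set t := min 1 (min (η / 12) ((η / 16) ^ 2))
    have h1 : t ≤ η / 12 := (min_le_right _ _).trans (min_le_left _ _)
    have h2 : t ≤ (η / 16) ^ 2 := (min_le_right _ _).trans (min_le_right _ _)
    have h3 : √(t + 2 * t) ≤ η / 8 := Real.sqrt_le_iff.2 ⟨by positivity, by nlinarith⟩
    linarith
  -- With ε = t/16, ζ = t/40 and root term t/4, each covering error 2ε + 5ζ + t/4 is t/2, and the
  -- two add up to t.
  obtain ⟨N₁, hN₁⟩ := exists_isSmoothing hb (betaState_isEnsemble hρ h.1) hδ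
    (ε := t / 16) (by positivity)
  obtain ⟨N₂, hN₂⟩ := exists_isSmoothing hb (gammaState_isEnsemble hρ h.1 h.2.1) hδ
    (ε := t / 16) (by positivity)
  obtain ⟨N₃, hN₃⟩ := eventually_exists_uniform_bins hq (pW_nonneg hρ h.1) (sum_pW hρ h.1) hδ
    (ζ := t / 40) (by positivity)
  -- The first bound makes the root terms of the coverings at most t/4, the second the overwritten
  -- fraction at most t; the powers of `q` absorb the rounding of dimensions.
  obtain ⟨N₄, hN₄⟩ := eventually_rpow_lt hb (δ := gap / 4) (ε := min (t ^ 2 / (32 * q)) (t / q ^ 2))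
    (by positivity) (by positivity)
  refine ⟨max (max N₁ N₂) (max N₃ N₄), fun n hn => ?_⟩
  obtain ⟨proj, cut, hs⟩ := hN₁ n (by omega)
  obtain ⟨proj', cut', hs'⟩ := hN₂ n (by omega)
  have h4 := hN₄ n (by omega)
  have h4a := h4.le.trans (min_le_left _ _)
  have h4b := h4.le.trans (min_le_right _ _)
  have hhn : 0 ≤ (n : ℝ) * (hh + 2 * δ) := by
    have : 0 ≤ hh + 2 * δ := by linarith
    positivity
  obtain ⟨g, hg⟩ := hN₃ n (by omega) ⌈(n : ℝ) * (hh + 2 * δ)⌉₊ (rpow_le_pow_ceil hb _)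
  have hKq := rpow_le_indexSize (Fintype.card F) n c
  have hMq := rpow_le_indexSize (Fintype.card F) n r
  have hBq := rpow_le_indexSize (Fintype.card F) n β
  rw [← hq] at hKq hMq hBq
  have hfl := rpow_le_mul_pow_floor hb ((n : ℝ) * r')
  have hfl' := pow_floor_le_rpow hb (x := (n : ℝ) * r') (by positivity)
  have hce := pow_ceil_le_mul_rpow hb (x := (n : ℝ) * c) (by positivity)
  have hce' := pow_ceil_le_mul_rpow hb hhn
  have hpos : ∀ x : ℝ, 0 < q ^ x := fun x => Real.rpow_pos_of_pos hq0 x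
  have hsq : ∀ a : ℝ, a ≤ 2 * q * q ^ (-((n : ℝ) * (gap / 4))) → √a ≤ t / 4 := by
    intro a ha
    refine Real.sqrt_le_iff.2 ⟨by positivity, ha.trans ?_⟩
    calc 2 * q * q ^ (-((n : ℝ) * (gap / 4))) ≤ 2 * q * (t ^ 2 / (32 * q)) := by gcongr
      _ = (t / 4) ^ 2 := by field_simp; norm_num
  refine (exists_cosetSimulates hρ hlam h hb (indexSize_pos hq1 n c) (indexSize_pos hq1 n r)
    (indexSize_pos hq1 n β) (d₁ := ⌈(n : ℝ) * c⌉₊) (d₂ := ⌊(n : ℝ) * r'⌋₊) ?_ ?_ hs hs' g hg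
    (v := t) (e := t) ?_ ht1 ?_).mono htη
  · refine Nat.ceil_le.2 ?_
    push_cast
    rw [← hq]
    exact rpow_le_pow_ceil hb _
  · have : q ^ ⌊(n : ℝ) * r'⌋₊ ≤ indexSize (Fintype.card F) n r := by
      refine (hfl'.trans (Real.rpow_le_rpow_of_exponent_le hb.le ?_)).trans hMq
      exact mul_le_mul_of_nonneg_left (by linarith) (Nat.cast_nonneg n)
    rw [hq] at this
    exact_mod_cast this
  · rw [← hq, div_le_iff₀ (mul_pos (mul_pos ((hpos _).trans_le hKq) ((hpos _).trans_le hMq))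
      ((hpos _).trans_le hBq)), pow_add, pow_add]
    calc q ^ ⌈(n : ℝ) * c⌉₊ * q ^ ⌊(n : ℝ) * r'⌋₊ * q ^ ⌈(n : ℝ) * (hh + 2 * δ)⌉₊
        ≤ (q * q ^ ((n : ℝ) * c)) * q ^ ((n : ℝ) * r') * (q * q ^ ((n : ℝ) * (hh + 2 * δ))) := by
          gcongr
      _ = q ^ 2 * q ^ (-((n : ℝ) * (gap / 4))) *
          (q ^ ((n : ℝ) * c) * q ^ ((n : ℝ) * r) * q ^ ((n : ℝ) * β)) := by
          have e : q ^ ((n : ℝ) * r') * q ^ ((n : ℝ) * (hh + 2 * δ)) =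
              q ^ (-((n : ℝ) * (gap / 4))) * q ^ ((n : ℝ) * r) * q ^ ((n : ℝ) * β) := by
            rw [← Real.rpow_add hq0, ← Real.rpow_add hq0, ← Real.rpow_add hq0]
            congr 1
            rw [hr', hδdef]; ring
          linear_combination q ^ 2 * q ^ ((n : ℝ) * c) * e
      _ ≤ q ^ 2 * (t / q ^ 2) * (indexSize (Fintype.card F) n c * indexSize (Fintype.card F) n r *
          indexSize (Fintype.card F) n β) := by
          have := (hpos ((n : ℝ) * c)).le
          have := (hpos ((n : ℝ) * r)).le
          have := (hpos ((n : ℝ) * β)).le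
          gcongr
      _ = _ := by field_simp
  · have hd : 1 / q ^ ⌊(n : ℝ) * r'⌋₊ ≤ q * q ^ (-((n : ℝ) * r')) := by
      rw [div_le_iff₀ (by positivity), Real.rpow_neg hq0.le]
      calc (1 : ℝ) = q ^ ((n : ℝ) * r') * (q ^ ((n : ℝ) * r'))⁻¹ :=
            (mul_inv_cancel₀ (hpos _).ne').symm
        _ ≤ (q * q ^ ⌊(n : ℝ) * r'⌋₊) * (q ^ ((n : ℝ) * r'))⁻¹ :=
            mul_le_mul_of_nonneg_right hfl (inv_nonneg.2 (hpos _).le)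
        _ = _ := by ring
    have ha : √(2 / (Fintype.card F : ℝ) ^ ⌊(n : ℝ) * r'⌋₊ * q ^ ((n : ℝ) *
        (vnEntropy q (∑ w, (pW ρ mu w : ℂ) • betaState ρ mu w) -
          ∑ w, pW ρ mu w * vnEntropy q (betaState ρ mu w) + 2 * δ))) ≤ t / 4 := by
      apply hsq
      rw [← hq]
      change 2 / q ^ ⌊(n : ℝ) * r'⌋₊ * q ^ ((n : ℝ) * (R + 2 * δ)) ≤ _
      calc 2 / q ^ ⌊(n : ℝ) * r'⌋₊ * q ^ ((n : ℝ) * (R + 2 * δ))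
          = 2 * (1 / q ^ ⌊(n : ℝ) * r'⌋₊) * q ^ ((n : ℝ) * (R + 2 * δ)) := by ring
        _ ≤ 2 * (q * q ^ (-((n : ℝ) * r'))) * q ^ ((n : ℝ) * (R + 2 * δ)) := by
            have := (hpos ((n : ℝ) * (R + 2 * δ))).le
            gcongr
        _ = 2 * q * q ^ (-((n : ℝ) * r') + (n : ℝ) * (R + 2 * δ)) := by
            rw [Real.rpow_add hq0]; ring
        _ ≤ _ := by
            refine mul_le_mul_of_nonneg_left (Real.rpow_le_rpow_of_exponent_le hb.le ?_)
              (by positivity)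
            have := mul_le_mul_of_nonneg_left (show R + 2 * δ - r' ≤ -(gap / 4) by linarith)
              (Nat.cast_nonneg (α := ℝ) n)
            linarith
    have ha' : √(2 / (indexSize (Fintype.card F) n c * (Fintype.card F : ℝ) ^ ⌊(n : ℝ) * r'⌋₊) *
        q ^ ((n : ℝ) * (vnEntropy q (∑ w, (pW ρ mu w : ℂ) • gammaState ρ mu p w) -
          ∑ w, pW ρ mu w * vnEntropy q (gammaState ρ mu p w) + 2 * δ))) ≤ t / 4 := by
      apply hsq
      rw [← hq]
      change 2 / (indexSize (Fintype.card F) n c * q ^ ⌊(n : ℝ) * r'⌋₊) *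
        q ^ ((n : ℝ) * (RC + 2 * δ)) ≤ _
      have hKi : 1 / (indexSize (Fintype.card F) n c : ℝ) ≤ q ^ (-((n : ℝ) * c)) := by
        rw [Real.rpow_neg hq0.le, one_div]
        exact inv_anti₀ (hpos _) hKq
      calc 2 / (indexSize (Fintype.card F) n c * q ^ ⌊(n : ℝ) * r'⌋₊) *
            q ^ ((n : ℝ) * (RC + 2 * δ))
          = 2 * ((1 / (indexSize (Fintype.card F) n c : ℝ)) * (1 / q ^ ⌊(n : ℝ) * r'⌋₊)) *
            q ^ ((n : ℝ) * (RC + 2 * δ)) := by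
            rw [one_div_mul_one_div]; ring
        _ ≤ 2 * (q ^ (-((n : ℝ) * c)) * (q * q ^ (-((n : ℝ) * r')))) *
            q ^ ((n : ℝ) * (RC + 2 * δ)) := by
            have := (hpos ((n : ℝ) * (RC + 2 * δ))).le
            have := (hpos (-((n : ℝ) * c))).le
            gcongr
        _ = 2 * q * q ^ (-((n : ℝ) * c) + -((n : ℝ) * r') + (n : ℝ) * (RC + 2 * δ)) := by
            rw [Real.rpow_add hq0, Real.rpow_add hq0]; ring
        _ ≤ _ := by
            refine mul_le_mul_of_nonneg_left (Real.rpow_le_rpow_of_exponent_le hb.le ?_)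
              (by positivity)
            have := mul_le_mul_of_nonneg_left
              (show RC + 2 * δ - c - r' ≤ -(gap / 4) by linarith) (Nat.cast_nonneg (α := ℝ) n)
            linarith
    linarith

end Asymptotics

end POVMSim

end

theorem theorem2 {A Y F : Type*} [Fintype A] [DecidableEq A] [Fintype Y] [DecidableEq Y]
    [Field F] [Fintype F] [DecidableEq F]
    (ρ : Matrix A A ℂ) (hρ : POVMSim.IsDensity ρ)
    (lam : Y → Matrix A A ℂ) (hlam : POVMSim.IsPOVM lam)
    (mu : F → Matrix A A ℂ) (p : F → Y → ℝ) (hmu : POVMSim.IsTestTriple ρ lam mu p)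
    (q : ℕ) (hq : q = Fintype.card F) :
    (∀ c r β : ℝ, POVMSim.AdmissibleRates ρ mu p c r β →
      ∀ η : ℝ, 0 < η → ∃ N : ℕ, ∀ n : ℕ, N ≤ n →
        POVMSim.CosetSimulates ρ lam mu n (POVMSim.indexSize q n c) (POVMSim.indexSize q n r)
          (POVMSim.indexSize q n β) η ∧
        Real.logb q (POVMSim.indexSize q n c) / n ≤ c + η ∧
        Real.logb q (POVMSim.indexSize q n r + 1) / n ≤ r + η) ∧
    (∀ η : ℝ, 0 < η → ∃ c r β : ℝ, POVMSim.AdmissibleRates ρ mu p c r β ∧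
      ∃ N : ℕ, ∀ n : ℕ, N ≤ n →
        POVMSim.CosetSimulates ρ lam mu n (POVMSim.indexSize q n c) (POVMSim.indexSize q n r)
          (POVMSim.indexSize q n β) η ∧
        Real.logb q (POVMSim.indexSize q n c) / n ≤ POVMSim.rateRC q ρ mu p + η ∧
        Real.logb q (POVMSim.indexSize q n c * (POVMSim.indexSize q n r + 1)) / n ≤
          POVMSim.rateRC q ρ mu p + η ∧
        Real.logb q (POVMSim.indexSize q n r + 1) / n ≤ POVMSim.rateR q ρ mu + η) := by
  subst hq
  have hq1 : 1 < Fintype.card F := Fintype.one_lt_card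
  have hb : (1 : ℝ) < Fintype.card F := by exact_mod_cast hq1
  have hq0 : (0 : ℝ) < Fintype.card F := by linarith
  have key : ∀ c r β : ℝ, POVMSim.AdmissibleRates ρ mu p c r β → ∀ η η' : ℝ, 0 < η → 0 < η' →
      ∃ N : ℕ, ∀ n : ℕ, N ≤ n →
        POVMSim.CosetSimulates ρ lam mu n (POVMSim.indexSize (Fintype.card F) n c)
          (POVMSim.indexSize (Fintype.card F) n r) (POVMSim.indexSize (Fintype.card F) n β) η ∧
        Real.logb (Fintype.card F) (POVMSim.indexSize (Fintype.card F) n c) / n ≤ c + η' ∧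
        Real.logb (Fintype.card F) (POVMSim.indexSize (Fintype.card F) n c *
          (POVMSim.indexSize (Fintype.card F) n r + 1)) / n ≤ (c + r) + η' ∧
        Real.logb (Fintype.card F) (POVMSim.indexSize (Fintype.card F) n r + 1) / n ≤ r + η' := by
    intro c r β hadm η η' hη hη'
    obtain ⟨N₁, hN₁⟩ := POVMSim.eventually_cosetSimulates hρ hlam hmu hadm hη
    -- 6 = 2·3: rounding up at most doubles K, and M + 1 is at most three times its nominal size.
    obtain ⟨N₂, hN₂⟩ := POVMSim.eventually_logb_div_le hb (C := 6) (by norm_num) hη'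
    refine ⟨max N₁ N₂, fun n hn => ⟨hN₁ n (le_of_max_le_left hn), ?_⟩⟩
    specialize hN₂ n (le_of_max_le_right hn)
    have hK := POVMSim.indexSize_le hq1 n hadm.c_nonneg
    have hM := POVMSim.indexSize_le hq1 n hadm.r_nonneg
    have hK1 := POVMSim.one_le_rpow_rate hq1 n hadm.c_nonneg
    have hM1 := POVMSim.one_le_rpow_rate hq1 n hadm.r_nonneg
    have hK0 : (0 : ℝ) < POVMSim.indexSize (Fintype.card F) n c := by
      exact_mod_cast POVMSim.indexSize_pos hq1 n c
    refine ⟨hN₂ _ _ hK0 (by linarith), hN₂ _ _ (by positivity) ?_,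
      hN₂ _ _ (by positivity) (by linarith)⟩
    rw [mul_add (n : ℝ) c r, Real.rpow_add hq0]
    calc (POVMSim.indexSize (Fintype.card F) n c : ℝ) *
          (POVMSim.indexSize (Fintype.card F) n r + 1)
        ≤ (2 * (Fintype.card F : ℝ) ^ ((n : ℝ) * c)) * (3 * (Fintype.card F : ℝ) ^ ((n : ℝ) * r)) :=
          mul_le_mul hK (by linarith) (by positivity) (by positivity)
      _ = _ := by ring
  refine ⟨fun c r β hadm η hη => ?_, fun η hη => ?_⟩
  · obtain ⟨N, hN⟩ := key c r β hadm η η hη hη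
    exact ⟨N, fun n hn => ⟨(hN n hn).1, (hN n hn).2.1, (hN n hn).2.2.2⟩⟩
  · have hR := POVMSim.rateR_nonneg hb hρ hmu.1
    have hRC := POVMSim.rateR_le_rateRC hb hρ hmu.1 hmu.2.1
    have hH := POVMSim.shannon_le_logb_card hb (POVMSim.pW_nonneg hρ hmu.1)
      (POVMSim.sum_pW hρ hmu.1)
    -- Taking β maximal cancels log q - H in both rate conditions. Then c + r = RC + η/2 leaves η/2
    -- for rounding, and c ≥ 0 rests on R ≤ RC.
    have hadm : POVMSim.AdmissibleRates ρ mu p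
        (POVMSim.rateRC (Fintype.card F) ρ mu p - POVMSim.rateR (Fintype.card F) ρ mu + η / 4)
        (POVMSim.rateR (Fintype.card F) ρ mu + η / 4)
        (Real.logb (Fintype.card F) (Fintype.card F) -
          POVMSim.shannon (Fintype.card F) (POVMSim.pW ρ mu)) :=
      ⟨by linarith, by linarith, by linarith, le_rfl, by linarith, by linarith⟩
    obtain ⟨N, hN⟩ := key _ _ _ hadm η (η / 2) hη (by positivity)
    refine ⟨_, _, _, hadm, N, fun n hn => ?_⟩
    obtain ⟨h1, h2, h3, h4⟩ := hN n hn
    exact ⟨h1, h2.trans (by linarith), h3.trans (by linarith), h4.trans (by linarith)⟩
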